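/- **Localized error representation.** Let $d\in\{2,3\}$ and let $\Omega\subset\mathbb R^d$ be a bounded domain that is decomposed into a finite mesh $\mathcal T_h$ of pairwise disjoint open quadrilateral ($d=2$) or hexahedral ($d=3$) cells $K=T_K((0,1)^d)\subset\Omega$ with $\overline\Omega=\bigcup_K\overline K$, where each $T_K$ is multilinear, and injective with invertible Jacobian on $[0,1]^d$; hanging nodes are allowed. Let $\varepsilon>0$, $\boldsymbol b\in L^\infty(\Omega)^d$, $\alpha\in L^\infty(\Omega)$, $f\in L^2(\Omega)$, let $V=H^1_0(\Omega)$ and $$A(u)(\varphi)=(\varepsilon\nabla u,\nabla\varphi)+(\boldsymbol b\cdot\nabla u,\varphi)+(\alpha u,\varphi),\qquad F(\varphi)=(f,\varphi),$$ with $(\cdot,\cdot)$ the inner product of $L^2(\Omega)$. Let $J:V\to\mathbb R$ be three times differentiable and let $\{u,z\}\in V\times V$ be a stationary point of the Lagrangian $\mathcal L(u,z)=J(u)+F(z)-A(u)(z)$, i.e. $\mathcal L'(u,z)=0$. For $p\ge 0$ let $V_h^p$ be the space of all $v\in V\cap C(\overline\Omega)$ such that $v|_{\overline K}\circ T_K$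 is, for every $K$, a polynomial of degree at most $p$ in each variable. For real parameters $\delta_K$ let $u_h\in V_h^p$ solve the SUPG-stabilized problem $$A(u_h)(\varphi_h)+S(u_h)(\varphi_h)=F(\varphi_h)\quad\forall\varphi_h\in V_h^p,\qquad S(u_h)(\varphi_h)=\sum_{K}\delta_K\big(-\nabla\cdot(\varepsilon\nabla u_h)+\boldsymbol b\cdot\nabla u_h+\alpha u_h-f,\ \boldsymbol b\cdot\nabla\varphi_h\big)_K .$$ Put $e=u-u_h$ and $$\mathcal R_J=\tfrac12\int_0^1J'''(u_h+se)(e,e,e)\,s(s-1)\,ds,\qquad \Delta\rho_J=-\int_0^1J''(u_h+se)(e,e)\,ds,$$ where the integral in $\mathcal R_J$ is assumed to exist. Then for every $\varphi_h\in V_h^p$ the function $z-\varphi_h$ has a trace in $L^2(\partial K)$ for each $K\in\mathcal T_h$, all terms below are well defined, and $$J(u)-J(u_h)=\sum_{K\in\mathcal T_h}\Big\{\big(\mathcal R(u_h),z-\varphi_h\big)_K-\delta_K\big(\mathcal R(u_h),\boldsymbol b\cdot\nabla\varphi_h\big)_K-\big(\mathcal E(u_h),z-\varphi_h\big)_{\partial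 K}\Big\}+\mathcal R_J+\tfrac12\Delta\rho_J .$$ Here $\mathcal R(u_h)|_K=f+\nabla\cdot(\varepsilon\nabla u_h)-\boldsymbol b\cdot\nabla u_h-\alpha u_h$, and on $\partial K$ the edge residual is $\mathcal E(u_h)=0$ on $\partial\Omega$ and $\mathcal E(u_h)=\tfrac12\,\boldsymbol n\cdot\big(\varepsilon\nabla u_h|_K-\varepsilon\nabla u_h|_{K'}\big)$ on the part of $\partial K\setminus\partial\Omega$ shared with a neighbouring cell $K'$, $\boldsymbol n$ being the unit normal pointing from $K$ to $K'$. Thus the sum over cells approximates $J(u)-J(u_h)$ up to the neglected remainder $\mathcal R_J+\tfrac12\Delta\rho_J$, which is of higher order: if $\|J''\|\le C_2$, respectively $\|J'''\|\le C_3$, on the segment from $u_h$ to $u$, then $|\tfrac12\Delta\rho_J|\le\tfrac12C_2\|e\|_{H^1}^2$, respectively $|\mathcal R_J|\le\tfrac1{12}C_3\|e\|_{H^1}^3$. -/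

import Mathlib

open MeasureTheory Filter Topology Set

noncomputable section

namespace SUPG

/-- The physical space `ℝ^(n+1)` with its Euclidean norm. -/
abbrev E (n : ℕ) : Type := EuclideanSpace ℝ (Fin (n + 1))

/-! ### The space `H¹₀(Ω)` -/

/-- `L²(Ω) × L²(Ω)^d`, with the Hilbert norm `(‖v‖² + ‖G‖²)^(1/2)`. -/
abbrev L2Pair {n : ℕ} (Ω : Set (E n)) : Type :=
  WithLp 2 (Lp ℝ 2 (volume.restrict Ω) × Lp (E n) 2 (volume.restrict Ω))

/-- Test functions: smooth functions with compact support contained in `Ω`. -/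
def IsTest {n : ℕ} (Ω : Set (E n)) (φ : E n → ℝ) : Prop :=
  ContDiff ℝ (⊤ : ℕ∞) φ ∧ HasCompactSupport φ ∧ tsupport φ ⊆ Ω

/-- `H¹₀(Ω)`: the closure in the `H¹` norm of the test functions, each function `v` being
stored together with its weak gradient as the pair `(v, ∇v)`. (The pairs `(φ, ∇φ)` already form
a linear subspace, so that taking the span adds nothing.) -/
def H10 {n : ℕ} (Ω : Set (E n)) : Submodule ℝ (L2Pair Ω) :=
  (Submodule.span ℝ {w : L2Pair Ω | ∃ φ : E n → ℝ, IsTest Ω φ ∧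
    w.fst =ᵐ[volume.restrict Ω] φ ∧ w.snd =ᵐ[volume.restrict Ω] gradient φ}).topologicalClosure

/-- `V = H¹₀(Ω)` as a normed space, with the `H¹` norm. -/
abbrev V {n : ℕ} (Ω : Set (E n)) : Type := ↥(H10 Ω)

/-- The function underlying an element of `H¹₀(Ω)`. -/
def V.val {n : ℕ} {Ω : Set (E n)} (v : V Ω) : E n → ℝ := (v : L2Pair Ω).fst

/-- The weak gradient of an element of `H¹₀(Ω)`. -/
def V.grad {n : ℕ} {Ω : Set (E n)} (v : V Ω) : E n → E n := (v : L2Pair Ω).snd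

/-! ### The weak problem and the Lagrangian functional -/

/-- `A(u)(φ) = (ε∇u, ∇φ) + (b·∇u, φ) + (αu, φ)`. -/
def formA {n : ℕ} {Ω : Set (E n)} (ε : ℝ) (b : E n → E n) (α : E n → ℝ) (u φ : V Ω) : ℝ :=
  (∫ x in Ω, inner ℝ (ε • V.grad u x) (V.grad φ x))
    + (∫ x in Ω, inner ℝ (b x) (V.grad u x) * V.val φ x)
    + (∫ x in Ω, α x * V.val u x * V.val φ x)

/-- `F(φ) = (f, φ)`. -/
def formF {n : ℕ} {Ω : Set (E n)} (f : E n → ℝ) (φ : V Ω) : ℝ :=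
  ∫ x in Ω, f x * V.val φ x

/-- `𝓛(u, z) = J(u) + F(z) - A(u)(z)`. -/
def lagrangian {n : ℕ} {Ω : Set (E n)} (ε : ℝ) (b : E n → E n) (α f : E n → ℝ)
    (J : V Ω → ℝ) (x : V Ω × V Ω) : ℝ :=
  J x.1 + formF f x.2 - formA ε b α x.1 x.2

/-! ### Meshes of quadrilaterals and hexahedra -/

/-- The map from reference coordinates to physical space with the polynomial components `P j`. -/
def polyMap {n : ℕ} (P : Fin (n + 1) → MvPolynomial (Fin (n + 1)) ℝ)
    (y : Fin (n + 1) → ℝ) : E n :=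
  WithLp.toLp 2 (fun j => MvPolynomial.eval y (P j))

/-- The Jacobian matrix of `polyMap P`. -/
def jac {n : ℕ} (P : Fin (n + 1) → MvPolynomial (Fin (n + 1)) ℝ)
    (y : Fin (n + 1) → ℝ) : Matrix (Fin (n + 1)) (Fin (n + 1)) ℝ :=
  Matrix.of fun i j => MvPolynomial.eval y (MvPolynomial.pderiv j (P i))

/-- The closed reference element `[0,1]^d`. -/
def refCube (n : ℕ) : Set (Fin (n + 1) → ℝ) := Icc 0 1

/-- The open reference element `(0,1)^d`. -/
def refCubeInt (n : ℕ) : Set (Fin (n + 1) → ℝ) := Set.pi univ fun _ => Ioo 0 1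

/-- A finite decomposition of `Ω` into pairwise disjoint (open) quadrilateral or hexahedral cells
`K`, the images of the open reference element under multilinear maps that are injective with
invertible Jacobian on the closed reference element. Faces of neighbouring cells need not match,
so hanging nodes are allowed. -/
structure Mesh {n : ℕ} (Ω : Set (E n)) (ι : Type*) where
  /-- The components of the reference map `T_K`. -/
  comp : ι → Fin (n + 1) → MvPolynomial (Fin (n + 1)) ℝ
  multilinear : ∀ K j, comp K j ∈ MvPolynomial.restrictDegree (Fin (n + 1)) ℝ 1
  injOn : ∀ K, InjOn (polyMap (comp K)) (refCube n)
  det_ne_zero : ∀ K, ∀ y ∈ refCube n, (jac (comp K) y).det ≠ 0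
  subset : ∀ K, polyMap (comp K) '' refCubeInt n ⊆ Ω
  disjoint : ∀ K K', K ≠ K' →
    Disjoint (polyMap (comp K) '' refCubeInt n) (polyMap (comp K') '' refCubeInt n)
  cover : closure Ω = ⋃ K, closure (polyMap (comp K) '' refCubeInt n)

namespace Mesh

variable {n : ℕ} {Ω : Set (E n)} {ι : Type*} (M : Mesh Ω ι)

/-- The reference map `T_K`. -/
def map (K : ι) : (Fin (n + 1) → ℝ) → E n := polyMap (M.comp K)

/-- The open cell `K`. -/
def cell (K : ι) : Set (E n) := M.map K '' refCubeInt n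

/-- The closed cell. -/
def closedCell (K : ι) : Set (E n) := M.map K '' refCube n

end Mesh

/-! ### Surface integrals over cell boundaries -/

/-- The outward unit normal of the reference element at a point in the relative interior of one
of its faces (the points of the lower dimensional faces are negligible). -/
def refNormal {n : ℕ} (y : Fin (n + 1) → ℝ) : Fin (n + 1) → ℝ :=
  fun i => if y i = 1 then 1 else if y i = 0 then -1 else 0

/-- The surface measure on the boundary of the reference element: on each of the faces `y i = 0`
and `y i = 1` it is the `n`-dimensional Lebesgue measure of the other coordinates. -/
def refSurface (n : ℕ) : Measure (Fin (n + 1) → ℝ) :=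
  ∑ i : Fin (n + 1), ∑ s : Fin 2,
    (volume.restrict (Icc (0 : Fin n → ℝ) 1)).map
      (fun y : Fin n → ℝ => (i.insertNth (s : ℝ) y : Fin (n + 1) → ℝ))

namespace Mesh

variable {n : ℕ} {Ω : Set (E n)} {ι : Type*} (M : Mesh Ω ι)

/-- The area vector `|det DT_K| (DT_K)⁻ᵀ n̂` of the parametrized boundary of `K`: its direction is
that of the outward normal of `K` and its length is the surface element of the
parametrization. -/
def areaVec (K : ι) (y : Fin (n + 1) → ℝ) : E n :=
  |(jac (M.comp K) y).det| •
    WithLp.toLp 2 (((jac (M.comp K) y)⁻¹.transpose).mulVec (refNormal y))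

/-- The surface measure on `∂K`, as a measure on the physical space. -/
def surface (K : ι) : Measure (E n) :=
  ((refSurface n).withDensity (fun y => ENNReal.ofReal ‖M.areaVec K y‖)).map (M.map K)

/-- The outward unit normal `n` of `K` at the points of `∂K`. -/
def normal (K : ι) (x : E n) : E n :=
  let y := Function.invFunOn (M.map K) (refCube n) x
  ‖M.areaVec K y‖⁻¹ • M.areaVec K y

/-- `g` is the trace on `∂K` of the function `v ∈ H¹₀(Ω)`: the limit in `L²(∂K)` of the restrictions
of test functions that converge to `v` in the `H¹` norm. -/
def IsTrace (K : ι) (v : V Ω) (g : E n → ℝ) : Prop :=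
  MemLp g 2 (M.surface K) ∧ ∃ φ : ℕ → E n → ℝ, (∀ m, IsTest Ω (φ m)) ∧
    Tendsto (fun m => eLpNorm (φ m - V.val v) 2 (volume.restrict Ω)) atTop (𝓝 0) ∧
    Tendsto (fun m => eLpNorm (gradient (φ m) - V.grad v) 2 (volume.restrict Ω)) atTop (𝓝 0) ∧
    Tendsto (fun m => eLpNorm (φ m - g) 2 (M.surface K)) atTop (𝓝 0)

/-! ### Finite element spaces, stabilization and residuals -/

/-- `U` is the continuous, piecewise polynomial representative of the finite element function `v`:
it is continuous on `closure Ω`, and on each closed cell its pull-back under `T_K` is a polynomial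
of degree at most `p` in each variable. -/
def IsFERep (p : ℕ) (v : V Ω) (U : E n → ℝ) : Prop :=
  V.val v =ᵐ[volume.restrict Ω] U ∧ ContinuousOn U (closure Ω) ∧
    ∀ K, ∃ q ∈ MvPolynomial.restrictDegree (Fin (n + 1)) ℝ p,
      ∀ y ∈ refCube n, U (M.map K y) = MvPolynomial.eval y q

/-- The finite element space `V_h^p`. -/
def feSpace (p : ℕ) : Set (V Ω) := {v | ∃ U, M.IsFERep p v U}

end Mesh

/-- The (classical) divergence of a vector field. -/
def divergence {n : ℕ} (G : E n → E n) (x : E n) : ℝ :=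
  ∑ i, fderiv ℝ G x (EuclideanSpace.single i 1) i

/-- `R(U) = -∇·(ε∇U) + b·∇U + αU - f`. -/
def strongResidual {n : ℕ} (ε : ℝ) (b : E n → E n) (α f U : E n → ℝ) (x : E n) : ℝ :=
  -divergence (fun y => ε • gradient U y) x + inner ℝ (b x) (gradient U x) + α x * U x - f x

/-- The cell residual `𝓡(U) = f + ∇·(ε∇U) - b·∇U - αU`. -/
def cellResidual {n : ℕ} (ε : ℝ) (b : E n → E n) (α f U : E n → ℝ) (x : E n) : ℝ :=
  f x + divergence (fun y => ε • gradient U y) x - inner ℝ (b x) (gradient U x) - α x * U x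

namespace Mesh

variable {n : ℕ} {Ω : Set (E n)} {ι : Type*} (M : Mesh Ω ι)

/-- The stabilization term `S(u_h)(φ) = ∑_K δ_K (R(u_h), b·∇φ)_K`, where `U` is the continuous
representative of `u_h`. -/
def stab [Fintype ι] (ε : ℝ) (b : E n → E n) (α f : E n → ℝ) (δ : ι → ℝ)
    (U : E n → ℝ) (φ : V Ω) : ℝ :=
  ∑ K, δ K * ∫ x in M.cell K, strongResidual ε b α f U x * inner ℝ (b x) (V.grad φ x)

/-- `u` solves the stabilized discrete problem:
`A(u)(φ) + S(u)(φ) = F(φ)` for all `φ ∈ V_h^p`. Here `U` is the representative of `u`. -/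
def IsDiscreteSol [Fintype ι] (p : ℕ) (ε : ℝ) (b : E n → E n) (α f : E n → ℝ) (δ : ι → ℝ)
    (u : V Ω) (U : E n → ℝ) : Prop :=
  M.IsFERep p u U ∧
    ∀ φ ∈ M.feSpace p, formA ε b α u φ + M.stab ε b α f δ U φ = formF f φ

open Classical in
/-- The edge residual `𝓔(U)` on `∂K`: zero on `∂Ω`, and `½ n·(ε∇U|_K - ε∇U|_K')` at the points that `K`
shares with a neighbouring cell `K'`. The gradients are one-sided ones. Almost every point of
`∂K ∖ ∂Ω` belongs to exactly one closed cell `K' ≠ K`, so that the sum has a single term there. -/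
def edgeResidual [Fintype ι] (ε : ℝ) (U : E n → ℝ) (K : ι) (x : E n) : ℝ :=
  if x ∈ frontier Ω then 0 else
    ∑ K' ∈ Finset.univ.filter (fun K' => K' ≠ K ∧ x ∈ M.closedCell K'),
      (1 / 2) * inner ℝ (M.normal K x)
        (ε • gradientWithin U (M.closedCell K) x - ε • gradientWithin U (M.closedCell K') x)

end Mesh

/-! ### The remainders -/

/-- The directional derivative `J⁽ᵏ⁾(x)(e, …, e)`. -/
def dirDeriv {W : Type*} [NormedAddCommGroup W] [NormedSpace ℝ W] (k : ℕ) (J : W → ℝ)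
    (x e : W) : ℝ :=
  iteratedFDeriv ℝ k J x (fun _ => e)

/-- `R_J = ½ ∫₀¹ J'''(u_h + s e)(e, e, e) s (s - 1) ds` with `e = u - u_h`. -/
def remainderJ {W : Type*} [NormedAddCommGroup W] [NormedSpace ℝ W] (J : W → ℝ)
    (u uh : W) : ℝ :=
  (1 / 2) * ∫ s in (0 : ℝ)..1, dirDeriv 3 J (uh + s • (u - uh)) (u - uh) * s * (s - 1)

/-- `Δρ_J = -∫₀¹ J''(u_h + s e)(e, e) ds` with `e = u - u_h`. -/
def deltaRho {W : Type*} [NormedAddCommGroup W] [NormedSpace ℝ W] (J : W → ℝ)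
    (u uh : W) : ℝ :=
  -∫ s in (0 : ℝ)..1, dirDeriv 2 J (uh + s • (u - uh)) (u - uh)

end SUPG

end

namespace SUPG

/-! ### Calculus of polynomial maps -/

section Polynomial

/-! Derivatives of the Lagrangian along lines give the primal problem `A(u)(φ) = F(φ)` and the dual
problem `J'(u)(v) = A(v)(z)`. Two integrations by parts of `s ↦ J(u_h + s e)`
(`sub_eq_fderiv_add_remainder`) give `J(u) - J(u_h) = J'(u)(e) + R_J + ½ Δρ_J`. Here `J'(u)(e) =
A(e)(z) = F(z) - A(u_h)(z)`, and the discrete equation tested with `φ_h` turns this into `F(z - φ_h)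
- A(u_h)(z - φ_h) + S(u_h)(φ_h)`. What remains is to localize the weak residual of `u_h` at `w = z -
φ_h` (`formF_sub_formA_eq`).

Localization is integration by parts on each cell. `green_cell` pulls a flux back to the cube by the
Piola transform: the cofactor rows of the Jacobian are divergence free (`piola`), so the divergence
theorem on a box applies. Applied to `φ²` and a field transversal to `∂K` it yields a trace
inequality on each cell, hence the traces, without any regularity of `∂Ω`; applied to the field `q
v`, with `q` the pulled-back `u_h` and `v` constant, it identifies the weak gradient of `u_h` with
the classical one inside the cells (`grad_ae_eq`).

The delicate point is that the boundary fluxes of all cells add up to half jumps although faces need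
not match. No faces are paired. All surface measures get densities with respect to their sum, the
skeleton measure. Green's formula for constant fields, summed over the cells and tested with
functions supported in `Ω`, says that the densities times the normals add up to zero almost
everywhere in `Ω` (`sum_density_smul_normal`). Almost every skeleton point lies in at most two
closed cells (`card_closedCell_le_two`): near a point off the ridges a cell contains a half-space of
directions, and three half-spaces cannot be pairwise disjoint. With these two facts the passage to
jumps is pointwise algebra (`sum_eq_sum_jump`). Everything is proved for test functions first and
passes to `w` by density. -/

theorem pderiv_pderiv_comm {σ : Type*} (i j : σ) (q : MvPolynomial σ ℝ) :
    MvPolynomial.pderiv i (MvPolynomial.pderiv j q)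
      = MvPolynomial.pderiv j (MvPolynomial.pderiv i q) := by
  classical
  -- A commutator of derivations is a derivation, so it vanishes once it vanishes on the variables.
  have h : ⁅(MvPolynomial.pderiv i : Derivation ℝ (MvPolynomial σ ℝ) (MvPolynomial σ ℝ)),
      MvPolynomial.pderiv j⁆
      = (0 : Derivation ℝ (MvPolynomial σ ℝ) (MvPolynomial σ ℝ)) := by
    apply MvPolynomial.derivation_ext
    intro k
    simp only [Derivation.commutator_apply, MvPolynomial.pderiv_X, Derivation.coe_zero,
      Pi.zero_apply, Pi.single_apply]
    split_ifs <;> simp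
  have h' := DFunLike.congr_fun h q
  rw [Derivation.commutator_apply] at h'
  simpa [sub_eq_zero] using h'

variable {σ : Type*} [Fintype σ]

theorem contDiff_mvPolynomial_eval (q : MvPolynomial σ ℝ) :
    ContDiff ℝ (⊤ : ℕ∞) (fun y : σ → ℝ => MvPolynomial.eval y q) := by
  induction q using MvPolynomial.induction_on with
  | C a => simpa using contDiff_const
  | add p q hp hq => simpa using hp.add hq
  | mul_X p i hp => simpa using hp.mul (contDiff_apply ℝ ℝ i)

/-- The total derivative of a polynomial function. -/
noncomputable def evalFDeriv (q : MvPolynomial σ ℝ) (y : σ → ℝ) : (σ → ℝ) →L[ℝ] ℝ :=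
  ∑ i, MvPolynomial.eval y (MvPolynomial.pderiv i q) • ContinuousLinearMap.proj i

theorem evalFDeriv_apply (q : MvPolynomial σ ℝ) (y v : σ → ℝ) :
    evalFDeriv q y v = ∑ i, MvPolynomial.eval y (MvPolynomial.pderiv i q) * v i := by
  simp [evalFDeriv]

theorem evalFDeriv_single [DecidableEq σ] (q : MvPolynomial σ ℝ) (y : σ → ℝ) (i : σ) :
    evalFDeriv q y (Pi.single i 1) = MvPolynomial.eval y (MvPolynomial.pderiv i q) := by
  simp [evalFDeriv_apply, Pi.single_apply]

theorem hasFDerivAt_mvPolynomial_eval (q : MvPolynomial σ ℝ) (y : σ → ℝ) :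
    HasFDerivAt (fun y : σ → ℝ => MvPolynomial.eval y q) (evalFDeriv q y) y := by
  classical
  induction q using MvPolynomial.induction_on with
  | C a =>
    have : evalFDeriv (MvPolynomial.C a) y = 0 := by ext; simp [evalFDeriv]
    rw [this]
    simpa using hasFDerivAt_const a y
  | add p q hp hq =>
    have : evalFDeriv (p + q) y = evalFDeriv p y + evalFDeriv q y := by
      ext v; simp [evalFDeriv_apply, add_mul, Finset.sum_add_distrib]
    rw [this]
    exact (hp.add hq).congr_of_eventuallyEq (Eventually.of_forall fun z => by simp)
  | mul_X p i hp =>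
    have : evalFDeriv (p * MvPolynomial.X i) y
        = MvPolynomial.eval y p • ContinuousLinearMap.proj i + y i • evalFDeriv p y := by
      ext v
      simp only [evalFDeriv_apply, MvPolynomial.pderiv_mul, map_add, map_mul,
        MvPolynomial.pderiv_X, add_mul, Finset.sum_add_distrib,
        add_apply, smul_apply,
        ContinuousLinearMap.proj_apply, smul_eq_mul, MvPolynomial.eval_X, Finset.mul_sum]
      rw [add_comm]
      congr 1
      · rw [Finset.sum_eq_single i]
        · simp
        · intro j _ hj; simp [hj]
        · simp
      · exact Finset.sum_congr rfl fun j _ => by ring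
    rw [this]
    exact (hp.mul (hasFDerivAt_apply (𝕜 := ℝ) i y)).congr_of_eventuallyEq
      (Eventually.of_forall fun z => by simp)

end Polynomial

/-! ### The Jacobian of a polynomial map and the Piola identity -/

section PolyMap

variable {n : ℕ} (P : Fin (n + 1) → MvPolynomial (Fin (n + 1)) ℝ)

/-- The linear map with the Jacobian matrix of `polyMap P`. -/
noncomputable def jacLin (y : Fin (n + 1) → ℝ) : (Fin (n + 1) → ℝ) →L[ℝ] (Fin (n + 1) → ℝ) :=
  LinearMap.toContinuousLinearMap (Matrix.toLin' (jac P y))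

theorem jacLin_det (y : Fin (n + 1) → ℝ) : (jacLin P y).det = (jac P y).det := by
  simp [jacLin, LinearMap.det_toLin']

theorem jacLin_apply (y v : Fin (n + 1) → ℝ) : jacLin P y v = (jac P y).mulVec v := by
  simp [jacLin]

/-- The coordinates of `polyMap P`. -/
noncomputable def polyCoord (y : Fin (n + 1) → ℝ) : Fin (n + 1) → ℝ := fun j => MvPolynomial.eval y (P j)

theorem contDiff_polyCoord : ContDiff ℝ (⊤ : ℕ∞) (polyCoord P) :=
  contDiff_pi.2 fun j => contDiff_mvPolynomial_eval (P j)

theorem hasFDerivAt_polyCoord (y : Fin (n + 1) → ℝ) :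
    HasFDerivAt (polyCoord P) (jacLin P y) y := by
  rw [hasFDerivAt_pi']
  intro j
  have : (ContinuousLinearMap.proj j).comp (jacLin P y) = evalFDeriv (P j) y := by
    ext v
    simp [jacLin_apply, evalFDeriv_apply, Matrix.mulVec, dotProduct, jac]
  rw [this]
  exact hasFDerivAt_mvPolynomial_eval (P j) y

/-- The identification of coordinate vectors with points of the Euclidean space. -/
noncomputable def toE (n : ℕ) : (Fin (n + 1) → ℝ) ≃L[ℝ] E n :=
  (PiLp.continuousLinearEquiv 2 ℝ (fun _ : Fin (n + 1) => ℝ)).symm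

theorem toE_apply (y : Fin (n + 1) → ℝ) : toE n y = WithLp.toLp 2 y := rfl

theorem contDiff_polyMap : ContDiff ℝ (⊤ : ℕ∞) (polyMap P) :=
  (toE n).contDiff.comp (contDiff_polyCoord P)

/-- The derivative of `polyMap P`. -/
noncomputable def jacMap (y : Fin (n + 1) → ℝ) : (Fin (n + 1) → ℝ) →L[ℝ] E n :=
  (toE n : (Fin (n + 1) → ℝ) →L[ℝ] E n).comp (jacLin P y)

theorem jacMap_apply (y v : Fin (n + 1) → ℝ) (i : Fin (n + 1)) :
    jacMap P y v i = ∑ j, jac P y i j * v j := by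
  simp [jacMap, jacLin_apply, toE_apply, Matrix.mulVec, dotProduct]

theorem hasFDerivAt_polyMap (y : Fin (n + 1) → ℝ) :
    HasFDerivAt (polyMap P) (jacMap P y) y :=
  (toE n).hasFDerivAt.comp y (hasFDerivAt_polyCoord P y)

theorem hasStrictFDerivAt_polyMap (y : Fin (n + 1) → ℝ) :
    HasStrictFDerivAt (polyMap P) (jacMap P y) y :=
  (contDiff_polyMap P).contDiffAt.hasStrictFDerivAt' (hasFDerivAt_polyMap P y) (by simp)

variable {P}

/-- The derivative of `polyMap P` as an equivalence, where the Jacobian is invertible. -/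
noncomputable def jacEquiv {y : Fin (n + 1) → ℝ} (h : (jac P y).det ≠ 0) :
    (Fin (n + 1) → ℝ) ≃L[ℝ] E n :=
  (ContinuousLinearEquiv.ofBijective (jacMap P y)
    (LinearMap.ker_eq_bot.2 ((toE n).injective.comp
      (by
        have : Function.Injective (jac P y).mulVec :=
          Matrix.mulVec_injective_iff_isUnit.2 ((Matrix.isUnit_iff_isUnit_det _).2 h.isUnit)
        intro v w hvw
        exact this (by simpa [jacLin_apply] using hvw))))
    (LinearMap.range_eq_top.2 ((toE n).surjective.comp
      (by
        have : Function.Surjective (jac P y).mulVec :=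
          Matrix.mulVec_surjective_iff_isUnit.2 ((Matrix.isUnit_iff_isUnit_det _).2 h.isUnit)
        intro w
        obtain ⟨v, hv⟩ := this w
        exact ⟨v, by simpa [jacLin_apply] using hv⟩))))

theorem coe_jacEquiv {y : Fin (n + 1) → ℝ} (h : (jac P y).det ≠ 0) :
    (jacEquiv h : (Fin (n + 1) → ℝ) →L[ℝ] E n) = jacMap P y := by
  ext; rfl

theorem hasStrictFDerivAt_polyMap_equiv {y : Fin (n + 1) → ℝ} (h : (jac P y).det ≠ 0) :
    HasStrictFDerivAt (polyMap P) (jacEquiv h : (Fin (n + 1) → ℝ) →L[ℝ] E n) y := by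
  rw [coe_jacEquiv]; exact hasStrictFDerivAt_polyMap P y

variable (P)

/-- The Jacobian matrix of polynomials. -/
noncomputable def polyJac : Matrix (Fin (n + 1)) (Fin (n + 1)) (MvPolynomial (Fin (n + 1)) ℝ) :=
  Matrix.of fun i j => MvPolynomial.pderiv j (P i)

theorem jac_eq_map (y : Fin (n + 1) → ℝ) :
    jac P y = (MvPolynomial.eval y).mapMatrix (polyJac P) := rfl

/-- Evaluation is a ring homomorphism and commutes with the adjugate. The cofactors are thus
polynomials in `y` and can be differentiated algebraically, unlike the entries of the inverse. -/
theorem adjugate_jac (y : Fin (n + 1) → ℝ) (i j : Fin (n + 1)) :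
    (jac P y).adjugate i j = MvPolynomial.eval y ((polyJac P).adjugate i j) := by
  rw [jac_eq_map, ← RingHom.map_adjugate]; rfl

theorem det_jac (y : Fin (n + 1) → ℝ) :
    (jac P y).det = MvPolynomial.eval y (polyJac P).det := by
  rw [jac_eq_map, ← RingHom.map_det]

/-- The Piola identity: the rows of the cofactor matrix are divergence free. -/
theorem piola (hn : n + 1 = 2 ∨ n + 1 = 3) (j : Fin (n + 1)) :
    ∑ i, MvPolynomial.pderiv i ((polyJac P).adjugate i j) = 0 := by
  -- With the explicit adjugate of a 2×2 or 3×3 matrix, the mixed second derivatives cancel in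
  -- pairs.
  rcases hn with hn | hn
  · obtain rfl : n = 1 := by omega
    fin_cases j <;>
      simp [Fin.sum_univ_two, Matrix.adjugate_fin_two, polyJac, pderiv_pderiv_comm (1 : Fin (1 + 1)) 0]
  · obtain rfl : n = 2 := by omega
    fin_cases j <;>
      simp [Fin.sum_univ_three, Matrix.adjugate_fin_three, polyJac,
        pderiv_pderiv_comm (1 : Fin (2 + 1)) 0, pderiv_pderiv_comm (2 : Fin (2 + 1)) 0,
        pderiv_pderiv_comm (2 : Fin (2 + 1)) 1] <;> ring

theorem continuous_det_jac : Continuous fun y => (jac P y).det := by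
  simp only [det_jac]
  exact MvPolynomial.continuous_eval _

end PolyMap

end SUPG

namespace SUPG

/-! ### The reference cube -/

section RefCube

variable {n : ℕ}

theorem refCube_eq_pi : refCube n = Set.pi univ fun _ => Icc (0 : ℝ) 1 := (pi_univ_Icc _ _).symm

theorem mem_refCube {y : Fin (n + 1) → ℝ} : y ∈ refCube n ↔ ∀ i, y i ∈ Icc (0 : ℝ) 1 := by
  rw [refCube_eq_pi, mem_univ_pi]

theorem mem_refCubeInt {y : Fin (n + 1) → ℝ} : y ∈ refCubeInt n ↔ ∀ i, y i ∈ Ioo (0 : ℝ) 1 := by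
  simp [refCubeInt]

theorem refCubeInt_subset : refCubeInt n ⊆ refCube n := by
  rw [refCube_eq_pi]; exact pi_mono fun _ _ => Ioo_subset_Icc_self

theorem isCompact_refCube : IsCompact (refCube n) := isCompact_Icc

theorem isOpen_refCubeInt : IsOpen (refCubeInt n) :=
  isOpen_set_pi finite_univ fun _ _ => isOpen_Ioo

theorem convex_refCube : Convex ℝ (refCube n) := convex_Icc _ _

theorem closure_refCubeInt : closure (refCubeInt n) = refCube n := by
  rw [refCubeInt, closure_pi_set, refCube_eq_pi]
  simp [closure_Ioo]

theorem refCubeInt_nonempty : (refCubeInt n).Nonempty :=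
  ⟨fun _ => 1 / 2, by rw [mem_refCubeInt]; intro i; norm_num⟩

theorem refCubeInt_ae_eq : (refCubeInt n : Set (Fin (n + 1) → ℝ)) =ᵐ[volume] refCube n :=
  Measure.univ_pi_Ioo_ae_eq_Icc

theorem uniqueDiffOn_refCube : UniqueDiffOn ℝ (refCube n) := by
  refine uniqueDiffOn_convex convex_refCube ?_
  exact (refCubeInt_nonempty).mono (interior_maximal refCubeInt_subset isOpen_refCubeInt)

theorem volume_refCube_diff : volume (refCube n \ refCubeInt n) = 0 :=
  ae_le_set.1 refCubeInt_ae_eq.symm.le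

end RefCube

/-! ### Cells -/

namespace Mesh

variable {n : ℕ} {Ω : Set (E n)} {ι : Type*} (M : Mesh Ω ι) (K : ι)

theorem contDiff_map : ContDiff ℝ (⊤ : ℕ∞) (M.map K) := contDiff_polyMap _

theorem continuous_map : Continuous (M.map K) := (M.contDiff_map K).continuous

theorem hasFDerivAt_map (y : Fin (n + 1) → ℝ) :
    HasFDerivAt (M.map K) (jacMap (M.comp K) y) y := hasFDerivAt_polyMap _ y

theorem injOn_map : InjOn (M.map K) (refCube n) := M.injOn K

theorem map_mem_closedCell {y : Fin (n + 1) → ℝ} (hy : y ∈ refCube n) :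
    M.map K y ∈ M.closedCell K := mem_image_of_mem _ hy

theorem isCompact_closedCell : IsCompact (M.closedCell K) :=
  isCompact_refCube.image (M.continuous_map K)

theorem isClosed_closedCell : IsClosed (M.closedCell K) := (M.isCompact_closedCell K).isClosed

theorem cell_subset_closedCell : M.cell K ⊆ M.closedCell K := image_mono refCubeInt_subset

theorem closure_cell : closure (M.cell K) = M.closedCell K := by
  apply subset_antisymm
  · exact closure_minimal (M.cell_subset_closedCell K) (M.isClosed_closedCell K)
  · rw [closedCell, ← closure_refCubeInt]
    exact image_closure_subset_closure_image (M.continuous_map K)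

/-- The polynomial map is defined on the whole space, so the inverse function theorem applies at the
boundary points of the cube as well. -/
theorem map_nhds {y : Fin (n + 1) → ℝ} (hy : y ∈ refCube n) :
    Filter.map (M.map K) (𝓝 y) = 𝓝 (M.map K y) :=
  (hasStrictFDerivAt_polyMap_equiv (M.det_ne_zero K y hy)).map_nhds_eq_of_equiv

theorem isOpen_cell : IsOpen (M.cell K) := by
  rw [isOpen_iff_mem_nhds]
  rintro _ ⟨y, hy, rfl⟩
  rw [← M.map_nhds K (refCubeInt_subset hy)]
  exact image_mem_map (isOpen_refCubeInt.mem_nhds hy)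

theorem cell_subset : M.cell K ⊆ Ω := M.subset K

theorem closure_eq_iUnion_closedCell : closure Ω = ⋃ K, M.closedCell K := by
  rw [M.cover]; exact iUnion_congr fun K => M.closure_cell K

variable {K} in
theorem disjoint_cell_closedCell {K' : ι} (h : K ≠ K') :
    Disjoint (M.cell K) (M.closedCell K') := by
  rw [← M.closure_cell K']
  exact (M.disjoint K K' h).closure_right (M.isOpen_cell K)

/-- The inverse of the reference map on the closed cell. -/
noncomputable def inv (x : E n) : Fin (n + 1) → ℝ := Function.invFunOn (M.map K) (refCube n) x

theorem inv_map {y : Fin (n + 1) → ℝ} (hy : y ∈ refCube n) : M.inv K (M.map K y) = y :=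
  (M.injOn_map K).leftInvOn_invFunOn hy

variable {K} in
theorem map_inv {x : E n} (hx : x ∈ M.closedCell K) : M.map K (M.inv K x) = x :=
  Function.invFunOn_eq hx

variable {K} in
theorem inv_mem {x : E n} (hx : x ∈ M.closedCell K) : M.inv K x ∈ refCube n :=
  Function.invFunOn_mem hx

theorem map_mem_cell_iff {y : Fin (n + 1) → ℝ} (hy : y ∈ refCube n) :
    M.map K y ∈ M.cell K ↔ y ∈ refCubeInt n := by
  constructor
  · rintro ⟨y', hy', h⟩
    rwa [← M.injOn_map K (refCubeInt_subset hy') hy h]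
  · exact fun h => mem_image_of_mem _ h

/-- A continuous injection on a compact set maps closed sets to closed sets. -/
theorem continuousOn_inv : ContinuousOn (M.inv K) (M.closedCell K) := by
  rw [continuousOn_iff_isClosed]
  intro t ht
  refine ⟨M.map K '' (t ∩ refCube n),
    ((isCompact_refCube.inter_left ht).image (M.continuous_map K)).isClosed, ?_⟩
  ext x
  constructor
  · rintro ⟨hx, hxK⟩
    exact ⟨⟨M.inv K x, ⟨hx, M.inv_mem hxK⟩, M.map_inv hxK⟩, hxK⟩
  · rintro ⟨⟨y, hy, rfl⟩, hxK⟩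
    exact ⟨by simpa [M.inv_map K hy.2] using hy.1, hxK⟩

/-- Moves images to coordinate space, where source and target of the map are the same space, as the
change of variables formula requires; the identification preserves volume. -/
theorem image_toE (s : Set (Fin (n + 1) → ℝ)) :
    M.map K '' s = (WithLp.ofLp : E n → _) ⁻¹' (polyCoord (M.comp K) '' s) := by
  ext x
  constructor
  · rintro ⟨y, hy, rfl⟩
    exact ⟨y, hy, rfl⟩
  · rintro ⟨y, hy, h⟩
    exact ⟨y, hy, (toE n).symm.injective h⟩

theorem volume_image (s : Set (Fin (n + 1) → ℝ)) :
    volume (M.map K '' s) = volume (polyCoord (M.comp K) '' s) := by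
  rw [image_toE]
  exact (EuclideanSpace.volume_preserving_symm_measurableEquiv_toLp (Fin (n + 1))).measure_preimage_equiv
    (f := (MeasurableEquiv.toLp 2 (Fin (n + 1) → ℝ)).symm) _

/-- The difference lies in the image of the boundary of the cube, and differentiable maps send null
sets to null sets. -/
theorem volume_closedCell_diff_cell : volume (M.closedCell K \ M.cell K) = 0 := by
  have h : M.closedCell K \ M.cell K ⊆ M.map K '' (refCube n \ refCubeInt n) :=
    by rw [(M.injOn_map K).image_sdiff_subset refCubeInt_subset]; rfl
  refine measure_mono_null h ?_
  rw [volume_image]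
  exact addHaar_image_eq_zero_of_differentiableOn_of_addHaar_eq_zero volume
    ((contDiff_polyCoord _).differentiable (by simp)).differentiableOn volume_refCube_diff

theorem setIntegral_cell (h : E n → ℝ) :
    ∫ x in M.cell K, h x
      = ∫ y in refCubeInt n, |(jac (M.comp K) y).det| * h (M.map K y) := by
  have hmp := (EuclideanSpace.volume_preserving_symm_measurableEquiv_toLp (Fin (n + 1)))
  have h1 := hmp.setIntegral_preimage_emb
    (MeasurableEquiv.toLp 2 (Fin (n + 1) → ℝ)).symm.measurableEmbedding
    (fun y => h (WithLp.toLp 2 y)) (polyCoord (M.comp K) '' refCubeInt n)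
  rw [cell, image_toE]
  refine h1.trans ?_
  rw [integral_image_eq_integral_abs_det_fderiv_smul volume
    isOpen_refCubeInt.measurableSet
    (fun y _ => (hasFDerivAt_polyCoord (M.comp K) y).hasFDerivWithinAt)
    (fun y hy y' hy' hyy => M.injOn_map K (refCubeInt_subset hy) (refCubeInt_subset hy')
      (congrArg (toE n) hyy))]
  simp only [jacLin_det, smul_eq_mul]
  rfl

/-! ### Integration over the domain, cell by cell -/

section Union

variable [Fintype ι]

/-- A point of `Ω` outside all open cells lies on the boundary of one of finitely many closed cells,
which is null. -/
theorem ae_eq_iUnion_cell : (Ω : Set (E n)) =ᵐ[volume] ⋃ K, M.cell K := by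
  refine EventuallyLE.antisymm ?_ (iUnion_subset M.cell_subset).eventuallyLE
  rw [ae_le_set]
  have : Ω \ (⋃ K, M.cell K) ⊆ ⋃ K, M.closedCell K \ M.cell K := by
    rintro x ⟨hx, hx'⟩
    have := subset_closure hx
    rw [M.closure_eq_iUnion_closedCell, mem_iUnion] at this
    obtain ⟨K, hK⟩ := this
    exact mem_iUnion.2 ⟨K, hK, fun h => hx' (mem_iUnion.2 ⟨K, h⟩)⟩
  exact measure_mono_null this (measure_iUnion_null fun K => M.volume_closedCell_diff_cell K)

theorem restrict_eq_sum : volume.restrict Ω = ∑ K, volume.restrict (M.cell K) := by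
  rw [Measure.restrict_congr_set M.ae_eq_iUnion_cell,
    Measure.restrict_iUnion (show Pairwise (Function.onFun Disjoint M.cell) from
      fun K K' h => M.disjoint K K' h)
      (fun K => (M.isOpen_cell K).measurableSet), Measure.sum_fintype]

theorem setIntegral_eq_sum {h : E n → ℝ} (hh : IntegrableOn h Ω) :
    ∫ x in Ω, h x = ∑ K, ∫ x in M.cell K, h x := by
  rw [M.restrict_eq_sum, integral_finsetSum_measure]
  exact fun K _ => hh.mono_set (M.cell_subset K)

end Union

theorem isFiniteMeasure_restrict_cell : IsFiniteMeasure (volume.restrict (M.cell K)) :=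
  ⟨by
    have := ((M.isCompact_closedCell K).isBounded.subset (M.cell_subset_closedCell K)).measure_lt_top
      (μ := (volume : Measure (E n)))
    simpa using this⟩

end Mesh

end SUPG

namespace SUPG

/-! ### The boundary of the reference cube -/

section RefSurface

variable {n : ℕ}

theorem measurableEmbedding_insertNth (i : Fin (n + 1)) (t : ℝ) :
    MeasurableEmbedding (fun y : Fin n → ℝ => (i.insertNth t y : Fin (n + 1) → ℝ)) := by
  have hc : Continuous (fun y : Fin n → ℝ => (i.insertNth t y : Fin (n + 1) → ℝ)) :=
    continuous_const.finInsertNth i continuous_id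
  refine hc.measurableEmbedding fun z z' h => ?_
  simpa using h

theorem ae_refSurface_iff {p : (Fin (n + 1) → ℝ) → Prop} :
    (∀ᵐ y ∂refSurface n, p y) ↔ ∀ (i : Fin (n + 1)) (s : Fin 2),
      ∀ᵐ z ∂(volume.restrict (Icc (0 : Fin n → ℝ) 1)), p (i.insertNth (s : ℝ) z) := by
  simp only [refSurface, ae_iff, Measure.coe_finsetSum, Finset.sum_apply,
    Finset.sum_eq_zero_iff, Finset.mem_univ, true_imp_iff]
  refine forall_congr' fun i => forall_congr' fun s => ?_
  have := (measurableEmbedding_insertNth i (s : ℝ)).ae_map_iff (p := p)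
    (μ := volume.restrict (Icc (0 : Fin n → ℝ) 1))
  rwa [ae_iff, ae_iff] at this

instance : IsFiniteMeasure (refSurface n) := by
  have h (i : Fin (n + 1)) (s : Fin 2) : IsFiniteMeasure
      ((volume.restrict (Icc (0 : Fin n → ℝ) 1)).map
      (fun y : Fin n → ℝ => (i.insertNth (s : ℝ) y : Fin (n + 1) → ℝ))) := by
    have : IsFiniteMeasure (volume.restrict (Icc (0 : Fin n → ℝ) 1)) :=
      ⟨by simpa using (isCompact_Icc (a := (0 : Fin n → ℝ)) (b := 1)).measure_lt_top⟩
    exact Measure.isFiniteMeasure_map _ _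
  unfold refSurface
  infer_instance

theorem insertNth_mem_refCube (i : Fin (n + 1)) {t : ℝ} (ht : t ∈ Icc (0 : ℝ) 1) {z : Fin n → ℝ}
    (hz : z ∈ Icc (0 : Fin n → ℝ) 1) : (i.insertNth t z : Fin (n + 1) → ℝ) ∈ refCube n := by
  rw [mem_refCube]
  intro j
  refine Fin.succAboveCases i ?_ (fun k => ?_) j
  · simpa using ht
  · simpa using ⟨hz.1 k, hz.2 k⟩

theorem fin_two_mem_Icc (s : Fin 2) : (s : ℝ) ∈ Icc (0 : ℝ) 1 := by
  fin_cases s <;> simp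

theorem ae_mem_refCube : ∀ᵐ y ∂refSurface n, y ∈ refCube n := by
  rw [ae_refSurface_iff]
  intro i s
  filter_upwards [ae_restrict_mem measurableSet_Icc] with z hz
  exact insertNth_mem_refCube i (fin_two_mem_Icc s) hz

theorem ae_notMem_refCubeInt : ∀ᵐ y ∂refSurface n, y ∉ refCubeInt n := by
  rw [ae_refSurface_iff]
  intro i s
  refine Eventually.of_forall fun z hz => ?_
  have := mem_refCubeInt.1 hz i
  simp only [Fin.insertNth_apply_same] at this
  fin_cases s <;> simp at this

/-- Discards the lower dimensional faces, where `refNormal` has more than one nonzero entry. -/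
theorem ae_mem_Ioo (n : ℕ) :
    ∀ᵐ z ∂(volume.restrict (Icc (0 : Fin n → ℝ) 1)), ∀ k, z k ∈ Ioo (0 : ℝ) 1 := by
  have h : (Set.pi univ fun _ : Fin n => Ioo (0 : ℝ) 1) =ᵐ[volume] Icc (0 : Fin n → ℝ) 1 :=
    Measure.univ_pi_Ioo_ae_eq_Icc
  rw [← Measure.restrict_congr_set h]
  filter_upwards [ae_restrict_mem (MeasurableSet.univ_pi fun _ => measurableSet_Ioo)] with z hz
  simpa using hz

theorem refNormal_insertNth {i : Fin (n + 1)} {s : Fin 2} {z : Fin n → ℝ}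
    (hz : ∀ k, z k ∈ Ioo (0 : ℝ) 1) (j : Fin (n + 1)) :
    refNormal (i.insertNth (s : ℝ) z : Fin (n + 1) → ℝ) j
      = if j = i then (if s = 1 then 1 else -1) else 0 := by
  refine Fin.succAboveCases i ?_ (fun k => ?_) j
  · fin_cases s <;> simp [refNormal]
  · simp [refNormal, (hz k).1.ne', (hz k).2.ne]

theorem measurable_refNormal (j : Fin (n + 1)) :
    Measurable fun y : Fin (n + 1) → ℝ => refNormal y j := by
  unfold refNormal
  have h (t : ℝ) : MeasurableSet {y : Fin (n + 1) → ℝ | y j = t} :=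
    (measurableSet_singleton t).preimage (measurable_pi_apply j)
  exact Measurable.ite (h 1) measurable_const (Measurable.ite (h 0) measurable_const
    measurable_const)

theorem abs_refNormal_le (y : Fin (n + 1) → ℝ) (j : Fin (n + 1)) : |refNormal y j| ≤ 1 := by
  unfold refNormal
  split_ifs <;> simp

variable {W : Fin (n + 1) → (Fin (n + 1) → ℝ) → ℝ}

theorem continuousOn_comp_insertNth {w : (Fin (n + 1) → ℝ) → ℝ} (hw : ContinuousOn w (refCube n))
    (i : Fin (n + 1)) {t : ℝ} (ht : t ∈ Icc (0 : ℝ) 1) :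
    ContinuousOn (fun z : Fin n → ℝ => w (i.insertNth t z)) (Icc 0 1) :=
  have hc : Continuous (fun z : Fin n → ℝ => (i.insertNth t z : Fin (n + 1) → ℝ)) :=
    continuous_const.finInsertNth i continuous_id
  hw.comp hc.continuousOn fun _ hz => insertNth_mem_refCube i ht hz

theorem flux_ae_eq (i : Fin (n + 1)) (s : Fin 2) :
    (fun z : Fin n → ℝ => ∑ j, W j (i.insertNth (s : ℝ) z)
        * refNormal (i.insertNth (s : ℝ) z : Fin (n + 1) → ℝ) j)
      =ᵐ[volume.restrict (Icc (0 : Fin n → ℝ) 1)]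
    fun z => (if s = 1 then 1 else -1) * W i (i.insertNth (s : ℝ) z) := by
  filter_upwards [ae_mem_Ioo n] with z hz
  simp only [refNormal_insertNth hz]
  simp [mul_comm]

theorem integrable_flux_face (hW : ∀ i, ContinuousOn (W i) (refCube n)) (i : Fin (n + 1))
    (s : Fin 2) :
    Integrable (fun y => ∑ j, W j y * refNormal y j)
      ((volume.restrict (Icc (0 : Fin n → ℝ) 1)).map
      (fun y : Fin n → ℝ => (i.insertNth (s : ℝ) y : Fin (n + 1) → ℝ))) := by
  rw [(measurableEmbedding_insertNth i (s : ℝ)).integrable_map_iff]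
  refine Integrable.congr ?_ (flux_ae_eq i s).symm
  exact ((continuousOn_comp_insertNth (hW i) i (fin_two_mem_Icc s)).integrableOn_compact
    isCompact_Icc).const_mul _

/-- On a face with `y i` fixed only the component `W i` is seen by the normal. The result is the
boundary side of the divergence theorem on a box. -/
theorem integral_flux (hW : ∀ i, ContinuousOn (W i) (refCube n)) :
    ∫ y, ∑ j, W j y * refNormal y j ∂refSurface n
      = ∑ i, ((∫ z in Icc (0 : Fin n → ℝ) 1, W i (i.insertNth 1 z))
        - ∫ z in Icc (0 : Fin n → ℝ) 1, W i (i.insertNth 0 z)) := by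
  unfold refSurface
  rw [integral_finsetSum_measure]
  · refine Finset.sum_congr rfl fun i _ => ?_
    rw [integral_finsetSum_measure fun s _ => integrable_flux_face hW i s]
    simp only [(measurableEmbedding_insertNth i _).integral_map, integral_congr_ae (flux_ae_eq i _)]
    simp [Fin.sum_univ_two, integral_neg]
    ring
  · intro i _
    rw [integrable_finsetSum_measure]
    exact fun s _ => integrable_flux_face hW i s

end RefSurface

/-! ### Surface measures -/

namespace Mesh

variable {n : ℕ} {Ω : Set (E n)} {ι : Type*} (M : Mesh Ω ι) (K : ι)

/-- The sign of the Jacobian determinant of the reference map. -/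
noncomputable def orient : ℝ := (SignType.sign (jac (M.comp K) 0).det : ℝ)

theorem zero_mem_refCube : (0 : Fin (n + 1) → ℝ) ∈ refCube n := by
  rw [mem_refCube]; intro i; simp

/-- The determinant is continuous without zeros on the connected cube, so its sign is constant. This
replaces the absolute value by a constant times a polynomial, which can be differentiated. -/
theorem abs_det {y : Fin (n + 1) → ℝ} (hy : y ∈ refCube n) :
    |(jac (M.comp K) y).det| = M.orient K * (jac (M.comp K) y).det := by
  have h0 := M.det_ne_zero K 0 zero_mem_refCube
  have hcont := (continuous_det_jac (M.comp K)).continuousOn (s := refCube n)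
  have hpre := (convex_refCube (n := n)).isPreconnected
  rcases lt_or_gt_of_ne h0 with h | h
  · have : (jac (M.comp K) y).det < 0 := by
      by_contra! hc
      obtain ⟨y', hy', h'⟩ := hpre.intermediate_value zero_mem_refCube hy hcont ⟨h.le, hc⟩
      exact M.det_ne_zero K y' hy' h'
    simp [orient, sign_neg h, abs_of_neg this]
  · have : 0 < (jac (M.comp K) y).det := by
      by_contra! hc
      obtain ⟨y', hy', h'⟩ := hpre.intermediate_value hy zero_mem_refCube hcont ⟨hc, h.le⟩
      exact M.det_ne_zero K y' hy' h'
    simp [orient, sign_pos h, abs_of_pos this]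

/-- The area vectors of the coordinate hyperplanes. -/
noncomputable def conormal (j : Fin (n + 1)) (y : Fin (n + 1) → ℝ) : E n :=
  M.orient K • toE n (fun i => (jac (M.comp K) y).adjugate j i)

theorem contDiff_adjugate (i j : Fin (n + 1)) :
    ContDiff ℝ (⊤ : ℕ∞) fun y => (jac (M.comp K) y).adjugate i j := by
  simp only [adjugate_jac]
  exact contDiff_mvPolynomial_eval _

theorem continuous_adjugate (i j : Fin (n + 1)) :
    Continuous fun y => (jac (M.comp K) y).adjugate i j := (M.contDiff_adjugate K i j).continuous

theorem continuous_toE_adjugate (j : Fin (n + 1)) :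
    Continuous fun y => toE n (fun i => (jac (M.comp K) y).adjugate j i) :=
  (toE n).continuous.comp (continuous_pi fun i => M.continuous_adjugate K j i)

theorem continuous_conormal (j : Fin (n + 1)) : Continuous (M.conormal K j) := by
  have h := M.continuous_toE_adjugate K j
  exact h.const_smul (M.orient K)

/-- Holds for every `y`, even where the determinant vanishes, because the matrix inverse is by
definition the inverted determinant (zero at zero) times the adjugate. It therefore gives
measurability on the whole space. -/
theorem areaVec_eq_sum (y : Fin (n + 1) → ℝ) :
    M.areaVec K y = ∑ j, (|(jac (M.comp K) y).det| * (jac (M.comp K) y).det⁻¹ * refNormal y j) •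
      toE n (fun i => (jac (M.comp K) y).adjugate j i) := by
  ext i
  simp [areaVec, toE_apply, Matrix.mulVec, dotProduct, Matrix.inv_def, Finset.mul_sum]
  exact Finset.sum_congr rfl fun j _ => by ring

theorem areaVec_eq {y : Fin (n + 1) → ℝ} (hy : y ∈ refCube n) :
    M.areaVec K y = ∑ j, refNormal y j • M.conormal K j y := by
  rw [areaVec_eq_sum]
  refine Finset.sum_congr rfl fun j _ => ?_
  rw [M.abs_det K hy, mul_assoc (M.orient K), mul_inv_cancel₀ (M.det_ne_zero K y hy), mul_one,
    conormal, smul_smul, mul_comm]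

theorem measurable_areaVec : Measurable (M.areaVec K) := by
  have : M.areaVec K = fun y => ∑ j,
      (|(jac (M.comp K) y).det| * (jac (M.comp K) y).det⁻¹ * refNormal y j) •
      toE n (fun i => (jac (M.comp K) y).adjugate j i) := funext fun y => M.areaVec_eq_sum K y
  rw [this]
  have hdet := (continuous_det_jac (M.comp K)).measurable
  refine Finset.measurable_sum _ fun j _ => ?_
  exact ((((continuous_abs.measurable.comp hdet).mul hdet.inv).mul (measurable_refNormal j))).smul
    (M.continuous_toE_adjugate K j).measurable

theorem exists_norm_areaVec_le : ∃ C, ∀ y ∈ refCube n, ‖M.areaVec K y‖ ≤ C := by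
  obtain ⟨C, hC⟩ := isCompact_refCube.exists_bound_of_continuousOn (s := refCube n)
    (f := fun y => ∑ j, ‖M.conormal K j y‖)
    (continuous_finsetSum _ fun j _ => (M.continuous_conormal K j).norm).continuousOn
  refine ⟨C, fun y hy => ?_⟩
  rw [M.areaVec_eq K hy]
  refine (norm_sum_le _ _).trans (le_trans ?_ ((le_abs_self _).trans (hC y hy)))
  refine Finset.sum_le_sum fun j _ => ?_
  rw [norm_smul, Real.norm_eq_abs]
  exact mul_le_of_le_one_left (norm_nonneg _) (abs_refNormal_le y j)

theorem measurable_areaDensity : Measurable fun y => ENNReal.ofReal ‖M.areaVec K y‖ :=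
  (M.measurable_areaVec K).norm.ennreal_ofReal

/-- The weighted surface measure of the reference element. -/
noncomputable def paramSurface : Measure (Fin (n + 1) → ℝ) :=
  (refSurface n).withDensity (fun y => ENNReal.ofReal ‖M.areaVec K y‖)

theorem surface_eq_map : M.surface K = (M.paramSurface K).map (M.map K) := rfl

instance : IsFiniteMeasure (M.paramSurface K) := by
  obtain ⟨C, hC⟩ := M.exists_norm_areaVec_le K
  refine isFiniteMeasure_withDensity_ofReal (HasFiniteIntegral.of_bounded (C := C) ?_)
  filter_upwards [ae_mem_refCube] with y hy
  simpa using hC y hy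

instance : IsFiniteMeasure (M.surface K) := by
  rw [surface_eq_map]; infer_instance

theorem paramSurface_absolutelyContinuous : M.paramSurface K ≪ refSurface n :=
  withDensity_absolutelyContinuous _ _

theorem ae_surface_of_refSurface {p : E n → Prop} (hp : MeasurableSet {x | p x})
    (h : ∀ᵐ y ∂refSurface n, p (M.map K y)) : ∀ᵐ x ∂M.surface K, p x := by
  rw [surface_eq_map, ae_map_iff (M.continuous_map K).aemeasurable hp]
  exact (M.paramSurface_absolutelyContinuous K).ae_le h

theorem ae_mem_closedCell : ∀ᵐ x ∂M.surface K, x ∈ M.closedCell K := by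
  refine M.ae_surface_of_refSurface K (M.isClosed_closedCell K).measurableSet ?_
  filter_upwards [ae_mem_refCube] with y hy
  exact M.map_mem_closedCell K hy

theorem ae_notMem_cell : ∀ᵐ x ∂M.surface K, x ∉ M.cell K := by
  refine M.ae_surface_of_refSurface K (M.isOpen_cell K).measurableSet.compl ?_
  filter_upwards [ae_mem_refCube, ae_notMem_refCubeInt] with y hy hy'
  rwa [M.map_mem_cell_iff K hy]

theorem restrict_surface : (M.surface K).restrict (M.closedCell K) = M.surface K :=
  Measure.restrict_eq_self_of_ae_mem (M.ae_mem_closedCell K)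

theorem aestronglyMeasurable_of_continuousOn {F : Type*} [NormedAddCommGroup F]
    [SecondCountableTopology F] {h : E n → F}
    (hh : ContinuousOn h (M.closedCell K)) : AEStronglyMeasurable h (M.surface K) := by
  rw [← M.restrict_surface K]
  exact hh.aestronglyMeasurable (M.isClosed_closedCell K).measurableSet

theorem aemeasurable_inv : AEMeasurable (M.inv K) (M.surface K) := by
  rw [← M.restrict_surface K]
  exact (M.continuousOn_inv K).aemeasurable (M.isClosed_closedCell K).measurableSet

theorem integral_surface {h : E n → ℝ} (hh : AEStronglyMeasurable h (M.surface K)) :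
    ∫ x, h x ∂M.surface K = ∫ y, ‖M.areaVec K y‖ * h (M.map K y) ∂refSurface n := by
  rw [surface_eq_map] at hh ⊢
  rw [integral_map (M.continuous_map K).aemeasurable hh, paramSurface,
    integral_withDensity_eq_integral_toReal_smul (M.measurable_areaDensity K)
      (Eventually.of_forall fun _ => ENNReal.ofReal_lt_top)]
  simp

/-- The surface element cancels the normalization of the normal, so boundary fluxes become integrals
of the area vector; a vanishing area vector does no harm. -/
theorem norm_smul_normal_map {y : Fin (n + 1) → ℝ} (hy : y ∈ refCube n) :
    ‖M.areaVec K y‖ • M.normal K (M.map K y) = M.areaVec K y := by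
  have : Function.invFunOn (M.map K) (refCube n) (M.map K y) = y := M.inv_map K hy
  simp only [normal, this, smul_smul]
  by_cases h : M.areaVec K y = 0
  · simp [h]
  · rw [mul_inv_cancel₀ (norm_ne_zero_iff.2 h), one_smul]

theorem normal_eq (x : E n) :
    M.normal K x = ‖M.areaVec K (M.inv K x)‖⁻¹ • M.areaVec K (M.inv K x) := rfl

theorem norm_normal_le (x : E n) : ‖M.normal K x‖ ≤ 1 := by
  rw [normal_eq, norm_smul, norm_inv, norm_norm]
  exact inv_mul_le_one

theorem aestronglyMeasurable_normal : AEStronglyMeasurable (M.normal K) (M.surface K) := by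
  have : Measurable fun y => ‖M.areaVec K y‖⁻¹ • M.areaVec K y :=
    ((M.measurable_areaVec K).norm.inv).smul (M.measurable_areaVec K)
  exact (this.comp_aemeasurable (M.aemeasurable_inv K)).aestronglyMeasurable

end Mesh

end SUPG

/-! ### The Piola transform and Green's formula on a cell -/

namespace SUPG

theorem inner_gradient_eq {F : Type*} [NormedAddCommGroup F] [InnerProductSpace ℝ F]
    [CompleteSpace F] (φ : F → ℝ) (x v : F) : inner ℝ (gradient φ x) v = fderiv ℝ φ x v := by
  rw [gradient, InnerProductSpace.toDual_symm_apply]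

namespace Mesh

variable {n : ℕ} {Ω : Set (E n)} {ι : Type*} (M : Mesh Ω ι) (K : ι)

/-- The physical divergence of a vector field given in reference coordinates. -/
noncomputable def refDiv (G : (Fin (n + 1) → ℝ) → E n) (y : Fin (n + 1) → ℝ) : ℝ :=
  (jac (M.comp K) y).det⁻¹ *
    ∑ i, ∑ j, (jac (M.comp K) y).adjugate i j * fderiv ℝ G y (Pi.single i 1) j

theorem jacMap_adjugate (y : Fin (n + 1) → ℝ) (v : E n) :
    jacMap (M.comp K) y ((jac (M.comp K) y).adjugate.mulVec v)
      = (jac (M.comp K) y).det • v := by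
  have : jacLin (M.comp K) y ((jac (M.comp K) y).adjugate.mulVec v)
      = (jac (M.comp K) y).det • v.ofLp := by
    rw [jacLin_apply, Matrix.mulVec_mulVec, Matrix.mul_adjugate, Matrix.smul_mulVec,
      Matrix.one_mulVec]
  ext i
  have := congrFun this i
  simpa [jacMap, toE_apply] using this

theorem inner_conormal (i : Fin (n + 1)) (y : Fin (n + 1) → ℝ) (v : E n) :
    inner ℝ v (M.conormal K i y)
      = M.orient K * ∑ j, (jac (M.comp K) y).adjugate i j * v j := by
  rw [conormal, inner_smul_right]
  simp [PiLp.inner_apply, toE_apply]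

variable {G : (Fin (n + 1) → ℝ) → E n} {φ : E n → ℝ}

theorem continuousOn_of_contDiffAt (hG : ∀ y ∈ refCube n, ContDiffAt ℝ 1 G y) :
    ContinuousOn G (refCube n) := fun y hy => (hG y hy).continuousAt.continuousWithinAt

theorem continuousOn_refDiv (hG : ∀ y ∈ refCube n, ContDiffAt ℝ 1 G y) :
    ContinuousOn (M.refDiv K G) (refCube n) := by
  have h1 : ContinuousOn (fderiv ℝ G) (refCube n) := fun y hy =>
    ((hG y hy).fderiv_right (m := 0) le_rfl).continuousAt.continuousWithinAt
  unfold refDiv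
  refine ContinuousOn.mul ((continuous_det_jac _).continuousOn.inv₀ (M.det_ne_zero K)) ?_
  refine continuousOn_finsetSum _ fun i _ => continuousOn_finsetSum _ fun j _ => ?_
  refine (M.continuous_adjugate K i j).continuousOn.mul ?_
  exact (EuclideanSpace.proj (𝕜 := ℝ) j).continuous.comp_continuousOn
    (h1.clm_apply continuousOn_const)

theorem hasFDerivAt_flux (hφ : ContDiff ℝ 1 φ) {y : Fin (n + 1) → ℝ}
    (hG : DifferentiableAt ℝ G y) (i : Fin (n + 1)) :
    HasFDerivAt (fun y => φ (M.map K y) * inner ℝ (G y) (M.conormal K i y))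
      (φ (M.map K y) • (M.orient K • ∑ j, ((jac (M.comp K) y).adjugate i j •
          (EuclideanSpace.proj j).comp (fderiv ℝ G y)
          + G y j • evalFDeriv ((polyJac (M.comp K)).adjugate i j) y))
        + (inner ℝ (G y) (M.conormal K i y)) •
          (fderiv ℝ φ (M.map K y)).comp (jacMap (M.comp K) y)) y := by
  simp only [inner_conormal]
  have h1 : HasFDerivAt (fun y => φ (M.map K y))
      ((fderiv ℝ φ (M.map K y)).comp (jacMap (M.comp K) y)) y :=
    ((hφ.differentiable one_ne_zero _).hasFDerivAt).comp y (M.hasFDerivAt_map K y)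
  have h2 (j : Fin (n + 1)) : HasFDerivAt (fun y => (jac (M.comp K) y).adjugate i j)
      (evalFDeriv ((polyJac (M.comp K)).adjugate i j) y) y := by
    simp only [adjugate_jac]
    exact hasFDerivAt_mvPolynomial_eval _ _
  have h3 (j : Fin (n + 1)) : HasFDerivAt (fun y => G y j)
      ((EuclideanSpace.proj j).comp (fderiv ℝ G y)) y :=
    (EuclideanSpace.proj (𝕜 := ℝ) j : E n →L[ℝ] ℝ).hasFDerivAt.comp y hG.hasFDerivAt
  exact h1.mul ((HasFDerivAt.fun_sum fun j (_ : j ∈ Finset.univ) => (h2 j).mul (h3 j)).const_mul _)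

/-- The divergence of the Piola transform of `φ G`. Derivatives of the cofactors drop out by
`piola`, those of `φ` recombine into the physical gradient because the Jacobian times its adjugate
is the determinant, and those of `G` form `refDiv`. -/
theorem sum_fderiv_flux (hn : n + 1 = 2 ∨ n + 1 = 3) (hφ : ContDiff ℝ 1 φ)
    {y : Fin (n + 1) → ℝ} (hy : y ∈ refCube n) (hG : DifferentiableAt ℝ G y) :
    ∑ i, fderiv ℝ (fun y => φ (M.map K y) * inner ℝ (G y) (M.conormal K i y)) y (Pi.single i 1)
      = |(jac (M.comp K) y).det| * (inner ℝ (gradient φ (M.map K y)) (G y)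
        + φ (M.map K y) * M.refDiv K G y) := by
  have hd := M.det_ne_zero K y hy
  have hpiola : ∑ i, ∑ j, G y j * MvPolynomial.eval y
      (MvPolynomial.pderiv i ((polyJac (M.comp K)).adjugate i j)) = 0 := by
    rw [Finset.sum_comm]
    refine Finset.sum_eq_zero fun j _ => ?_
    rw [← Finset.mul_sum, ← map_sum, piola _ hn, map_zero, mul_zero]
  have hgrad : ∑ i, (∑ j, (jac (M.comp K) y).adjugate i j * G y j)
        * fderiv ℝ φ (M.map K y) (jacMap (M.comp K) y (Pi.single i 1))
      = (jac (M.comp K) y).det * inner ℝ (gradient φ (M.map K y)) (G y) := by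
    rw [inner_gradient_eq, ← smul_eq_mul, ← map_smul, ← jacMap_adjugate]
    conv_rhs => rw [pi_eq_sum_univ' ((jac (M.comp K) y).adjugate.mulVec (G y)), map_sum, map_sum]
    refine Finset.sum_congr rfl fun i _ => ?_
    rw [map_smul, map_smul]
    rfl
  simp only [fun i => (M.hasFDerivAt_flux K hφ hG i).fderiv]
  simp only [inner_conormal, add_apply, smul_apply, sum_apply,
    ContinuousLinearMap.comp_apply, smul_eq_mul, evalFDeriv_single,
    Finset.sum_add_distrib, mul_assoc, ← Finset.mul_sum, hgrad, hpiola]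
  rw [M.abs_det K hy, refDiv, ← mul_assoc, ← mul_assoc]
  field_simp
  simp only [PiLp.proj_apply]
  ring

/-- Green's formula on a cell. -/
theorem green_cell (hn : n + 1 = 2 ∨ n + 1 = 3)
    (hG : ∀ y ∈ refCube n, ContDiffAt ℝ 1 G y) (hφ : ContDiff ℝ 1 φ) :
    ∫ x in M.cell K, (inner ℝ (gradient φ x) (G (M.inv K x)) + φ x * M.refDiv K G (M.inv K x))
      = ∫ x, φ x * inner ℝ (G (M.inv K x)) (M.normal K x) ∂M.surface K := by
  have hGc := continuousOn_of_contDiffAt hG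
  have hGinv : ContinuousOn (fun x => G (M.inv K x)) (M.closedCell K) :=
    hGc.comp (M.continuousOn_inv K) fun x hx => M.inv_mem hx
  have hW (i : Fin (n + 1)) : ContinuousOn
      (fun y => φ (M.map K y) * inner ℝ (G y) (M.conormal K i y)) (refCube n) :=
    ((hφ.continuous.comp (M.continuous_map K)).continuousOn).mul
      (hGc.inner (M.continuous_conormal K i).continuousOn)
  have hgradφ : Continuous (gradient φ) :=
    (InnerProductSpace.toDual ℝ (E n)).symm.continuous.comp (hφ.continuous_fderiv one_ne_zero)
  rw [setIntegral_cell, integral_surface]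
  · have hR : ∫ y, ‖M.areaVec K y‖ * (φ (M.map K y) *
        inner ℝ (G (M.inv K (M.map K y))) (M.normal K (M.map K y))) ∂refSurface n
        = ∫ y, ∑ j, (φ (M.map K y) * inner ℝ (G y) (M.conormal K j y)) * refNormal y j
          ∂refSurface n := by
      refine integral_congr_ae ?_
      filter_upwards [ae_mem_refCube] with y hy
      rw [M.inv_map K hy, mul_left_comm, ← inner_smul_right, M.norm_smul_normal_map K hy,
        M.areaVec_eq K hy, inner_sum, Finset.mul_sum]
      refine Finset.sum_congr rfl fun j _ => ?_
      rw [inner_smul_right]; ring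
    rw [hR, integral_flux hW]
    -- The flux has only to be continuous on the closed cube and differentiable inside it;
    -- integrability of its divergence is read off from the formula in `hcong`.
    have hdiv := integral_divergence_of_hasFDerivAt_off_countable' (E := ℝ)
      (0 : Fin (n + 1) → ℝ) 1 zero_le_one
      (fun i y => φ (M.map K y) * inner ℝ (G y) (M.conormal K i y))
      (fun i y => fderiv ℝ (fun y => φ (M.map K y) * inner ℝ (G y) (M.conormal K i y)) y)
      ∅ countable_empty hW
      (fun y hy i => (M.hasFDerivAt_flux K hφ ((hG y (refCubeInt_subset
        (mem_refCubeInt.2 fun k => by simpa using hy.1 k))).differentiableAt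
          one_ne_zero) i).differentiableAt.hasFDerivAt)
    have hcong : EqOn (fun y => ∑ i, fderiv ℝ (fun y => φ (M.map K y) *
        inner ℝ (G y) (M.conormal K i y)) y (Pi.single i 1))
        (fun y => |(jac (M.comp K) y).det| * (inner ℝ (gradient φ (M.map K y)) (G y)
        + φ (M.map K y) * M.refDiv K G y)) (refCube n) := fun y hy =>
      M.sum_fderiv_flux K hn hφ hy ((hG y hy).differentiableAt one_ne_zero)
    have hint : IntegrableOn (fun y => |(jac (M.comp K) y).det| *
        (inner ℝ (gradient φ (M.map K y)) (G y) + φ (M.map K y) * M.refDiv K G y))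
        (refCube n) := by
      refine ContinuousOn.integrableOn_compact isCompact_refCube ?_
      refine (continuous_det_jac _).abs.continuousOn.mul ?_
      refine (((hgradφ.comp (M.continuous_map K)).continuousOn).inner hGc).add ?_
      exact ((hφ.continuous.comp (M.continuous_map K)).continuousOn).mul
        (M.continuousOn_refDiv K hG)
    have hmeas : MeasurableSet (refCube n) := isCompact_refCube.measurableSet
    have hdiv' := hdiv (hint.congr_fun hcong.symm hmeas)
    have hcong' := (setIntegral_congr_fun (μ := volume) hmeas hcong).symm.trans hdiv'
    have hint_eq : ∫ y in refCubeInt n, |(jac (M.comp K) y).det| *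
        (inner ℝ (gradient φ (M.map K y)) (G (M.inv K (M.map K y)))
          + φ (M.map K y) * M.refDiv K G (M.inv K (M.map K y)))
        = ∫ y in refCube n, |(jac (M.comp K) y).det| *
        (inner ℝ (gradient φ (M.map K y)) (G y) + φ (M.map K y) * M.refDiv K G y) := by
      rw [← setIntegral_congr_set refCubeInt_ae_eq]
      refine setIntegral_congr_fun isOpen_refCubeInt.measurableSet fun y hy => ?_
      simp only [M.inv_map K (refCubeInt_subset hy)]
    rw [hint_eq]
    exact hcong'
  · exact (M.aestronglyMeasurable_of_continuousOn K hφ.continuous.continuousOn).mul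
      ((M.aestronglyMeasurable_of_continuousOn K hGinv).inner (M.aestronglyMeasurable_normal K))

end Mesh

end SUPG

namespace SUPG

open scoped ENNReal NNReal

/-! ### Test functions -/

section Test

variable {n : ℕ} {Ω : Set (E n)} {φ ψ : E n → ℝ}

theorem gradient_sub_of_differentiable {F : Type*} [NormedAddCommGroup F] [InnerProductSpace ℝ F]
    [CompleteSpace F] {φ ψ : F → ℝ} (hφ : Differentiable ℝ φ) (hψ : Differentiable ℝ ψ) :
    gradient (φ - ψ) = gradient φ - gradient ψ := by
  ext1 x
  simp [gradient, fderiv_sub (hφ x) (hψ x)]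

theorem gradient_add_of_differentiable {F : Type*} [NormedAddCommGroup F] [InnerProductSpace ℝ F]
    [CompleteSpace F] {φ ψ : F → ℝ} (hφ : Differentiable ℝ φ) (hψ : Differentiable ℝ ψ) :
    gradient (φ + ψ) = gradient φ + gradient ψ := by
  ext1 x
  simp [gradient, fderiv_add (hφ x) (hψ x)]

theorem gradient_smul_of_differentiable {F : Type*} [NormedAddCommGroup F] [InnerProductSpace ℝ F]
    [CompleteSpace F] {φ : F → ℝ} (c : ℝ) (hφ : Differentiable ℝ φ) :
    gradient (c • φ) = c • gradient φ := by
  ext1 x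
  simp [gradient, fderiv_const_smul (hφ x)]

theorem continuous_gradient {F : Type*} [NormedAddCommGroup F] [InnerProductSpace ℝ F]
    [CompleteSpace F] {φ : F → ℝ} (hφ : ContDiff ℝ 1 φ) : Continuous (gradient φ) :=
  (InnerProductSpace.toDual ℝ F).symm.continuous.comp (hφ.continuous_fderiv one_ne_zero)

namespace IsTest

theorem contDiff_one (h : IsTest Ω φ) : ContDiff ℝ 1 φ := h.1.of_le (by exact_mod_cast le_top)

theorem differentiable (h : IsTest Ω φ) : Differentiable ℝ φ :=
  h.contDiff_one.differentiable one_ne_zero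

theorem continuous (h : IsTest Ω φ) : Continuous φ := h.1.continuous

theorem add (h : IsTest Ω φ) (h' : IsTest Ω ψ) : IsTest Ω (φ + ψ) :=
  ⟨h.1.add h'.1, h.2.1.add h'.2.1, (tsupport_add _ _).trans (union_subset h.2.2 h'.2.2)⟩

theorem smul (c : ℝ) (h : IsTest Ω φ) : IsTest Ω (c • φ) :=
  ⟨contDiff_const.smul h.1, h.2.1.smul_left, (tsupport_smul_subset_right (fun _ => c) φ).trans h.2.2⟩

theorem sub (h : IsTest Ω φ) (h' : IsTest Ω ψ) : IsTest Ω (φ - ψ) := by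
  have := h.add (h'.smul (-1))
  rwa [neg_one_smul, ← sub_eq_add_neg] at this

theorem zero : IsTest Ω (0 : E n → ℝ) :=
  ⟨contDiff_const, HasCompactSupport.zero, by simp [tsupport]⟩

theorem memLp (h : IsTest Ω φ) (p : ℝ≥0∞) (μ : Measure (E n)) [IsFiniteMeasureOnCompacts μ] :
    MemLp φ p μ := h.continuous.memLp_of_hasCompactSupport h.2.1

theorem memLp_gradient (h : IsTest Ω φ) (p : ℝ≥0∞) (μ : Measure (E n))
    [IsFiniteMeasureOnCompacts μ] : MemLp (gradient φ) p μ := by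
  refine (continuous_gradient h.contDiff_one).memLp_of_hasCompactSupport ?_
  exact (h.2.1.fderiv (𝕜 := ℝ)).comp_left (g := (InnerProductSpace.toDual ℝ (E n)).symm)
    (map_zero _)

theorem eq_zero_of_notMem (h : IsTest Ω φ) {x : E n} (hx : x ∉ Ω) : φ x = 0 :=
  image_eq_zero_of_notMem_tsupport fun hx' => hx (h.2.2 hx')

theorem mono {Ω' : Set (E n)} (hΩ : Ω ⊆ Ω') (h : IsTest Ω φ) : IsTest Ω' φ :=
  ⟨h.1, h.2.1, h.2.2.trans hΩ⟩

end IsTest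

theorem eLpNorm_two_sq {α F : Type*} [MeasurableSpace α] [NormedAddCommGroup F] {μ : Measure α}
    {f : α → F} (hf : MemLp f 2 μ) : eLpNorm f 2 μ ^ 2 = ENNReal.ofReal (∫ x, ‖f x‖ ^ 2 ∂μ) := by
  have h := eLpNorm_nnreal_pow_eq_lintegral (f := f) (μ := μ) (p := 2) two_ne_zero
  rw [ofReal_integral_eq_lintegral_ofReal (hf.integrable_norm_pow two_ne_zero)
    (Eventually.of_forall fun x => by positivity)]
  simp only [NNReal.coe_ofNat, ENNReal.coe_ofNat, ENNReal.rpow_ofNat] at h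
  rw [h]
  refine lintegral_congr fun x => ?_
  rw [ENNReal.ofReal_pow (norm_nonneg _), ofReal_norm]

/-- Every element of `H¹₀(Ω)` is the limit of a sequence of test functions. -/
theorem exists_isTest_tendsto (w : V Ω) : ∃ φ : ℕ → E n → ℝ, (∀ m, IsTest Ω (φ m)) ∧
    Tendsto (fun m => eLpNorm (φ m - V.val w) 2 (volume.restrict Ω)) atTop (𝓝 0) ∧
    Tendsto (fun m => eLpNorm (gradient (φ m) - V.grad w) 2 (volume.restrict Ω)) atTop (𝓝 0) := by
  -- The pairs of a test function and its gradient already form a subspace, so every element of the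
  -- span is again such a pair.
  have hspan : ∀ v ∈ Submodule.span ℝ {w : L2Pair Ω | ∃ φ : E n → ℝ, IsTest Ω φ ∧
      w.fst =ᵐ[volume.restrict Ω] φ ∧ w.snd =ᵐ[volume.restrict Ω] gradient φ},
      ∃ φ : E n → ℝ, IsTest Ω φ ∧
        v.fst =ᵐ[volume.restrict Ω] φ ∧ v.snd =ᵐ[volume.restrict Ω] gradient φ := by
    intro v hv
    induction hv using Submodule.span_induction with
    | mem v hv => exact hv
    | zero =>
      refine ⟨0, IsTest.zero, Lp.coeFn_zero _ _ _, ?_⟩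
      have : gradient (0 : E n → ℝ) = 0 := by
        ext1 x; simp [gradient]
      rw [this]
      exact Lp.coeFn_zero _ _ _
    | add v v' _ _ hv hv' =>
      obtain ⟨φ, h, h1, h2⟩ := hv
      obtain ⟨φ', h', h1', h2'⟩ := hv'
      refine ⟨φ + φ', h.add h', (Lp.coeFn_add _ _).trans (h1.add h1'), ?_⟩
      rw [gradient_add_of_differentiable h.differentiable h'.differentiable]
      exact (Lp.coeFn_add _ _).trans (h2.add h2')
    | smul c v _ hv =>
      obtain ⟨φ, h, h1, h2⟩ := hv
      refine ⟨c • φ, h.smul c, (Lp.coeFn_smul _ _).trans (h1.const_smul c), ?_⟩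
      rw [gradient_smul_of_differentiable c h.differentiable]
      exact (Lp.coeFn_smul _ _).trans (h2.const_smul c)
  have hw : (w : L2Pair Ω) ∈ closure (Submodule.span ℝ {w : L2Pair Ω | ∃ φ : E n → ℝ, IsTest Ω φ ∧
      w.fst =ᵐ[volume.restrict Ω] φ ∧ w.snd =ᵐ[volume.restrict Ω] gradient φ} :
      Set (L2Pair Ω)) := w.2
  obtain ⟨v, hv, hlim⟩ := mem_closure_iff_seq_limit.1 hw
  choose φ hφ h1 h2 using fun m => hspan (v m) (hv m)
  refine ⟨φ, hφ, ?_, ?_⟩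
  · have := ((WithLp.prod_continuous_ofLp 2 _ _).fst.tendsto (w : L2Pair Ω)).comp hlim
    refine (tendsto_congr fun m => eLpNorm_congr_ae ?_).1 ((Lp.tendsto_Lp_iff_tendsto_eLpNorm' _ _).1 this)
    exact (h1 m).sub .rfl
  · have := ((WithLp.prod_continuous_ofLp 2 _ _).snd.tendsto (w : L2Pair Ω)).comp hlim
    refine (tendsto_congr fun m => eLpNorm_congr_ae ?_).1 ((Lp.tendsto_Lp_iff_tendsto_eLpNorm' _ _).1 this)
    exact (h2 m).sub .rfl

end Test

/-! ### Traces -/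

namespace Mesh

variable {n : ℕ} {Ω : Set (E n)} {ι : Type*} (M : Mesh Ω ι) (K : ι)

/-- A vector field, in reference coordinates, that is transversal to the boundary of the cell. -/
noncomputable def transversal (y : Fin (n + 1) → ℝ) : E n :=
  jacMap (M.comp K) y (2 • y - 1)

theorem contDiff_transversal : ContDiff ℝ 1 (M.transversal K) := by
  have : M.transversal K = fun y => toE n (fun i => ∑ j,
      MvPolynomial.eval y (MvPolynomial.pderiv j (M.comp K i)) * (2 * y j - 1)) := by
    ext y i
    simp only [transversal, jacMap_apply, jac, toE_apply]
    simp
  rw [this]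
  refine (toE n).contDiff.comp (contDiff_pi.2 fun i => ContDiff.sum fun j _ => ?_)
  refine ContDiff.mul ((contDiff_mvPolynomial_eval _).of_le (by exact_mod_cast le_top)) ?_
  exact (contDiff_const.mul (contDiff_apply ℝ ℝ j)).sub contDiff_const

/-- The field `2y - 1` points away from the centre of the cube and has outward normal component one
on every face. Pairing its image with a conormal multiplies this by the absolute determinant. On the
lower dimensional faces several such nonnegative terms add up, hence an inequality. -/
theorem inner_transversal_areaVec {y : Fin (n + 1) → ℝ} (hy : y ∈ refCube n)
    (hy' : y ∉ refCubeInt n) :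
    |(jac (M.comp K) y).det| ≤ inner ℝ (M.transversal K y) (M.areaVec K y) := by
  have h1 (i : Fin (n + 1)) : inner ℝ (M.transversal K y) (M.conormal K i y)
      = |(jac (M.comp K) y).det| * (2 * y i - 1) := by
    have : ∑ j, (jac (M.comp K) y).adjugate i j * M.transversal K y j
        = (jac (M.comp K) y).det * (2 * y i - 1) := by
      have h : (jac (M.comp K) y).adjugate.mulVec ((jac (M.comp K) y).mulVec (2 • y - 1))
          = (jac (M.comp K) y).det • (2 • y - 1) := by
        rw [Matrix.mulVec_mulVec, Matrix.adjugate_mul, Matrix.smul_mulVec, Matrix.one_mulVec]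
      have := congrFun h i
      simpa [transversal, jacMap, jacLin_apply, toE_apply, Matrix.mulVec, dotProduct] using this
    rw [inner_conormal, this, M.abs_det K hy, mul_assoc]
  have h2 (i : Fin (n + 1)) : 0 ≤ refNormal y i * (2 * y i - 1) := by
    unfold refNormal
    split_ifs with h h <;> simp [h]
  have h3 : 1 ≤ ∑ i, refNormal y i * (2 * y i - 1) := by
    rw [mem_refCubeInt] at hy'
    push Not at hy'
    obtain ⟨i, hi⟩ := hy'
    refine le_trans ?_ (Finset.single_le_sum (fun i _ => h2 i) (Finset.mem_univ i))
    have hyi := mem_refCube.1 hy i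
    have : y i = 0 ∨ y i = 1 := by
      by_contra! hc
      exact hi ⟨lt_of_le_of_ne hyi.1 hc.1.symm, lt_of_le_of_ne hyi.2 hc.2⟩
    rcases this with h | h <;> simp [refNormal, h]
    norm_num
  rw [M.areaVec_eq K hy, inner_sum]
  simp only [inner_smul_right, h1]
  calc |(jac (M.comp K) y).det| = |(jac (M.comp K) y).det| * 1 := (mul_one _).symm
    _ ≤ |(jac (M.comp K) y).det| * ∑ i, refNormal y i * (2 * y i - 1) := by gcongr
    _ = _ := by
      rw [Finset.mul_sum]
      exact Finset.sum_congr rfl fun i _ => by ring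

theorem exists_transversal_bound : ∃ κ > 0, ∀ᵐ x ∂M.surface K,
    κ ≤ inner ℝ (M.transversal K (M.inv K x)) (M.normal K x) := by
  obtain ⟨C, hC⟩ := M.exists_norm_areaVec_le K
  obtain ⟨y₀, hy₀, hmin⟩ := isCompact_refCube.exists_isMinOn ⟨0, zero_mem_refCube (n := n)⟩
    (continuous_det_jac (M.comp K)).abs.continuousOn
  set c := |(jac (M.comp K) y₀).det| with hc
  have hc0 : 0 < c := abs_pos.2 (M.det_ne_zero K y₀ hy₀)
  have hC1 : 0 < |C| + 1 := by positivity
  -- The least absolute determinant over an upper bound for the length of the area vectors; the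
  -- summand one keeps the denominator positive.
  refine ⟨c / (|C| + 1), by positivity, ?_⟩
  filter_upwards [M.ae_mem_closedCell K, M.ae_notMem_cell K] with x hx hx'
  obtain ⟨y, hy, rfl⟩ := hx
  rw [M.map_mem_cell_iff K hy] at hx'
  have h1 := M.inner_transversal_areaVec K hy hx'
  have h2 : c ≤ |(jac (M.comp K) y).det| := hmin hy
  rw [M.inv_map K hy]
  rw [← M.norm_smul_normal_map K hy, inner_smul_right] at h1
  have h3 : ‖M.areaVec K y‖ ≤ |C| + 1 := (hC y hy).trans ((le_abs_self C).trans (by simp))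
  rw [div_le_iff₀ hC1]
  have h4 : 0 < inner ℝ (M.transversal K y) (M.normal K (M.map K y)) := by
    by_contra! hneg
    have := mul_nonpos_of_nonneg_of_nonpos (norm_nonneg (M.areaVec K y)) hneg
    linarith
  nlinarith

theorem integrableOn_cell_of_continuousOn {F : Type*} [NormedAddCommGroup F] {h : E n → F}
    (hh : ContinuousOn h (M.closedCell K)) : IntegrableOn h (M.cell K) :=
  (hh.integrableOn_compact (M.isCompact_closedCell K)).mono_set (M.cell_subset_closedCell K)

theorem integrable_surface_of_continuousOn {h : E n → ℝ}
    (hh : ContinuousOn h (M.closedCell K)) : Integrable h (M.surface K) := by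
  rw [← M.restrict_surface K]
  exact hh.integrableOn_compact (M.isCompact_closedCell K)

theorem continuousOn_comp_inv {F : Type*} [TopologicalSpace F] {G : (Fin (n + 1) → ℝ) → F}
    (hG : ContinuousOn G (refCube n)) :
    ContinuousOn (fun x => G (M.inv K x)) (M.closedCell K) :=
  hG.comp (M.continuousOn_inv K) fun _ hx => M.inv_mem hx

theorem exists_bound_comp_inv {F : Type*} [NormedAddCommGroup F] {G : (Fin (n + 1) → ℝ) → F}
    (hG : ContinuousOn G (refCube n)) : ∃ C, 0 ≤ C ∧ ∀ x ∈ M.closedCell K, ‖G (M.inv K x)‖ ≤ C := by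
  obtain ⟨C, hC⟩ := isCompact_refCube.exists_bound_of_continuousOn hG
  exact ⟨C, (norm_nonneg _).trans (hC 0 zero_mem_refCube), fun x hx => hC _ (M.inv_mem hx)⟩

/-- The trace inequality for smooth functions. -/
theorem trace_inequality (hn : n + 1 = 2 ∨ n + 1 = 3) : ∃ C : ℝ, 0 ≤ C ∧ ∀ φ : E n → ℝ,
    ContDiff ℝ 1 φ → ∫ x, φ x ^ 2 ∂M.surface K
      ≤ C * ((∫ x in M.cell K, φ x ^ 2) + ∫ x in M.cell K, ‖gradient φ x‖ ^ 2) := by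
  obtain ⟨κ, hκ, hbound⟩ := M.exists_transversal_bound K
  have hG : ∀ y ∈ refCube n, ContDiffAt ℝ 1 (M.transversal K) y := fun y _ =>
    (M.contDiff_transversal K).contDiffAt
  have hGc := continuousOn_of_contDiffAt hG
  have hdc := M.continuousOn_refDiv K hG
  obtain ⟨C₁, hC₁, hC₁'⟩ := M.exists_bound_comp_inv K hGc
  obtain ⟨C₂, hC₂, hC₂'⟩ := M.exists_bound_comp_inv K hdc
  -- Green's formula is applied to `φ²` and the transversal field. The boundary term is at least `κ
  -- ∫ φ²`. The volume term `2 φ ∇φ·G + φ² div G` is bounded with `2ab ≤ a² + b²`, where `C₁` and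
  -- `C₂` bound the field and its divergence.
  refine ⟨(C₁ + C₂) / κ, by positivity, fun φ hφ => ?_⟩
  have hφ2 : ContDiff ℝ 1 (fun x => φ x ^ 2) := hφ.pow 2
  have hgrad := continuous_gradient hφ
  have hgrad2 (x v : E n) : inner ℝ (gradient (fun x => φ x ^ 2) x) v
      = 2 * φ x * inner ℝ (gradient φ x) v := by
    rw [inner_gradient_eq, inner_gradient_eq, fderiv_fun_pow 2 (hφ.differentiable one_ne_zero x)]
    simp
  have hgreen := M.green_cell K hn hG hφ2
  simp only [hgrad2] at hgreen
  have hGi := M.continuousOn_comp_inv K hGc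
  have hdi := M.continuousOn_comp_inv K hdc
  have i1 : IntegrableOn (fun x => φ x ^ 2) (M.cell K) :=
    M.integrableOn_cell_of_continuousOn K hφ2.continuous.continuousOn
  have i2 : IntegrableOn (fun x => ‖gradient φ x‖ ^ 2) (M.cell K) :=
    M.integrableOn_cell_of_continuousOn K (hgrad.norm.pow 2).continuousOn
  have hub : ∫ x in M.cell K, (2 * φ x * inner ℝ (gradient φ x) (M.transversal K (M.inv K x))
      + φ x ^ 2 * M.refDiv K (M.transversal K) (M.inv K x))
      ≤ ∫ x in M.cell K, (C₁ + C₂) * (φ x ^ 2 + ‖gradient φ x‖ ^ 2) := by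
    refine setIntegral_mono_on (M.integrableOn_cell_of_continuousOn K ?_)
      ((i1.add i2).const_mul _) (M.isOpen_cell K).measurableSet fun x hx => ?_
    · exact ((continuousOn_const.mul hφ.continuous.continuousOn).mul
        (hgrad.continuousOn.inner hGi)).add (hφ2.continuous.continuousOn.mul hdi)
    · have hxK := M.cell_subset_closedCell K hx
      have h1 : |inner ℝ (gradient φ x) (M.transversal K (M.inv K x))| ≤ ‖gradient φ x‖ * C₁ :=
        (abs_real_inner_le_norm _ _).trans (by gcongr; exact hC₁' x hxK)
      have h2 : M.refDiv K (M.transversal K) (M.inv K x) ≤ C₂ :=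
        (le_abs_self _).trans (hC₂' x hxK)
      have h3 : 2 * φ x * inner ℝ (gradient φ x) (M.transversal K (M.inv K x))
          ≤ 2 * |φ x| * (‖gradient φ x‖ * C₁) := by
        refine (le_abs_self _).trans ?_
        rw [abs_mul, abs_mul, abs_two]
        gcongr
      have h4 : 2 * |φ x| * ‖gradient φ x‖ ≤ φ x ^ 2 + ‖gradient φ x‖ ^ 2 := by
        rw [← sq_abs (φ x)]
        exact two_mul_le_add_sq _ _
      have h5 := mul_le_mul_of_nonneg_left h2 (sq_nonneg (φ x))
      have h6 := mul_le_mul_of_nonneg_right h4 hC₁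
      have h7 := mul_nonneg hC₂ (sq_nonneg ‖gradient φ x‖)
      nlinarith
  have hlb : κ * ∫ x, φ x ^ 2 ∂M.surface K
      ≤ ∫ x, φ x ^ 2 * inner ℝ (M.transversal K (M.inv K x)) (M.normal K x) ∂M.surface K := by
    rw [← integral_const_mul]
    have j1 := M.integrable_surface_of_continuousOn K hφ2.continuous.continuousOn
    refine integral_mono_ae (j1.const_mul _) ?_ ?_
    · refine Integrable.mono' (j1.mul_const C₁) ((M.aestronglyMeasurable_of_continuousOn K
        hφ2.continuous.continuousOn).mul ((M.aestronglyMeasurable_of_continuousOn K hGi).inner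
          (M.aestronglyMeasurable_normal K))) ?_
      filter_upwards [M.ae_mem_closedCell K] with x hx
      rw [norm_mul, Real.norm_of_nonneg (sq_nonneg (φ x))]
      gcongr
      refine (norm_inner_le_norm _ _).trans ?_
      calc _ ≤ C₁ * 1 := mul_le_mul (hC₁' x hx) (M.norm_normal_le K x) (norm_nonneg _) hC₁
        _ = C₁ := mul_one _
    · filter_upwards [hbound] with x hx
      rw [mul_comm]
      gcongr
  rw [← hgreen] at hlb
  have := hlb.trans hub
  rw [integral_const_mul, integral_add i1 i2] at this
  rw [div_mul_eq_mul_div, le_div_iff₀ hκ]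
  linarith

theorem exists_eLpNorm_surface_le (hn : n + 1 = 2 ∨ n + 1 = 3) : ∃ C : ℝ≥0, ∀ φ : E n → ℝ,
    IsTest Ω φ → eLpNorm φ 2 (M.surface K) ≤ C * (eLpNorm φ 2 (volume.restrict Ω)
      + eLpNorm (gradient φ) 2 (volume.restrict Ω)) := by
  obtain ⟨C, hC, hbound⟩ := M.trace_inequality K hn
  -- Since `C ≤ (C + 1)²`, this constant avoids a square root when the squared inequality is
  -- compared.
  refine ⟨Real.toNNReal (C + 1), fun φ hφ => ?_⟩
  have hle : volume.restrict (M.cell K) ≤ volume.restrict Ω :=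
    Measure.restrict_mono (M.cell_subset K) le_rfl
  refine le_trans ?_ (mul_le_mul_right (add_le_add (eLpNorm_mono_measure _ hle)
    (eLpNorm_mono_measure _ hle)) _)
  refine (ENNReal.pow_le_pow_left_iff two_ne_zero).1 ?_
  have h := hbound φ hφ.contDiff_one
  have e1 := eLpNorm_two_sq (hφ.memLp 2 (M.surface K))
  have e2 := eLpNorm_two_sq (hφ.memLp 2 (volume.restrict (M.cell K)))
  have e3 := eLpNorm_two_sq (hφ.memLp_gradient 2 (volume.restrict (M.cell K)))
  simp only [Real.norm_eq_abs, sq_abs] at e1 e2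
  have p2 : 0 ≤ ∫ x in M.cell K, φ x ^ 2 := integral_nonneg fun x => sq_nonneg _
  have p3 : 0 ≤ ∫ x in M.cell K, ‖gradient φ x‖ ^ 2 := integral_nonneg fun x => sq_nonneg _
  calc eLpNorm φ 2 (M.surface K) ^ 2 = ENNReal.ofReal (∫ x, φ x ^ 2 ∂M.surface K) := e1
    _ ≤ ENNReal.ofReal ((C + 1) ^ 2 * ((∫ x in M.cell K, φ x ^ 2)
          + ∫ x in M.cell K, ‖gradient φ x‖ ^ 2)) := by
        refine ENNReal.ofReal_le_ofReal (h.trans ?_)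
        gcongr
        nlinarith
    _ = (Real.toNNReal (C + 1) : ℝ≥0∞) ^ 2 * (eLpNorm φ 2 (volume.restrict (M.cell K)) ^ 2
          + eLpNorm (gradient φ) 2 (volume.restrict (M.cell K)) ^ 2) := by
        rw [e2, e3, ENNReal.ofReal_mul (by positivity), ENNReal.ofReal_add p2 p3,
          ENNReal.ofReal_pow (by positivity)]
        rfl
    _ ≤ _ := by
        rw [mul_pow]
        gcongr
        rw [add_sq]
        calc _ ≤ _ := le_add_of_nonneg_right (zero_le (a := 2 *
              eLpNorm φ 2 (volume.restrict (M.cell K)) *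
              eLpNorm (gradient φ) 2 (volume.restrict (M.cell K))))
          _ = _ := by ring

variable {K}

/-- Every sequence of test functions that converges to `w` in the `H¹` norm converges to every
trace of `w`. -/
theorem IsTrace.tendsto {M : Mesh Ω ι} (hn : n + 1 = 2 ∨ n + 1 = 3) {w : V Ω} {g : E n → ℝ}
    (hg : M.IsTrace K w g) {ψ : ℕ → E n → ℝ} (hψ : ∀ m, IsTest Ω (ψ m))
    (h1 : Tendsto (fun m => eLpNorm (ψ m - V.val w) 2 (volume.restrict Ω)) atTop (𝓝 0))
    (h2 : Tendsto (fun m => eLpNorm (gradient (ψ m) - V.grad w) 2 (volume.restrict Ω)) atTop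
      (𝓝 0)) : Tendsto (fun m => eLpNorm (ψ m - g) 2 (M.surface K)) atTop (𝓝 0) := by
  obtain ⟨hgL, φ, hφ, h1', h2', h3'⟩ := hg
  obtain ⟨C, hC⟩ := M.exists_eLpNorm_surface_le K hn
  have mval : AEStronglyMeasurable (V.val w) (volume.restrict Ω) := Lp.aestronglyMeasurable _
  have mgrad : AEStronglyMeasurable (V.grad w) (volume.restrict Ω) := Lp.aestronglyMeasurable _
  have key (m : ℕ) : eLpNorm (ψ m - g) 2 (M.surface K) ≤
      C * ((eLpNorm (ψ m - V.val w) 2 (volume.restrict Ω)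
        + eLpNorm (φ m - V.val w) 2 (volume.restrict Ω))
        + (eLpNorm (gradient (ψ m) - V.grad w) 2 (volume.restrict Ω)
        + eLpNorm (gradient (φ m) - V.grad w) 2 (volume.restrict Ω)))
        + eLpNorm (φ m - g) 2 (M.surface K) := by
    -- The trace inequality controls `ψ m - φ m` on `∂K`, because both sequences have the same `H¹`
    -- limit.
    have a1 : ψ m - g = (ψ m - φ m) + (φ m - g) := by abel
    have a2 : ψ m - φ m = (ψ m - V.val w) - (φ m - V.val w) := by abel
    have a3 : gradient (ψ m - φ m) = (gradient (ψ m) - V.grad w) - (gradient (φ m) - V.grad w) := by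
      rw [gradient_sub_of_differentiable (hψ m).differentiable (hφ m).differentiable]; abel
    have b1 := ((hψ m).memLp 2 (volume.restrict Ω)).1.sub mval
    have b2 := ((hφ m).memLp 2 (volume.restrict Ω)).1.sub mval
    have b3 := ((hψ m).memLp_gradient 2 (volume.restrict Ω)).1.sub mgrad
    have b4 := ((hφ m).memLp_gradient 2 (volume.restrict Ω)).1.sub mgrad
    have c1 := eLpNorm_sub_le b1 b2 one_le_two
    have c2 := eLpNorm_sub_le b3 b4 one_le_two
    rw [← a2] at c1
    rw [← a3] at c2
    rw [a1]
    refine (eLpNorm_add_le (((hψ m).sub (hφ m)).memLp 2 (M.surface K)).1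
      (((hφ m).memLp 2 (M.surface K)).1.sub hgL.1) one_le_two).trans ?_
    gcongr
    exact (hC _ ((hψ m).sub (hφ m))).trans (by gcongr)
  refine tendsto_of_tendsto_of_tendsto_of_le_of_le tendsto_const_nhds ?_ (fun m => zero_le)
    key
  have := (ENNReal.Tendsto.const_mul (a := (C : ℝ≥0∞)) ((h1.add h1').add (h2.add h2'))
    (Or.inr ENNReal.coe_ne_top)).add h3'
  simpa using this

/-- By the trace inequality an approximating sequence of test functions is Cauchy in `L²(∂K)`, and
this space is complete. -/
theorem exists_isTrace (hn : n + 1 = 2 ∨ n + 1 = 3) (w : V Ω) : ∃ g, M.IsTrace K w g := by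
  obtain ⟨φ, hφ, h1, h2⟩ := exists_isTest_tendsto w
  obtain ⟨C, hC⟩ := M.exists_eLpNorm_surface_le K hn
  have mval : AEStronglyMeasurable (V.val w) (volume.restrict Ω) := Lp.aestronglyMeasurable _
  have mgrad : AEStronglyMeasurable (V.grad w) (volume.restrict Ω) := Lp.aestronglyMeasurable _
  set a : ℕ → ℝ≥0∞ := fun m => eLpNorm (φ m - V.val w) 2 (volume.restrict Ω)
    + eLpNorm (gradient (φ m) - V.grad w) 2 (volume.restrict Ω) with ha
  have ha0 : Tendsto a atTop (𝓝 0) := by simpa using h1.add h2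
  have key (m k : ℕ) : eLpNorm (φ m - φ k) 2 (M.surface K) ≤ C * (a m + a k) := by
    have a2 : φ m - φ k = (φ m - V.val w) - (φ k - V.val w) := by abel
    have a3 : gradient (φ m - φ k) = (gradient (φ m) - V.grad w) - (gradient (φ k) - V.grad w) := by
      rw [gradient_sub_of_differentiable (hφ m).differentiable (hφ k).differentiable]; abel
    have b1 (m : ℕ) := ((hφ m).memLp 2 (volume.restrict Ω)).1.sub mval
    have b3 (m : ℕ) := ((hφ m).memLp_gradient 2 (volume.restrict Ω)).1.sub mgrad
    have c1 := eLpNorm_sub_le (b1 m) (b1 k) one_le_two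
    have c2 := eLpNorm_sub_le (b3 m) (b3 k) one_le_two
    rw [← a2] at c1
    rw [← a3] at c2
    refine (hC _ ((hφ m).sub (hφ k))).trans (mul_le_mul' le_rfl
      ((add_le_add c1 c2).trans (le_of_eq ?_)))
    simp only [ha]; abel
  have hmem (m : ℕ) := (hφ m).memLp 2 (M.surface K)
  have hcauchy : CauchySeq fun m => (hmem m).toLp (φ m) := by
    rw [EMetric.cauchySeq_iff]
    intro δ hδ
    have hlim : Tendsto (fun m => C * (a m + a m)) atTop (𝓝 0) := by
      simpa using ENNReal.Tendsto.const_mul (a := (C : ℝ≥0∞)) (ha0.add ha0)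
        (Or.inr ENNReal.coe_ne_top)
    have hlim2 : Tendsto (fun q : ℕ × ℕ => C * (a q.1 + a q.2)) atTop (𝓝 0) := by
      rw [← prod_atTop_atTop_eq]
      simpa using ENNReal.Tendsto.const_mul (a := (C : ℝ≥0∞))
        ((ha0.comp tendsto_fst).add (ha0.comp tendsto_snd)) (Or.inr ENNReal.coe_ne_top)
    obtain ⟨N, hN⟩ := eventually_atTop_prod_self.1 (hlim2.eventually_lt_const hδ)
    refine ⟨N, fun m hm k hk => ?_⟩
    rw [Lp.edist_toLp_toLp]
    exact (key m k).trans_lt (hN m k hm hk)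
  obtain ⟨g, hg⟩ := cauchySeq_tendsto_of_complete hcauchy
  refine ⟨g, Lp.memLp g, φ, hφ, h1, h2, ?_⟩
  refine (tendsto_congr fun m => eLpNorm_congr_ae ?_).1 ((Lp.tendsto_Lp_iff_tendsto_eLpNorm' _ _).1 hg)
  exact (hmem m).coeFn_toLp.sub .rfl

end Mesh

end SUPG

namespace SUPG

open scoped ENNReal NNReal

namespace Mesh

variable {n : ℕ} {Ω : Set (E n)} {ι : Type*} (M : Mesh Ω ι) (K : ι)

/-! ### Piecewise polynomial functions -/

/-- Within the closed cell, continuity of `inv` keeps its values near `y`, so it agrees there with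
the local inverse from the inverse function theorem, whose derivative is known. This covers boundary
points. -/
theorem hasFDerivWithinAt_inv {y : Fin (n + 1) → ℝ} (hy : y ∈ refCube n) :
    HasFDerivWithinAt (M.inv K) ((jacEquiv (M.det_ne_zero K y hy)).symm : E n →L[ℝ] _)
      (M.closedCell K) (M.map K y) := by
  have hs := hasStrictFDerivAt_polyMap_equiv (M.det_ne_zero K y hy)
  refine HasFDerivWithinAt.congr_of_eventuallyEq
    (f := hs.localInverse (polyMap (M.comp K)) (jacEquiv (M.det_ne_zero K y hy)) y)
    hs.to_localInverse.hasFDerivAt.hasFDerivWithinAt ?_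
    (by rw [M.inv_map K hy]; exact hs.localInverse_apply_image.symm)
  have h1 := M.continuousOn_inv K (M.map K y) (M.map_mem_closedCell K hy)
  rw [ContinuousWithinAt, M.inv_map K hy] at h1
  filter_upwards [h1.eventually hs.eventually_left_inverse, self_mem_nhdsWithin] with x hx hxK
  have : polyMap (M.comp K) (M.inv K x) = x := M.map_inv hxK
  rw [this] at hx
  exact hx.symm

/-- Makes the one-sided gradients in the edge residual unambiguous, also at corners: the property is
carried over from the convex cube by a derivative that is onto. -/
theorem uniqueDiffWithinAt_closedCell {x : E n} (hx : x ∈ M.closedCell K) :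
    UniqueDiffWithinAt ℝ (M.closedCell K) x := by
  obtain ⟨y, hy, rfl⟩ := hx
  have h := (hasStrictFDerivAt_polyMap_equiv
    (M.det_ne_zero K y hy)).hasFDerivAt.hasFDerivWithinAt (s := refCube n)
  exact h.uniqueDiffWithinAt (uniqueDiffOn_refCube y hy)
    (jacEquiv (M.det_ne_zero K y hy)).surjective.denseRange

theorem jacEquiv_symm_single {y : Fin (n + 1) → ℝ} (hy : y ∈ refCube n) (k : Fin (n + 1)) :
    (jacEquiv (M.det_ne_zero K y hy)).symm (EuclideanSpace.single k 1)
      = ∑ i, ((jac (M.comp K) y).det⁻¹ * (jac (M.comp K) y).adjugate i k) •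
        (Pi.single i 1 : Fin (n + 1) → ℝ) := by
  rw [ContinuousLinearEquiv.symm_apply_eq]
  have h1 : jacEquiv (M.det_ne_zero K y hy) ((jac (M.comp K) y).det⁻¹ •
      (jac (M.comp K) y).adjugate.mulVec (EuclideanSpace.single k (1 : ℝ)))
      = EuclideanSpace.single k 1 := by
    rw [map_smul]
    have := M.jacMap_adjugate K y (EuclideanSpace.single k (1 : ℝ))
    change (jac (M.comp K) y).det⁻¹ • jacMap (M.comp K) y _ = _
    rw [this, smul_smul, inv_mul_cancel₀ (M.det_ne_zero K y hy), one_smul]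
  rw [← h1]
  congr 1
  ext i
  simp [Finset.sum_apply, Pi.single_apply]

/-- The physical gradient of a polynomial given in reference coordinates. -/
noncomputable def refGrad (q : MvPolynomial (Fin (n + 1)) ℝ) (y : Fin (n + 1) → ℝ) : E n :=
  toE n fun j => (jac (M.comp K) y).det⁻¹ *
    ∑ i, (jac (M.comp K) y).adjugate i j * MvPolynomial.eval y (MvPolynomial.pderiv i q)

theorem contDiffAt_refGrad (q : MvPolynomial (Fin (n + 1)) ℝ) :
    ∀ y ∈ refCube n, ContDiffAt ℝ 1 (M.refGrad K q) y := by
  intro y hy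
  have hle : (1 : WithTop ℕ∞) ≤ ((⊤ : ℕ∞) : WithTop ℕ∞) := by exact_mod_cast le_top
  have hdet : ContDiff ℝ 1 fun y => (jac (M.comp K) y).det := by
    simp only [det_jac]
    exact (contDiff_mvPolynomial_eval _).of_le hle
  refine (toE n).contDiff.contDiffAt.comp y (contDiffAt_pi.2 fun j => ?_)
  refine (hdet.contDiffAt.inv (M.det_ne_zero K y hy)).mul (ContDiff.contDiffAt ?_)
  exact ContDiff.sum fun i _ => ((M.contDiff_adjugate K i j).of_le hle).mul
    ((contDiff_mvPolynomial_eval _).of_le hle)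

theorem continuousOn_refGrad (q : MvPolynomial (Fin (n + 1)) ℝ) :
    ContinuousOn (M.refGrad K q) (refCube n) :=
  continuousOn_of_contDiffAt (M.contDiffAt_refGrad K q)

theorem inner_refGrad (q : MvPolynomial (Fin (n + 1)) ℝ) {y : Fin (n + 1) → ℝ} (hy : y ∈ refCube n)
    (v : Fin (n + 1) → ℝ) :
    inner ℝ (M.refGrad K q y) (jacMap (M.comp K) y v) = evalFDeriv q y v := by
  have hd := M.det_ne_zero K y hy
  have hadj : (jac (M.comp K) y).adjugate.mulVec ((jac (M.comp K) y).mulVec v)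
      = (jac (M.comp K) y).det • v := by
    rw [Matrix.mulVec_mulVec, Matrix.adjugate_mul, Matrix.smul_mulVec, Matrix.one_mulVec]
  have h1 : inner ℝ (M.refGrad K q y) (jacMap (M.comp K) y v)
      = (jac (M.comp K) y).det⁻¹ * ∑ i, MvPolynomial.eval y (MvPolynomial.pderiv i q) *
        (jac (M.comp K) y).adjugate.mulVec ((jac (M.comp K) y).mulVec v) i := by
    simp only [PiLp.inner_apply, refGrad, toE_apply, jacMap, ContinuousLinearMap.comp_apply,
      jacLin_apply, ContinuousLinearEquiv.coe_coe, RCLike.inner_apply, conj_trivial, Finset.mul_sum]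
    rw [Finset.sum_comm]
    refine Finset.sum_congr rfl fun i _ => ?_
    rw [Matrix.mulVec.eq_def (jac (M.comp K) y).adjugate, dotProduct, Finset.mul_sum, Finset.mul_sum]
    exact Finset.sum_congr rfl fun j _ => by ring
  rw [h1, hadj, evalFDeriv_apply, Finset.mul_sum]
  refine Finset.sum_congr rfl fun i _ => ?_
  simp only [Pi.smul_apply, smul_eq_mul]
  field_simp

variable {K} {U : E n → ℝ} {q : MvPolynomial (Fin (n + 1)) ℝ}

theorem eq_eval_inv (hU : ∀ y ∈ refCube n, U (M.map K y) = MvPolynomial.eval y q) {x : E n}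
    (hx : x ∈ M.closedCell K) : U x = MvPolynomial.eval (M.inv K x) q := by
  rw [← hU _ (M.inv_mem hx), M.map_inv hx]

theorem hasGradientWithinAt_closedCell
    (hU : ∀ y ∈ refCube n, U (M.map K y) = MvPolynomial.eval y q) {x : E n}
    (hx : x ∈ M.closedCell K) :
    HasGradientWithinAt U (M.refGrad K q (M.inv K x)) (M.closedCell K) x := by
  obtain ⟨y, hy, rfl⟩ := hx
  rw [M.inv_map K hy, hasGradientWithinAt_iff_hasFDerivWithinAt]
  have h1 : HasFDerivWithinAt (fun x => MvPolynomial.eval (M.inv K x) q)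
      ((evalFDeriv q y).comp ((jacEquiv (M.det_ne_zero K y hy)).symm : E n →L[ℝ] _))
      (M.closedCell K) (M.map K y) := by
    have h2 := hasFDerivAt_mvPolynomial_eval q (M.inv K (M.map K y))
    have h3 := h2.comp_hasFDerivWithinAt (M.map K y) (M.hasFDerivWithinAt_inv K hy)
    rw [M.inv_map K hy] at h3
    exact h3
  have h4 : (InnerProductSpace.toDual ℝ (E n)) (M.refGrad K q y)
      = (evalFDeriv q y).comp ((jacEquiv (M.det_ne_zero K y hy)).symm : E n →L[ℝ] _) := by
    ext w
    obtain ⟨v, rfl⟩ := (jacEquiv (M.det_ne_zero K y hy)).surjective w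
    rw [InnerProductSpace.toDual_apply_apply]
    refine (M.inner_refGrad K q hy v).trans ?_
    simp
  rw [h4]
  exact h1.congr (fun x hx => M.eq_eval_inv hU hx) (M.eq_eval_inv hU (M.map_mem_closedCell K hy))

theorem gradientWithin_closedCell
    (hU : ∀ y ∈ refCube n, U (M.map K y) = MvPolynomial.eval y q) {x : E n}
    (hx : x ∈ M.closedCell K) :
    gradientWithin U (M.closedCell K) x = M.refGrad K q (M.inv K x) := by
  have h1 := (M.hasGradientWithinAt_closedCell hU hx).hasFDerivWithinAt
  rw [gradientWithin, h1.fderivWithin (M.uniqueDiffWithinAt_closedCell K hx)]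
  simp

theorem closedCell_mem_nhds {x : E n} (hx : x ∈ M.cell K) : M.closedCell K ∈ 𝓝 x :=
  Filter.mem_of_superset ((M.isOpen_cell K).mem_nhds hx) (M.cell_subset_closedCell K)

theorem gradient_cell (hU : ∀ y ∈ refCube n, U (M.map K y) = MvPolynomial.eval y q) {x : E n}
    (hx : x ∈ M.cell K) : gradient U x = M.refGrad K q (M.inv K x) := by
  have h := (M.hasGradientWithinAt_closedCell hU (M.cell_subset_closedCell K hx)).hasFDerivWithinAt
  have h' : HasGradientAt U (M.refGrad K q (M.inv K x)) x := h.hasFDerivAt (M.closedCell_mem_nhds hx)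
  exact h'.gradient

theorem divergence_cell (hU : ∀ y ∈ refCube n, U (M.map K y) = MvPolynomial.eval y q) (ε : ℝ)
    {x : E n} (hx : x ∈ M.cell K) :
    divergence (fun y => ε • gradient U y) x = ε * M.refDiv K (M.refGrad K q) (M.inv K x) := by
  -- The formula for the gradient holds on the open cell, a neighbourhood of `x`, and may therefore
  -- be differentiated.
  have hev : (fun y => ε • gradient U y) =ᶠ[𝓝 x] fun y => ε • M.refGrad K q (M.inv K y) := by
    filter_upwards [(M.isOpen_cell K).mem_nhds hx] with x' hx'
    rw [M.gradient_cell hU hx']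
  obtain ⟨y, hy, rfl⟩ := M.cell_subset_closedCell K hx
  have h1 : HasFDerivAt (M.inv K) ((jacEquiv (M.det_ne_zero K y hy)).symm : E n →L[ℝ] _)
      (M.map K y) := (M.hasFDerivWithinAt_inv K hy).hasFDerivAt (M.closedCell_mem_nhds hx)
  have h2 := ((M.contDiffAt_refGrad K q y hy).differentiableAt one_ne_zero).hasFDerivAt
  rw [← M.inv_map K hy] at h2
  have h3 := (h2.comp (M.map K y) h1).const_smul ε
  rw [M.inv_map K hy] at h3
  have h4 : fderiv ℝ (fun y => ε • gradient U y) (M.map K y) = _ :=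
    (h3.congr_of_eventuallyEq hev).fderiv
  rw [divergence, h4, M.inv_map K hy, refDiv]
  simp only [smul_apply, ContinuousLinearMap.comp_apply, PiLp.smul_apply, smul_eq_mul,
    ContinuousLinearEquiv.coe_coe, M.jacEquiv_symm_single K hy, map_sum, map_smul,
    WithLp.ofLp_sum, Finset.sum_apply, Finset.mul_sum]
  rw [Finset.sum_comm]
  refine Finset.sum_congr rfl fun i _ => Finset.sum_congr rfl fun j _ => ?_
  ring

end Mesh

/-! ### Weak gradients -/

theorem tendsto_integral_inner_of_eLpNorm {β F : Type*} [MeasurableSpace β]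
    [NormedAddCommGroup F] [InnerProductSpace ℝ F] {μ : Measure β} {f : ℕ → β → F} {f₀ h : β → F}
    (hf : ∀ m, MemLp (f m) 2 μ) (hf₀ : MemLp f₀ 2 μ) (hh : MemLp h 2 μ)
    (hlim : Tendsto (fun m => eLpNorm (f m - f₀) 2 μ) atTop (𝓝 0)) :
    Tendsto (fun m => ∫ x, inner ℝ (f m x) (h x) ∂μ) atTop (𝓝 (∫ x, inner ℝ (f₀ x) (h x) ∂μ)) := by
  have key (g : β → F) (hg : MemLp g 2 μ) :
      inner ℝ (hg.toLp g) (hh.toLp h) = ∫ x, inner ℝ (g x) (h x) ∂μ := by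
    rw [L2.inner_def]
    refine integral_congr_ae ?_
    filter_upwards [hg.coeFn_toLp, hh.coeFn_toLp] with x h1 h2
    rw [h1, h2]
  have h1 : Tendsto (fun m => (hf m).toLp (f m)) atTop (𝓝 (hf₀.toLp f₀)) := by
    rw [Lp.tendsto_Lp_iff_tendsto_eLpNorm'']
    exact hlim
  have h2 := h1.inner (𝕜 := ℝ) (tendsto_const_nhds (x := hh.toLp h))
  simpa only [key] using h2

theorem tendsto_integral_mul_of_eLpNorm {β : Type*} [MeasurableSpace β]
    {μ : Measure β} {f : ℕ → β → ℝ} {f₀ h : β → ℝ}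
    (hf : ∀ m, MemLp (f m) 2 μ) (hf₀ : MemLp f₀ 2 μ) (hh : MemLp h 2 μ)
    (hlim : Tendsto (fun m => eLpNorm (f m - f₀) 2 μ) atTop (𝓝 0)) :
    Tendsto (fun m => ∫ x, h x * f m x ∂μ) atTop (𝓝 (∫ x, h x * f₀ x ∂μ)) := by
  simpa using tendsto_integral_inner_of_eLpNorm hf hf₀ hh hlim

section Weak

variable {n : ℕ} {Ω : Set (E n)}

theorem memLp_val (w : V Ω) : MemLp (V.val w) 2 (volume.restrict Ω) := Lp.memLp _

theorem memLp_grad (w : V Ω) : MemLp (V.grad w) 2 (volume.restrict Ω) := Lp.memLp _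

theorem IsTest.gradient_eq_zero {φ : E n → ℝ} (h : IsTest Ω φ) {x : E n} (hx : x ∉ Ω) :
    gradient φ x = 0 := by
  have h0 : x ∉ tsupport φ := fun hx' => hx (h.2.2 hx')
  have : φ =ᶠ[𝓝 x] fun _ => 0 := notMem_tsupport_iff_eventuallyEq.1 h0
  rw [gradient, this.fderiv_eq]
  simp

theorem integral_test_mul_inner_gradient {φ ψ : E n → ℝ} (hφ : IsTest Ω φ) (hψ : IsTest Ω ψ)
    (v : E n) :
    ∫ x in Ω, inner ℝ (gradient ψ x) v * φ x = - ∫ x in Ω, ψ x * inner ℝ (gradient φ x) v := by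
  rw [setIntegral_eq_integral_of_forall_compl_eq_zero, setIntegral_eq_integral_of_forall_compl_eq_zero]
  · simp only [inner_gradient_eq]
    have c (θ : E n → ℝ) (hθ : IsTest Ω θ) : Continuous fun x => fderiv ℝ θ x v :=
      (hθ.contDiff_one.continuous_fderiv one_ne_zero).clm_apply continuous_const
    have i1 : Integrable (fun x => fderiv ℝ ψ x v * φ x) :=
      ((c ψ hψ).mul hφ.continuous).integrable_of_hasCompactSupport hφ.2.1.mul_left
    have i2 : Integrable (fun x => ψ x * fderiv ℝ φ x v) :=
      (hψ.continuous.mul (c φ hφ)).integrable_of_hasCompactSupport hψ.2.1.mul_right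
    have i3 : Integrable (fun x => ψ x * φ x) :=
      (hψ.continuous.mul hφ.continuous).integrable_of_hasCompactSupport hψ.2.1.mul_right
    have := integral_mul_fderiv_eq_neg_fderiv_mul_of_integrable i1 i2 i3
      (fun x _ => hψ.differentiable x) (fun x _ => hφ.differentiable x)
    rw [this, neg_neg]
  · intro x hx
    rw [hψ.eq_zero_of_notMem hx, zero_mul]
  · intro x hx
    rw [hφ.eq_zero_of_notMem hx, mul_zero]

/-- The second component of an element of `H¹₀(Ω)` is its weak gradient. -/
theorem integral_val_mul_inner_gradient (w : V Ω) {ψ : E n → ℝ} (hψ : IsTest Ω ψ) (v : E n) :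
    ∫ x in Ω, inner ℝ (gradient ψ x) v * V.val w x
      = - ∫ x in Ω, inner ℝ (V.grad w x) (ψ x • v) := by
  obtain ⟨φ, hφ, h1, h2⟩ := exists_isTest_tendsto w
  have hψv : MemLp (fun x => ψ x • v) 2 (volume.restrict Ω) := by
    have hc : Continuous fun x => ψ x • v := hψ.continuous.smul continuous_const
    exact hc.memLp_of_hasCompactSupport hψ.2.1.smul_right
  have hψg : MemLp (fun x => inner ℝ (gradient ψ x) v) 2 (volume.restrict Ω) :=
    MemLp.inner_const (hψ.memLp_gradient 2 _) v
  have l1 := tendsto_integral_mul_of_eLpNorm (fun m => (hφ m).memLp 2 (volume.restrict Ω))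
    (memLp_val w) hψg h1
  have l2 := tendsto_integral_inner_of_eLpNorm
    (fun m => (hφ m).memLp_gradient 2 (volume.restrict Ω)) (memLp_grad w) hψv h2
  refine tendsto_nhds_unique l1 ?_
  have : (fun m => ∫ x in Ω, inner ℝ (gradient ψ x) v * φ m x)
      = fun m => - ∫ x in Ω, inner ℝ (gradient (φ m) x) (ψ x • v) := by
    funext m
    rw [integral_test_mul_inner_gradient (hφ m) hψ]
    simp only [inner_smul_right]
  rw [this]
  exact l2.neg

namespace Mesh

variable {ι : Type*} (M : Mesh Ω ι) {K : ι}
variable {U : E n → ℝ} {q : MvPolynomial (Fin (n + 1)) ℝ}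

/-- Lets Green's formula for the field `q v` serve as the definition of a weak derivative in
direction `v`. -/
theorem refDiv_smul_const {y : Fin (n + 1) → ℝ} (v : E n) :
    M.refDiv K (fun y => MvPolynomial.eval y q • v) y = inner ℝ (M.refGrad K q y) v := by
  have h1 (i : Fin (n + 1)) : fderiv ℝ (fun y => MvPolynomial.eval y q • v) y (Pi.single i 1)
      = MvPolynomial.eval y (MvPolynomial.pderiv i q) • v := by
    rw [((hasFDerivAt_mvPolynomial_eval q y).smul_const v).fderiv]
    simp [evalFDeriv_single]
  simp only [refDiv, h1, refGrad, toE_apply, PiLp.inner_apply, RCLike.inner_apply, conj_trivial,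
    Finset.mul_sum, PiLp.smul_apply, smul_eq_mul]
  rw [Finset.sum_comm]
  exact Finset.sum_congr rfl fun i _ => Finset.sum_congr rfl fun j _ => by ring

/-- For test functions supported in the open cell the boundary term of Green's formula vanishes, so
the polynomial gradient and the weak gradient satisfy the same identity on the cell. The fundamental
lemma of the calculus of variations shows that they agree. -/
theorem grad_ae_eq (hn : n + 1 = 2 ∨ n + 1 = 3) {w : V Ω} (hw : V.val w =ᵐ[volume.restrict Ω] U)
    (hU : ∀ y ∈ refCube n, U (M.map K y) = MvPolynomial.eval y q) :
    V.grad w =ᵐ[volume.restrict (M.cell K)] fun x => M.refGrad K q (M.inv K x) := by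
  have hmeas := (M.isOpen_cell K).measurableSet
  have hfin := M.isFiniteMeasure_restrict_cell K
  have hR : IntegrableOn (fun x => M.refGrad K q (M.inv K x)) (M.cell K) :=
    M.integrableOn_cell_of_continuousOn K (M.continuousOn_comp_inv K (M.continuousOn_refGrad K q))
  have hgrad : IntegrableOn (V.grad w) (M.cell K) :=
    MemLp.integrable one_le_two ((memLp_grad w).mono_measure
      (Measure.restrict_mono (M.cell_subset K) le_rfl))
  have key := (M.isOpen_cell K).ae_eq_zero_of_integral_contDiff_smul_eq_zero
    (f := fun x => V.grad w x - M.refGrad K q (M.inv K x)) (μ := volume)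
    (hgrad.sub hR).locallyIntegrableOn ?_
  · rw [EventuallyEq, ae_restrict_iff' hmeas]
    filter_upwards [key] with x hx hxK
    exact sub_eq_zero.1 (hx hxK)
  intro ψ hψ1 hψ2 hψ3
  have hψ : IsTest (M.cell K) ψ := ⟨hψ1, hψ2, hψ3⟩
  have hψΩ : IsTest Ω ψ := hψ.mono (M.cell_subset K)
  have hψg : Continuous (gradient ψ) := continuous_gradient hψ.contDiff_one
  rw [← setIntegral_eq_integral_of_forall_compl_eq_zero (s := M.cell K)
    (fun x hx => by rw [hψ.eq_zero_of_notMem hx, zero_smul])]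
  obtain ⟨Cψ, hCψ⟩ := hψ2.exists_bound_of_continuous hψ.continuous
  have hint {h : E n → E n} (hh : IntegrableOn h (M.cell K) volume) :
      IntegrableOn (fun x => ψ x • h x) (M.cell K) :=
    Integrable.bdd_smul (φ := ψ) hh Cψ hψ.continuous.aestronglyMeasurable
      (Eventually.of_forall hCψ)
  -- The vector identity is checked in every constant direction `v`, with Green's formula for the
  -- field `q v`.
  refine ext_inner_right ℝ fun v => ?_
  rw [inner_zero_left, real_inner_comm]
  refine (integral_inner (𝕜 := ℝ) (hint (hgrad.sub hR)) v).symm.trans ?_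
  have hG : ∀ y ∈ refCube n, ContDiffAt ℝ 1 (fun y => MvPolynomial.eval y q • v) y := fun y _ =>
    (((contDiff_mvPolynomial_eval q).of_le (by exact_mod_cast le_top)).smul
      contDiff_const).contDiffAt
  have hgreen := M.green_cell K hn hG hψ.contDiff_one
  have hbd : ∫ x, ψ x * inner ℝ (MvPolynomial.eval (M.inv K x) q • v) (M.normal K x) ∂M.surface K
      = 0 := by
    refine integral_eq_zero_of_ae ?_
    filter_upwards [M.ae_notMem_cell K] with x hx
    rw [hψ.eq_zero_of_notMem hx, zero_mul]; rfl
  have hUc : ContinuousOn (fun x => MvPolynomial.eval (M.inv K x) q) (M.closedCell K) :=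
    M.continuousOn_comp_inv K (MvPolynomial.continuous_eval q).continuousOn
  have hRc := M.continuousOn_comp_inv K (M.continuousOn_refGrad K q)
  rw [hbd] at hgreen
  simp only [refDiv_smul_const, inner_smul_right] at hgreen
  have i1 : IntegrableOn (fun x => MvPolynomial.eval (M.inv K x) q * inner ℝ (gradient ψ x) v)
      (M.cell K) := M.integrableOn_cell_of_continuousOn K
        (hUc.mul (hψg.continuousOn.inner continuousOn_const))
  have i2 : IntegrableOn (fun x => ψ x * inner ℝ (M.refGrad K q (M.inv K x)) v) (M.cell K) :=
    M.integrableOn_cell_of_continuousOn K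
      (hψ.continuous.continuousOn.mul (hRc.inner continuousOn_const))
  rw [integral_add i1 i2] at hgreen
  have hweak := integral_val_mul_inner_gradient w hψΩ v
  have e1 : ∫ x in Ω, inner ℝ (gradient ψ x) v * V.val w x
      = ∫ x in M.cell K, MvPolynomial.eval (M.inv K x) q * inner ℝ (gradient ψ x) v := by
    have h0 (x : E n) (hx : x ∉ M.cell K) : inner ℝ (gradient ψ x) v * V.val w x = 0 := by
      rw [hψ.gradient_eq_zero hx, inner_zero_left, zero_mul]
    rw [setIntegral_eq_integral_of_forall_compl_eq_zero
      fun x hx => h0 x fun h => hx (M.cell_subset K h),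
      ← setIntegral_eq_integral_of_forall_compl_eq_zero h0]
    refine integral_congr_ae ?_
    filter_upwards [ae_restrict_mem hmeas, ae_mono (Measure.restrict_mono (M.cell_subset K) le_rfl)
      hw] with x hx hx'
    rw [hx', M.eq_eval_inv hU (M.cell_subset_closedCell K hx), mul_comm]
  have e2 : ∫ x in Ω, inner ℝ (V.grad w x) (ψ x • v)
      = ∫ x in M.cell K, inner ℝ (V.grad w x) (ψ x • v) := by
    have h0 (x : E n) (hx : x ∉ M.cell K) : inner ℝ (V.grad w x) (ψ x • v) = 0 := by
      rw [hψ.eq_zero_of_notMem hx, zero_smul, inner_zero_right]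
    rw [setIntegral_eq_integral_of_forall_compl_eq_zero
      fun x hx => h0 x fun h => hx (M.cell_subset K h),
      ← setIntegral_eq_integral_of_forall_compl_eq_zero h0]
  rw [e1, e2] at hweak
  have e3 : ∫ x in M.cell K, inner ℝ v (ψ x • (V.grad w x - M.refGrad K q (M.inv K x)))
      = (∫ x in M.cell K, inner ℝ (V.grad w x) (ψ x • v))
        - ∫ x in M.cell K, ψ x * inner ℝ (M.refGrad K q (M.inv K x)) v := by
    rw [← integral_sub]
    · refine integral_congr_ae (Eventually.of_forall fun x => ?_)
      simp only [inner_smul_right, inner_sub_right, real_inner_comm v, mul_sub]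
    · refine ((hint hgrad).const_inner v).congr (Eventually.of_forall fun x => ?_)
      simp only [inner_smul_right, real_inner_comm v]
    · exact M.integrableOn_cell_of_continuousOn K
        (hψ.continuous.continuousOn.mul (hRc.inner continuousOn_const))
  refine e3.trans ?_
  linarith

end Mesh

end Weak

end SUPG

namespace SUPG

open scoped ENNReal NNReal

/-! ### Cells that meet at a point -/

theorem eventually_lt_of_hasDerivAt_neg {h : ℝ → ℝ} {h' a : ℝ} (hd : HasDerivAt h h' a)
    (hneg : h' < 0) : ∀ᶠ t in 𝓝[>] a, h t < h a := by
  have h1 := (hasDerivWithinAt_iff_tendsto_slope' (s := Ioi a) (by simp)).1 hd.hasDerivWithinAt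
  filter_upwards [h1.eventually_lt_const hneg, self_mem_nhdsWithin] with t ht hta
  have hta' : 0 < t - a := sub_pos.2 hta
  rw [slope_def_field, div_neg_iff] at ht
  rcases ht with ht | ht
  · linarith [ht.2]
  · linarith [ht.1]

theorem lipschitzWith_insertNth {n : ℕ} (i : Fin (n + 1)) (t : ℝ) :
    LipschitzWith 1 (fun y : Fin n → ℝ => (i.insertNth t y : Fin (n + 1) → ℝ)) := by
  refine LipschitzWith.of_dist_le_mul fun z z' => ?_
  rw [NNReal.coe_one, one_mul, dist_pi_le_iff dist_nonneg]
  intro j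
  refine Fin.succAboveCases i ?_ (fun k => ?_) j
  · simp
  · simpa using dist_le_pi_dist z z' k

theorem lipschitzWith_removeNth {n : ℕ} (i : Fin (n + 1)) :
    LipschitzWith 1 (fun (y : Fin (n + 1) → ℝ) (k : Fin n) => y (i.succAbove k)) := by
  refine LipschitzWith.of_dist_le_mul fun z z' => ?_
  rw [NNReal.coe_one, one_mul, dist_pi_le_iff dist_nonneg]
  exact fun k => dist_le_pi_dist z z' _

theorem hausdorffMeasure_fin_eq_volume (n : ℕ) :
    (μH[(n : ℝ)] : Measure (Fin n → ℝ)) = volume := by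
  simpa using hausdorffMeasure_pi_real (ι := Fin n)

namespace Mesh

variable {n : ℕ} {Ω : Set (E n)} {ι : Type*} (M : Mesh Ω ι) (K : ι)

/-- The surface measure is absolutely continuous with respect to the Hausdorff measure of
codimension one. -/
theorem surface_eq_zero_of_hausdorffMeasure {S : Set (E n)} (hS : MeasurableSet S)
    (h0 : μH[(n : ℝ)] S = 0) : M.surface K S = 0 := by
  have hcompl : ∀ᵐ x ∂M.surface K, x ∉ S := by
    refine M.ae_surface_of_refSurface K hS.compl ?_
    rw [ae_refSurface_iff]
    intro i s
    rw [ae_restrict_iff' measurableSet_Icc, ae_iff]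
    -- Near each point of a face the reference map has a Lipschitz inverse. Composed with the
    -- projection to the face coordinates, it covers the local preimage of `S` by a Lipschitz image
    -- of `S`, which is null for the `n`-dimensional Hausdorff measure, that is, for the Lebesgue
    -- measure of the face.
    refine measure_null_of_locally_null _ fun z hz => ?_
    have hz' : z ∈ Icc (0 : Fin n → ℝ) 1 := by
      by_contra hc
      exact hz fun h => absurd h hc
    set y : Fin (n + 1) → ℝ := i.insertNth (s : ℝ) z with hy
    have hycube : y ∈ refCube n := insertNth_mem_refCube i (fin_two_mem_Icc s) hz'
    have hs := hasStrictFDerivAt_polyMap_equiv (M.det_ne_zero K y hycube)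
    obtain ⟨C, N, hN, hlip⟩ := hs.to_localInverse.exists_lipschitzOnWith
    have hins : Continuous (fun y : Fin n → ℝ => (i.insertNth (s : ℝ) y : Fin (n + 1) → ℝ)) :=
      (lipschitzWith_insertNth i (s : ℝ)).continuous
    have e1 : ∀ᶠ z' in 𝓝 z, M.map K (i.insertNth (s : ℝ) z') ∈ N :=
      (((M.continuous_map K).comp hins).tendsto z).eventually hN
    have e2 : ∀ᶠ z' in 𝓝 z, hs.localInverse _ _ _ (M.map K (i.insertNth (s : ℝ) z'))
        = i.insertNth (s : ℝ) z' := (hins.tendsto z).eventually hs.eventually_left_inverse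
    refine ⟨_, inter_mem_nhdsWithin _ (e1.and e2), ?_⟩
    rw [← hausdorffMeasure_fin_eq_volume]
    have hsub : {a | ¬(a ∈ Icc (0 : Fin n → ℝ) 1 → M.map K (i.insertNth (s : ℝ) a) ∉ S)} ∩
        {z' | M.map K (i.insertNth (s : ℝ) z') ∈ N ∧
          hs.localInverse _ _ _ (M.map K (i.insertNth (s : ℝ) z')) = i.insertNth (s : ℝ) z'}
        ⊆ (fun (y : Fin (n + 1) → ℝ) (k : Fin n) => y (i.succAbove k)) ''
          (hs.localInverse _ _ _ '' (N ∩ S)) := by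
      rintro z' ⟨h1, h2, h3⟩
      simp only [mem_ofPred_eq, Classical.not_imp, not_not] at h1
      refine ⟨i.insertNth (s : ℝ) z', ⟨_, ⟨h2, h1.2⟩, h3⟩, ?_⟩
      funext k
      simp
    refine measure_mono_null hsub ?_
    refine le_antisymm ?_ zero_le
    refine ((lipschitzWith_removeNth i).hausdorffMeasure_image_le (Nat.cast_nonneg n) _).trans ?_
    have h4 := (hlip.mono inter_subset_left).hausdorffMeasure_image_le (s := N ∩ S)
      (Nat.cast_nonneg n)
    rw [measure_mono_null inter_subset_right h0, mul_zero] at h4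
    rw [le_antisymm h4 zero_le, mul_zero]
  rwa [ae_iff, show {a | ¬a ∉ S} = S by ext; simp] at hcompl

/-- A face of codimension two of the reference cube. -/
def refRidge (i j : Fin (n + 1)) (s t : ℝ) : Set (Fin (n + 1) → ℝ) :=
  {y ∈ refCube n | y i = s ∧ y j = t}

theorem isCompact_refRidge (i j : Fin (n + 1)) (s t : ℝ) : IsCompact (refRidge i j s t) :=
  isCompact_refCube.inter_right ((isClosed_eq (continuous_apply i) continuous_const).inter
    (isClosed_eq (continuous_apply j) continuous_const))

/-- The set lies in the Lipschitz image of a hyperplane of `ℝⁿ`, which is Lebesgue null. -/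
theorem hausdorffMeasure_refRidge {i j : Fin (n + 1)} (hij : i ≠ j) (s t : ℝ) :
    μH[(n : ℝ)] (refRidge i j s t) = 0 := by
  obtain ⟨k, rfl⟩ := Fin.exists_succAbove_eq hij.symm
  have hsub : refRidge i (i.succAbove k) s t ⊆
      (fun z : Fin n → ℝ => (i.insertNth s z : Fin (n + 1) → ℝ)) '' {z | z k = t} := by
    rintro y ⟨-, hi, hk⟩
    refine ⟨i.removeNth y, hk, ?_⟩
    rw [← hi]
    exact Fin.insertNth_self_removeNth i y
  refine measure_mono_null hsub (le_antisymm ?_ zero_le)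
  refine ((lipschitzWith_insertNth i s).hausdorffMeasure_image_le (Nat.cast_nonneg n) _).trans ?_
  rw [hausdorffMeasure_fin_eq_volume, volume_pi, Measure.pi_hyperplane, mul_zero]

/-- With hanging nodes a ridge of the cell `K` may cross the interior of a face of another cell `J`.
Hausdorff measure does not depend on the parametrization and so compares the two cells. -/
theorem surface_image_refRidge (J : ι) {i j : Fin (n + 1)} (hij : i ≠ j) (s t : ℝ) :
    M.surface J (M.map K '' refRidge i j s t) = 0 := by
  refine M.surface_eq_zero_of_hausdorffMeasure J
    ((isCompact_refRidge i j s t).image (M.continuous_map K)).measurableSet ?_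
  obtain ⟨C, hC⟩ := ((M.contDiff_map K).contDiffOn (s := refCube n)).exists_lipschitzOnWith
    (by simp) convex_refCube isCompact_refCube
  have h := (hC.mono (fun _ hy => hy.1 : refRidge i j s t ⊆ _)).hausdorffMeasure_image_le
    (s := refRidge i j s t) (Nat.cast_nonneg n)
  rw [hausdorffMeasure_refRidge hij, mul_zero] at h
  exact le_antisymm h zero_le

variable {K}

/-- At a boundary point away from the ridges, a cell contains a half-space of directions. -/
theorem exists_halfSpace {x : E n} (hx : x ∈ M.closedCell K) (hx' : x ∉ M.cell K)
    (hr : ∀ i j : Fin (n + 1), i ≠ j → ∀ s t : Fin 2, x ∉ M.map K '' refRidge i j s t) :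
    ∃ l : Module.Dual ℝ (E n), l ≠ 0 ∧
      ∀ w, l w < 0 → ∀ᶠ t : ℝ in 𝓝[>] 0, x + t • w ∈ M.cell K := by
  obtain ⟨y, hy, rfl⟩ := hx
  rw [M.map_mem_cell_iff K hy, mem_refCubeInt] at hx'
  push Not at hx'
  obtain ⟨i, hi⟩ := hx'
  have hext (k : Fin (n + 1)) (hk : y k ∉ Ioo (0 : ℝ) 1) : ∃ s : Fin 2, y k = s := by
    have hyk := mem_refCube.1 hy k
    by_contra! hc
    have h0 := hc 0
    have h1 := hc 1
    simp only [Fin.val_zero, Fin.val_one, Nat.cast_zero, Nat.cast_one] at h0 h1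
    exact hk ⟨lt_of_le_of_ne hyk.1 h0.symm, lt_of_le_of_ne hyk.2 h1⟩
  obtain ⟨s, hs⟩ := hext i hi
  have hother (j : Fin (n + 1)) (hj : j ≠ i) : y j ∈ Ioo (0 : ℝ) 1 := by
    by_contra hc
    obtain ⟨t, ht⟩ := hext j hc
    exact hr i j hj.symm s t ⟨y, ⟨hy, hs, ht⟩, rfl⟩
  set e := jacEquiv (M.det_ne_zero K y hy) with he
  have hst := hasStrictFDerivAt_polyMap_equiv (M.det_ne_zero K y hy)
  -- Off the ridges exactly one coordinate `y i` is extreme, and `c` is the sign of the outward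
  -- normal there: `w` points into the cell when `c` times the `i`-th coordinate of its pull-back is
  -- negative.
  set c : ℝ := if s = 1 then 1 else -1 with hc
  have hc0 : c ≠ 0 := by rw [hc]; split_ifs <;> norm_num
  refine ⟨c • (LinearMap.proj i ∘ₗ (e.symm : E n →ₗ[ℝ] Fin (n + 1) → ℝ)), ?_, fun w hw => ?_⟩
  · intro h
    have := LinearMap.congr_fun h (e (Pi.single i 1))
    simp [hc0] at this
  -- The ray pulled back by the local inverse. For small `t > 0` it is in the open cube: coordinate
  -- `i` by the sign of its derivative at zero, the others by continuity.
  set γ : ℝ → Fin (n + 1) → ℝ := fun t => hst.localInverse _ _ _ (M.map K y + t • w) with hγ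
  have hline : HasDerivAt (fun t : ℝ => M.map K y + t • w) w 0 := by
    simpa using ((hasDerivAt_id (0 : ℝ)).smul_const w).const_add (M.map K y)
  have hlim : Tendsto (fun t : ℝ => M.map K y + t • w) (𝓝 0) (𝓝 (M.map K y)) := by
    simpa using hline.continuousAt.tendsto
  have hγ0 : γ 0 = y := by
    simp only [hγ, zero_smul, add_zero]
    exact hst.localInverse_apply_image
  have hγd : HasDerivAt γ (e.symm w) 0 := by
    have h1 := hst.to_localInverse.hasFDerivAt
    have h2 : polyMap (M.comp K) y = M.map K y + (0 : ℝ) • w := by simp [Mesh.map]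
    rw [h2] at h1
    exact h1.comp_hasDerivAt (0 : ℝ) hline
  have hγc : Tendsto γ (𝓝 0) (𝓝 y) := by
    have := hγd.continuousAt.tendsto
    rwa [hγ0] at this
  have hright : ∀ᶠ t : ℝ in 𝓝[>] 0, M.map K (γ t) = M.map K y + t • w :=
    (hlim.eventually hst.eventually_right_inverse).filter_mono nhdsWithin_le_nhds
  have hmem : ∀ᶠ t : ℝ in 𝓝[>] 0, ∀ j, γ t j ∈ Ioo (0 : ℝ) 1 := by
    rw [eventually_all]
    intro j
    have hγj : Tendsto (fun t => γ t j) (𝓝 0) (𝓝 (y j)) := (continuous_apply j).tendsto y |>.comp hγc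
    by_cases hj : j = i
    · subst hj
      have hdj : HasDerivAt (fun t => γ t j) (e.symm w j) 0 := (hasDerivAt_pi.1 hγd) j
      have hw' : c * e.symm w j < 0 := by simpa using hw
      by_cases hs1 : s = 1
      · subst hs1
        simp only [hc, if_true, one_mul] at hw'
        have hyj : y j = 1 := by simpa using hs
        filter_upwards [eventually_lt_of_hasDerivAt_neg hdj hw',
          (hγj.eventually_const_lt (by rw [hyj]; exact zero_lt_one)).filter_mono
            nhdsWithin_le_nhds] with t h1 h2
        rw [hγ0, hyj] at h1
        exact ⟨h2, h1⟩
      · have hs0 : s = 0 := by omega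
        subst hs0
        have hyj : y j = 0 := by simpa using hs
        simp only [hc, if_neg hs1, neg_one_mul] at hw'
        filter_upwards [eventually_lt_of_hasDerivAt_neg hdj.neg hw',
          (hγj.eventually_lt_const (by rw [hyj]; exact zero_lt_one)).filter_mono
            nhdsWithin_le_nhds] with t h1 h2
        simp only [Pi.neg_apply, hγ0, hyj] at h1
        exact ⟨by linarith, h2⟩
    · exact (hγj.eventually (Ioo_mem_nhds (hother j hj).1 (hother j hj).2)).filter_mono
        nhdsWithin_le_nhds
  filter_upwards [hright, hmem] with t h1 h2
  rw [← h1]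
  exact mem_image_of_mem _ (mem_refCubeInt.2 h2)

/-- A real vector space is not a union of finitely many hyperplanes. -/
theorem exists_forall_dual_ne_zero {F : Type*} [AddCommGroup F] [Module ℝ F]
    (l : Fin 3 → Module.Dual ℝ F) (hl : ∀ i, l i ≠ 0) : ∃ w, ∀ i, l i w ≠ 0 := by
  exact Module.Dual.exists_forall_ne_zero_of_forall_exists l fun i => by
    by_contra! h
    exact hl i (LinearMap.ext h)

/-- Away from the ridges at most two closed cells meet. -/
theorem card_closedCell_le_two [Fintype ι] {x : E n}
    [DecidablePred fun K' => x ∈ M.closedCell K']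
    (hr : ∀ K, ∀ i j : Fin (n + 1), i ≠ j → ∀ s t : Fin 2, x ∉ M.map K '' refRidge i j s t) :
    (Finset.univ.filter fun K' => x ∈ M.closedCell K').card ≤ 2 := by
  by_contra! hcard
  obtain ⟨K₀, K₁, K₂, h0, h1, h2, h01, h02, h12⟩ := Finset.two_lt_card_iff.1 hcard
  simp only [Finset.mem_filter, Finset.mem_univ, true_and] at h0 h1 h2
  have hcell {A B : ι} (hAB : A ≠ B) (hB : x ∈ M.closedCell B) : x ∉ M.cell A := fun hA =>
    (M.disjoint_cell_closedCell hAB).le_bot ⟨hA, hB⟩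
  obtain ⟨l0, hl0, H0⟩ := M.exists_halfSpace h0 (hcell h01 h1) (hr K₀)
  obtain ⟨l1, hl1, H1⟩ := M.exists_halfSpace h1 (hcell h01.symm h0) (hr K₁)
  obtain ⟨l2, hl2, H2⟩ := M.exists_halfSpace h2 (hcell h02.symm h0) (hr K₂)
  have hdisj {A B : ι} (hAB : A ≠ B) {a b : Module.Dual ℝ (E n)}
      (HA : ∀ w, a w < 0 → ∀ᶠ t : ℝ in 𝓝[>] 0, x + t • w ∈ M.cell A)
      (HB : ∀ w, b w < 0 → ∀ᶠ t : ℝ in 𝓝[>] 0, x + t • w ∈ M.cell B) (w : E n) :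
      ¬ (a w < 0 ∧ b w < 0) := by
    rintro ⟨ha, hb⟩
    obtain ⟨t, hA, hB⟩ := ((HA w ha).and (HB w hb)).exists
    exact (M.disjoint A B hAB).le_bot ⟨hA, hB⟩
  -- Among three nonzero numbers two have the same sign, so `w` or `-w` points into two different
  -- cells, which are disjoint.
  obtain ⟨w, hw⟩ := exists_forall_dual_ne_zero ![l0, l1, l2] (by
    intro i; fin_cases i <;> assumption)
  have w0 : l0 w ≠ 0 := hw 0
  have w1 : l1 w ≠ 0 := hw 1
  have w2 : l2 w ≠ 0 := hw 2
  have a := hdisj h01 H0 H1 w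
  have b := hdisj h02 H0 H2 w
  have c := hdisj h12 H1 H2 w
  have a' := hdisj h01 H0 H1 (-w)
  have b' := hdisj h02 H0 H2 (-w)
  have c' := hdisj h12 H1 H2 (-w)
  simp only [map_neg, neg_lt_zero] at a' b' c'
  rcases lt_or_gt_of_ne w0 with p0 | p0 <;> rcases lt_or_gt_of_ne w1 with p1 | p1
  · exact a ⟨p0, p1⟩
  · rcases lt_or_gt_of_ne w2 with p2 | p2
    exacts [b ⟨p0, p2⟩, c' ⟨p1, p2⟩]
  · rcases lt_or_gt_of_ne w2 with p2 | p2
    exacts [c ⟨p1, p2⟩, b' ⟨p0, p2⟩]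
  · exact a' ⟨p0, p1⟩

theorem ae_card_closedCell_le_two [Fintype ι] (J : ι) :
    ∀ᵐ x ∂M.surface J, ∀ [DecidablePred fun K' => x ∈ M.closedCell K'],
      (Finset.univ.filter fun K' => x ∈ M.closedCell K').card ≤ 2 := by
  have h : ∀ᵐ x ∂M.surface J, ∀ K, ∀ i j : Fin (n + 1), i ≠ j → ∀ s t : Fin 2,
      x ∉ M.map K '' refRidge i j s t := by
    simp only [ae_all_iff]
    intro K i j hij s t
    have := M.surface_image_refRidge K J hij s t
    rw [ae_iff]
    convert this using 2
    ext; simp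
  filter_upwards [h] with x hx _
  exact M.card_closedCell_le_two hx

end Mesh

end SUPG

namespace SUPG

open scoped ENNReal NNReal

namespace Mesh

variable {n : ℕ} {Ω : Set (E n)} {ι : Type*} (M : Mesh Ω ι)

/-! ### Cancellation of the normals on the interior faces -/

theorem integrable_normal (K : ι) : Integrable (M.normal K) (M.surface K) :=
  Integrable.of_bound (M.aestronglyMeasurable_normal K) 1
    (Eventually.of_forall (M.norm_normal_le K))

section Skeleton

variable [Fintype ι]

/-- The surface measure of the skeleton of the mesh, where the faces are counted once for each
cell that they belong to. -/
noncomputable def skeleton : Measure (E n) := ∑ K, M.surface K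

instance : IsFiniteMeasure M.skeleton := by unfold skeleton; infer_instance

instance (K : ι) :
    (M.surface K).HaveLebesgueDecomposition M.skeleton :=
  Measure.haveLebesgueDecomposition_of_sigmaFinite _ _

theorem surface_absolutelyContinuous (K : ι) : M.surface K ≪ M.skeleton := by
  intro s hs
  simp only [skeleton, Measure.coe_finsetSum, Finset.sum_apply, Finset.sum_eq_zero_iff,
    Finset.mem_univ, true_imp_iff] at hs
  exact hs K

theorem ae_skeleton_iff {p : E n → Prop} :
    (∀ᵐ x ∂M.skeleton, p x) ↔ ∀ K, ∀ᵐ x ∂M.surface K, p x := by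
  simp [skeleton, ae_iff, Measure.coe_finsetSum, Finset.sum_apply]

/-- The density of the surface measure of a cell. -/
noncomputable def density (K : ι) (x : E n) : ℝ := ((M.surface K).rnDeriv M.skeleton x).toReal

/-- Puts integrals over different cell boundaries under one measure, where the contributions of
neighbouring cells can be compared pointwise. -/
theorem integral_density (K : ι) {F : Type*} [NormedAddCommGroup F] [NormedSpace ℝ F]
    (h : E n → F) : ∫ x, M.density K x • h x ∂M.skeleton = ∫ x, h x ∂M.surface K :=
  integral_rnDeriv_smul (M.surface_absolutelyContinuous K)

theorem integrable_density_smul_iff (K : ι) {F : Type*} [NormedAddCommGroup F] [NormedSpace ℝ F]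
    {h : E n → F} :
    Integrable (fun x => M.density K x • h x) M.skeleton ↔ Integrable h (M.surface K) :=
  integrable_rnDeriv_smul_iff (M.surface_absolutelyContinuous K)

theorem density_ae_eq_zero (K : ι) :
    ∀ᵐ x ∂M.skeleton, x ∉ M.closedCell K → M.density K x = 0 := by
  have hm := (M.isClosed_closedCell K).measurableSet.compl
  have h1 : ∫⁻ x in (M.closedCell K)ᶜ, (M.surface K).rnDeriv M.skeleton x ∂M.skeleton = 0 := by
    rw [Measure.setLIntegral_rnDeriv (M.surface_absolutelyContinuous K)]
    exact M.ae_mem_closedCell K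
  rw [lintegral_eq_zero_iff (Measure.measurable_rnDeriv _ _), EventuallyEq,
    ae_restrict_iff' hm] at h1
  filter_upwards [h1] with x hx hxK
  simp [density, hx hxK]

theorem integral_inner_gradient_eq_zero {φ : E n → ℝ} (hφ : IsTest Ω φ) (v : E n) :
    ∫ x in Ω, inner ℝ (gradient φ x) v = 0 := by
  rw [setIntegral_eq_integral_of_forall_compl_eq_zero
    fun x hx => by rw [hφ.gradient_eq_zero hx, inner_zero_left]]
  simp only [inner_gradient_eq]
  have hc : Continuous fun x => fderiv ℝ φ x v :=
    (hφ.contDiff_one.continuous_fderiv one_ne_zero).clm_apply continuous_const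
  have hi : Integrable (fun x => fderiv ℝ φ x v) :=
    hc.integrable_of_hasCompactSupport (hφ.2.1.fderiv_apply (𝕜 := ℝ) v)
  have := integral_mul_fderiv_eq_neg_fderiv_mul_of_integrable (μ := volume) (f := fun _ : E n => (1 : ℝ))
    (g := φ) (v := v) (by simp) (by simpa using hi)
    (by simpa using hφ.continuous.integrable_of_hasCompactSupport hφ.2.1)
    (fun x _ => differentiableAt_const _) (fun x _ => hφ.differentiable x)
  simpa using this

/-- Green's formula with the constant field `v` gives the integral of `∇φ·v` on each cell; these add
up to the integral over `Ω`, which is zero for a test function. -/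
theorem sum_integral_normal (hn : n + 1 = 2 ∨ n + 1 = 3) {φ : E n → ℝ} (hφ : IsTest Ω φ)
    (v : E n) : ∑ K, ∫ x, φ x * inner ℝ v (M.normal K x) ∂M.surface K = 0 := by
  have h1 (K : ι) : ∫ x, φ x * inner ℝ v (M.normal K x) ∂M.surface K
      = ∫ x in M.cell K, inner ℝ (gradient φ x) v := by
    have := M.green_cell K hn (G := fun _ => v) (fun y _ => contDiffAt_const) hφ.contDiff_one
    rw [← this]
    refine integral_congr_ae (Eventually.of_forall fun x => ?_)
    simp [refDiv]
  simp only [h1]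
  rw [← M.setIntegral_eq_sum, integral_inner_gradient_eq_zero hφ v]
  have hm : MemLp (fun x => inner ℝ (gradient φ x) v) 1 (volume.restrict Ω) :=
    MemLp.inner_const (hφ.memLp_gradient 1 _) v
  exact memLp_one_iff_integrable.1 hm

/-- The normals of the two cells at an interior face cancel. -/
theorem sum_density_smul_normal (hn : n + 1 = 2 ∨ n + 1 = 3) (hΩ : IsOpen Ω) :
    ∀ᵐ x ∂M.skeleton, x ∈ Ω → ∑ K, M.density K x • M.normal K x = 0 := by
  have hi (K : ι) : Integrable (fun x => M.density K x • M.normal K x) M.skeleton :=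
    (M.integrable_density_smul_iff K).2 (M.integrable_normal K)
  -- It suffices to test with functions supported in the open set `Ω`; this is why nothing is
  -- claimed on `∂Ω`.
  refine hΩ.ae_eq_zero_of_integral_contDiff_smul_eq_zero
    (integrable_finsetSum _ fun K _ => hi K).integrableOn.locallyIntegrableOn ?_
  intro φ hφ1 hφ2 hφ3
  have hφ : IsTest Ω φ := ⟨hφ1, hφ2, hφ3⟩
  obtain ⟨C, hC⟩ := hφ2.exists_bound_of_continuous hφ.continuous
  have hi' (K : ι) : Integrable (fun x => φ x • M.normal K x) (M.surface K) :=
    Integrable.bdd_smul (φ := φ) (M.integrable_normal K) C hφ.continuous.aestronglyMeasurable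
      (Eventually.of_forall hC)
  have e1 : (fun x => φ x • ∑ K, M.density K x • M.normal K x)
      = fun x => ∑ K, M.density K x • (φ x • M.normal K x) := by
    funext x
    rw [Finset.smul_sum]
    exact Finset.sum_congr rfl fun K _ => smul_comm _ _ _
  rw [e1, integral_finsetSum _ fun K _ => (M.integrable_density_smul_iff K).2 (hi' K)]
  simp only [integral_density]
  refine ext_inner_left ℝ fun v => ?_
  rw [inner_zero_right, inner_sum, ← M.sum_integral_normal hn hφ v]
  refine Finset.sum_congr rfl fun K _ => ?_
  rw [← integral_inner (𝕜 := ℝ) (hi' K) v]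
  simp only [inner_smul_right]

end Skeleton

/-! ### Jumps -/

section Jump

variable {ε : ℝ} {U : E n → ℝ}

/-- The diffusive flux of `U` on the closed cell. -/
noncomputable def cellFlux (ε : ℝ) (U : E n → ℝ) (K : ι) (x : E n) : E n :=
  ε • gradientWithin U (M.closedCell K) x

theorem continuousOn_cellFlux {p : ℕ} {w : V Ω} (hU : M.IsFERep p w U) (K : ι) :
    ContinuousOn (M.cellFlux ε U K) (M.closedCell K) := by
  obtain ⟨q, -, hq⟩ := hU.2.2 K
  refine ContinuousOn.const_smul ?_ ε
  exact (M.continuousOn_comp_inv K (M.continuousOn_refGrad K q)).congr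
    fun x hx => M.gradientWithin_closedCell hq hx

variable [Fintype ι]

open Classical in
-- With two cells at `x` the weighted normals are opposite, so each side equals `d K` times the
-- normal component of `g K - g K'`: the two halves on the right are equal. With a single cell the
-- weighted normal is zero and both sides vanish.
theorem sum_eq_sum_jump {x : E n} {d : ι → ℝ} {ν g : ι → E n}
    (hcard : (Finset.univ.filter fun K => x ∈ M.closedCell K).card ≤ 2)
    (hd : ∀ K, x ∉ M.closedCell K → d K = 0) (hsum : ∑ K, d K • ν K = 0) :
    ∑ K, d K * inner ℝ (ν K) (g K)
      = ∑ K, d K * ∑ K' ∈ Finset.univ.filter (fun K' => K' ≠ K ∧ x ∈ M.closedCell K'),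
        (1 / 2) * inner ℝ (ν K) (g K - g K') := by
  set s := Finset.univ.filter fun K => x ∈ M.closedCell K with hs
  have hmem (K : ι) : K ∈ s ↔ x ∈ M.closedCell K := by simp [hs]
  have red {F : Type _} [AddCommGroup F] [Module ℝ F] (h : ι → F) :
      ∑ K, d K • h K = ∑ K ∈ s, d K • h K := by
    refine (Finset.sum_subset (Finset.subset_univ s) fun K _ hK => ?_).symm
    rw [hd K (mt (hmem K).2 hK), zero_smul]
  have hfil (K : ι) : Finset.univ.filter (fun K' => K' ≠ K ∧ x ∈ M.closedCell K') = s.erase K := by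
    ext K'; simp [hs]
  have red1 := red fun K => inner ℝ (ν K) (g K)
  have red2 := red fun K => ∑ K' ∈ s.erase K, (1 / 2) * inner ℝ (ν K) (g K - g K')
  simp only [smul_eq_mul] at red1 red2
  simp only [hfil]
  rw [red1, red2]
  rw [red] at hsum
  have hcases : s.card = 0 ∨ s.card = 1 ∨ s.card = 2 := by omega
  rcases hcases with h | h | h
  · rw [Finset.card_eq_zero.1 h]; simp
  · obtain ⟨K, hK⟩ := Finset.card_eq_one.1 h
    rw [hK] at hsum ⊢
    simp only [Finset.sum_singleton] at hsum ⊢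
    rw [← real_inner_smul_left, hsum]
    simp
  · obtain ⟨K, K', hne, hK⟩ := Finset.card_eq_two.1 h
    rw [hK] at hsum ⊢
    rw [Finset.sum_pair hne] at hsum
    rw [Finset.sum_pair hne, Finset.sum_pair hne, Finset.erase_insert (by simpa using hne),
      Finset.pair_comm, Finset.erase_insert (by simpa using hne.symm)]
    simp only [Finset.sum_singleton]
    have hν : d K' • ν K' = -(d K • ν K) := by
      rw [eq_neg_iff_add_eq_zero, add_comm]; exact hsum
    have hν' (a : E n) : d K' * inner ℝ (ν K') a = -(d K * inner ℝ (ν K) a) := by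
      rw [← real_inner_smul_left, hν, inner_neg_left, real_inner_smul_left]
    simp only [inner_sub_right]
    linear_combination (1 / 2) * hν' (g K') + (1 / 2) * hν' (g K)

theorem exists_cellFlux_bound {p : ℕ} {w : V Ω} (hU : M.IsFERep p w U) :
    ∃ C, 0 ≤ C ∧ ∀ K, ∀ x ∈ M.closedCell K, ‖M.cellFlux ε U K x‖ ≤ C := by
  choose C hC using fun K => (M.isCompact_closedCell K).exists_bound_of_continuousOn
    (M.continuousOn_cellFlux (ε := ε) hU K)
  refine ⟨∑ K, |C K|, by positivity, fun K x hx => (hC K x hx).trans ((le_abs_self _).trans ?_)⟩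
  exact Finset.single_le_sum (f := fun K => |C K|) (fun _ _ => abs_nonneg _) (Finset.mem_univ K)

open Classical in
theorem edgeResidual_eq (K : ι) (x : E n) : M.edgeResidual ε U K x =
    if x ∈ frontier Ω then 0 else
    ∑ K' ∈ Finset.univ.filter (fun K' => K' ≠ K ∧ x ∈ M.closedCell K'),
      (1 / 2) * inner ℝ (M.normal K x) (M.cellFlux ε U K x - M.cellFlux ε U K' x) := by
  unfold edgeResidual cellFlux
  congr

theorem aestronglyMeasurable_edgeResidual {p : ℕ} {w : V Ω} (hU : M.IsFERep p w U) (K : ι) :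
    AEStronglyMeasurable (M.edgeResidual ε U K) (M.surface K) := by
  classical
  -- The index set of the sum depends on `x`; as a sum of indicators of closed cells over a fixed
  -- index set the function is visibly measurable.
  have h : M.edgeResidual ε U K = (frontier Ω)ᶜ.indicator (fun x => ∑ K' ∈ Finset.univ.erase K,
      (M.closedCell K').indicator (fun x => (1 / 2) * inner ℝ (M.normal K x)
        (M.cellFlux ε U K x - M.cellFlux ε U K' x)) x) := by
    funext x
    rw [edgeResidual_eq]
    by_cases hx : x ∈ frontier Ω
    · simp [hx]
    · rw [if_neg hx, indicator_of_mem (mem_compl hx)]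
      simp only [indicator_apply, ← Finset.sum_filter]
      refine Finset.sum_congr ?_ fun _ _ => rfl
      ext K'; simp
  rw [h]
  refine AEStronglyMeasurable.indicator ?_ isClosed_frontier.measurableSet.compl
  refine Finset.aestronglyMeasurable_fun_sum _ fun K' _ => ?_
  rw [aestronglyMeasurable_indicator_iff (M.isClosed_closedCell K').measurableSet]
  have h1 : AEStronglyMeasurable (M.cellFlux ε U K') ((M.surface K).restrict (M.closedCell K')) :=
    (M.continuousOn_cellFlux hU K').aestronglyMeasurable (M.isClosed_closedCell K').measurableSet
  have h2 : AEStronglyMeasurable (M.cellFlux ε U K) (M.surface K) :=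
    M.aestronglyMeasurable_of_continuousOn K (M.continuousOn_cellFlux hU K)
  exact ((M.aestronglyMeasurable_normal K).restrict.inner (h2.restrict.sub h1)).const_mul _

theorem exists_edgeResidual_bound {p : ℕ} {w : V Ω} (hU : M.IsFERep p w U) :
    ∃ C, 0 ≤ C ∧ ∀ K, ∀ x ∈ M.closedCell K, ‖M.edgeResidual ε U K x‖ ≤ C := by
  classical
  obtain ⟨C, hC0, hC⟩ := M.exists_cellFlux_bound (ε := ε) hU
  -- Each term is at most `½ (C + C)`, and there are no more terms than cells.
  refine ⟨Fintype.card ι * C, by positivity, fun K x hx => ?_⟩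
  rw [edgeResidual_eq]
  split_ifs with hfr
  · simpa using by positivity
  refine (norm_sum_le_of_le (n := fun _ => C) _ fun K' hK' => ?_).trans ?_
  · simp only [Finset.mem_filter] at hK'
    rw [norm_mul]
    have h1 := norm_inner_le_norm (𝕜 := ℝ) (M.normal K x)
      (M.cellFlux ε U K x - M.cellFlux ε U K' x)
    have h2 := norm_sub_le (M.cellFlux ε U K x) (M.cellFlux ε U K' x)
    have h3 := hC K x hx
    have h4 := hC K' x hK'.2.2
    have h5 : ‖M.normal K x‖ * ‖M.cellFlux ε U K x - M.cellFlux ε U K' x‖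
        ≤ 1 * (C + C) := by
      gcongr
      · exact M.norm_normal_le K x
      · exact h2.trans (add_le_add h3 h4)
    rw [Real.norm_of_nonneg (by norm_num : (0 : ℝ) ≤ 1 / 2)]
    linarith
  · rw [Finset.sum_const, nsmul_eq_mul]
    gcongr
    exact Finset.card_le_univ _

theorem memLp_edgeResidual {p : ℕ} {w : V Ω} (hU : M.IsFERep p w U) (K : ι) (r : ℝ≥0∞) :
    MemLp (M.edgeResidual ε U K) r (M.surface K) := by
  obtain ⟨C, -, hC⟩ := M.exists_edgeResidual_bound (ε := ε) hU
  refine MemLp.of_bound (M.aestronglyMeasurable_edgeResidual hU K) C ?_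
  filter_upwards [M.ae_mem_closedCell K] with x hx using hC K x hx

/-- The boundary terms of all cells add up to the integrals of the edge residuals. -/
theorem sum_integral_cellFlux (hn : n + 1 = 2 ∨ n + 1 = 3) (hΩ : IsOpen Ω) {p : ℕ} {w : V Ω}
    (hU : M.IsFERep p w U) {φ : E n → ℝ} (hφ : IsTest Ω φ) :
    ∑ K, ∫ x, φ x * inner ℝ (M.cellFlux ε U K x) (M.normal K x) ∂M.surface K
      = ∑ K, ∫ x, M.edgeResidual ε U K x * φ x ∂M.surface K := by
  classical
  obtain ⟨C, hC0, hC⟩ := M.exists_cellFlux_bound (ε := ε) hU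
  have hφc (K : ι) : Integrable φ (M.surface K) :=
    memLp_one_iff_integrable.1 (hφ.memLp 1 _)
  have i1 (K : ι) : Integrable (fun x => φ x * inner ℝ (M.cellFlux ε U K x) (M.normal K x))
      (M.surface K) := by
    refine (hφc K).mul_bdd (c := C) ((M.aestronglyMeasurable_of_continuousOn K
      (M.continuousOn_cellFlux hU K)).inner (M.aestronglyMeasurable_normal K)) ?_
    filter_upwards [M.ae_mem_closedCell K] with x hx
    refine (norm_inner_le_norm _ _).trans ?_
    calc _ ≤ C * 1 := mul_le_mul (hC K x hx) (M.norm_normal_le K x) (norm_nonneg _) hC0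
      _ = C := mul_one C
  have i2 (K : ι) : Integrable (fun x => M.edgeResidual ε U K x * φ x) (M.surface K) :=
    (M.memLp_edgeResidual hU K 2).integrable_mul (hφ.memLp 2 _)
  simp only [← M.integral_density]
  rw [← integral_finsetSum _ fun K _ => (M.integrable_density_smul_iff K).2 (i1 K),
    ← integral_finsetSum _ fun K _ => (M.integrable_density_smul_iff K).2 (i2 K)]
  refine integral_congr_ae ?_
  filter_upwards [M.sum_density_smul_normal hn hΩ, ae_all_iff.2 M.density_ae_eq_zero,
    M.ae_skeleton_iff.2 M.ae_card_closedCell_le_two] with x h1 h2 h3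
  -- The cancellation of normals is available in `Ω` only, but test functions vanish elsewhere.
  by_cases hx : x ∈ Ω
  · have hfr : x ∉ frontier Ω := fun h => (hΩ.frontier_eq ▸ h).2 hx
    have key := M.sum_eq_sum_jump (g := fun K => M.cellFlux ε U K x) h3 h2 (h1 hx)
    simp only [edgeResidual_eq, if_neg hfr, smul_eq_mul]
    have e1 : ∑ K, M.density K x * (φ x * inner ℝ (M.cellFlux ε U K x) (M.normal K x))
        = φ x * ∑ K, M.density K x * inner ℝ (M.normal K x) (M.cellFlux ε U K x) := by
      rw [Finset.mul_sum]
      refine Finset.sum_congr rfl fun K _ => ?_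
      rw [real_inner_comm]; ring
    rw [e1, key, Finset.mul_sum]
    exact Finset.sum_congr rfl fun K _ => by ring
  · simp [hφ.eq_zero_of_notMem hx]

end Jump

end Mesh

end SUPG

namespace SUPG

open scoped ENNReal NNReal

/-! ### The trapezoidal rule along a segment -/

section Taylor

variable {W : Type*} [NormedAddCommGroup W] [NormedSpace ℝ W] {J : W → ℝ}

theorem hasDerivAt_dirDeriv {k : ℕ} (hJ : Differentiable ℝ (iteratedFDeriv ℝ k J)) (a e : W)
    (s : ℝ) :
    HasDerivAt (fun s : ℝ => dirDeriv k J (a + s • e) e) (dirDeriv (k + 1) J (a + s • e) e) s := by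
  have hline : HasDerivAt (fun s : ℝ => a + s • e) e s := by
    simpa using ((hasDerivAt_id s).smul_const e).const_add a
  have h1 := (hJ (a + s • e)).hasFDerivAt.comp_hasDerivAt s hline
  have h2 := (ContinuousMultilinearMap.apply ℝ (fun _ : Fin k => W) ℝ
    (fun _ => e)).hasFDerivAt.comp_hasDerivAt s h1
  refine h2.congr_deriv ?_
  rw [dirDeriv, iteratedFDeriv_succ_apply_left]
  rfl

theorem dirDeriv_one (x e : W) : dirDeriv 1 J x e = fderiv ℝ J x e := by
  rw [dirDeriv, iteratedFDeriv_one_apply]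

theorem dirDeriv_zero (x e : W) : dirDeriv 0 J x e = J x := rfl

/-- The trapezoidal rule with its remainder, where the derivative at `u_h` is then traded for the
one at `u` at the cost of `½ Δρ_J`. The first two directional derivatives are continuous along the
segment because they are differentiable; the third need not be, so its integrability enters as a
hypothesis. -/
theorem sub_eq_fderiv_add_remainder (hJ : ∀ k < 3, Differentiable ℝ (iteratedFDeriv ℝ k J))
    (u uh : W) (hR : IntervalIntegrable (fun s : ℝ =>
      dirDeriv 3 J (uh + s • (u - uh)) (u - uh) * s * (s - 1)) volume 0 1) :
    J u - J uh = fderiv ℝ J u (u - uh) + (remainderJ J u uh + (1 / 2) * deltaRho J u uh) := by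
  set e := u - uh with he
  have hend : uh + (1 : ℝ) • e = u := by rw [one_smul, he]; abel
  have d0 := hasDerivAt_dirDeriv (hJ 0 (by norm_num)) uh e
  have d1 := hasDerivAt_dirDeriv (hJ 1 (by norm_num)) uh e
  have d2 := hasDerivAt_dirDeriv (hJ 2 (by norm_num)) uh e
  simp only [zero_add, Nat.reduceAdd, dirDeriv_zero] at d0 d1 d2
  have c1 : Continuous fun s : ℝ => dirDeriv 1 J (uh + s • e) e :=
    continuous_iff_continuousAt.2 fun s => (d1 s).continuousAt
  have c2 : Continuous fun s : ℝ => dirDeriv 2 J (uh + s • e) e :=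
    continuous_iff_continuousAt.2 fun s => (d2 s).continuousAt
  have I0 := intervalIntegral.integral_eq_sub_of_hasDerivAt (a := 0) (b := 1)
    (fun s _ => d0 s) (c1.intervalIntegrable _ _)
  have I1 := intervalIntegral.integral_eq_sub_of_hasDerivAt (a := 0) (b := 1)
    (fun s _ => d1 s) (c2.intervalIntegrable _ _)
  -- The weight `2s - 1` is `-1` and `1` at the end points and produces the trapezoidal values. It
  -- is the derivative of `s (s - 1)`, which vanishes at both ends, so the second integration by
  -- parts has no boundary terms.
  have d1' (s : ℝ) : HasDerivAt (fun s : ℝ => dirDeriv 1 J (uh + s • e) e * (2 * s - 1))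
      (dirDeriv 2 J (uh + s • e) e * (2 * s - 1) + dirDeriv 1 J (uh + s • e) e * 2) s := by
    refine (d1 s).mul ?_
    simpa using ((hasDerivAt_id s).const_mul 2).sub_const 1
  have i2 : IntervalIntegrable (fun s : ℝ => dirDeriv 2 J (uh + s • e) e * (2 * s - 1))
      volume 0 1 := Continuous.intervalIntegrable (by fun_prop) _ _
  have i1 : IntervalIntegrable (fun s : ℝ => dirDeriv 1 J (uh + s • e) e * 2)
      volume 0 1 := Continuous.intervalIntegrable (by fun_prop) _ _
  have I2 := intervalIntegral.integral_eq_sub_of_hasDerivAt (a := 0) (b := 1)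
    (fun s _ => d1' s) (i2.add i1)
  have d2' (s : ℝ) : HasDerivAt (fun s : ℝ => dirDeriv 2 J (uh + s • e) e * (s * (s - 1)))
      (dirDeriv 3 J (uh + s • e) e * s * (s - 1)
        + dirDeriv 2 J (uh + s • e) e * (2 * s - 1)) s := by
    have h := (d2 s).mul ((hasDerivAt_id s).mul ((hasDerivAt_id s).sub_const 1))
    refine h.congr_deriv ?_
    simp
    ring
  have I3 := intervalIntegral.integral_eq_sub_of_hasDerivAt (a := 0) (b := 1)
    (fun s _ => d2' s) (hR.add i2)
  rw [intervalIntegral.integral_add hR i2] at I3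
  rw [intervalIntegral.integral_add i2 i1, intervalIntegral.integral_mul_const] at I2
  simp only [hend, zero_smul, add_zero] at I0 I1 I2 I3
  rw [remainderJ, deltaRho, ← dirDeriv_one, ← he]
  linarith

theorem abs_dirDeriv_le (k : ℕ) (x e : W) :
    |dirDeriv k J x e| ≤ ‖iteratedFDeriv ℝ k J x‖ * ‖e‖ ^ k := by
  have := (iteratedFDeriv ℝ k J x).le_opNorm (fun _ => e)
  simpa [dirDeriv] using this

theorem abs_half_deltaRho_le {u uh : W} {C : ℝ}
    (hC : ∀ s ∈ Icc (0 : ℝ) 1, ‖iteratedFDeriv ℝ 2 J (uh + s • (u - uh))‖ ≤ C) :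
    |(1 / 2) * deltaRho J u uh| ≤ C / 2 * ‖u - uh‖ ^ 2 := by
  have h := intervalIntegral.norm_integral_le_of_norm_le_const (a := 0) (b := 1)
    (f := fun s : ℝ => dirDeriv 2 J (uh + s • (u - uh)) (u - uh)) (C := C * ‖u - uh‖ ^ 2) ?_
  · rw [deltaRho, abs_mul, abs_neg]
    rw [Real.norm_eq_abs] at h
    norm_num at h ⊢
    linarith
  · intro s hs
    rw [uIoc_of_le zero_le_one] at hs
    refine (abs_dirDeriv_le 2 _ _).trans ?_
    gcongr
    exact hC s ⟨hs.1.le, hs.2⟩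

theorem abs_remainderJ_le {u uh : W} {C : ℝ}
    (hC : ∀ s ∈ Icc (0 : ℝ) 1, ‖iteratedFDeriv ℝ 3 J (uh + s • (u - uh))‖ ≤ C) :
    |remainderJ J u uh| ≤ C / 12 * ‖u - uh‖ ^ 3 := by
  have h := intervalIntegral.norm_integral_le_of_norm_le (μ := volume) (a := 0) (b := 1)
    (f := fun s : ℝ => dirDeriv 3 J (uh + s • (u - uh)) (u - uh) * s * (s - 1))
    (g := fun s : ℝ => C * ‖u - uh‖ ^ 3 * (s * (1 - s))) zero_le_one
    (Eventually.of_forall fun s hs => ?_) (Continuous.intervalIntegrable (by fun_prop) _ _)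
  · have hval : ∫ s in (0 : ℝ)..1, s * (1 - s) = 1 / 6 := by
      have : (fun s : ℝ => s * (1 - s)) = fun s => s - s ^ 2 := by funext s; ring
      rw [this, intervalIntegral.integral_sub intervalIntegral.intervalIntegrable_id
        (intervalIntegral.intervalIntegrable_pow 2), integral_id, integral_pow]
      norm_num
    rw [intervalIntegral.integral_const_mul, hval, Real.norm_eq_abs] at h
    rw [remainderJ, abs_mul]
    norm_num at h ⊢
    linarith
  · rw [norm_mul, norm_mul, mul_assoc, Real.norm_of_nonneg hs.1.le, Real.norm_eq_abs (s - 1),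
      abs_of_nonpos (by linarith [hs.2]), neg_sub]
    have h0 : 0 ≤ s * (1 - s) := mul_nonneg hs.1.le (by linarith [hs.2])
    gcongr
    refine (abs_dirDeriv_le 3 _ _).trans ?_
    gcongr
    exact hC s ⟨hs.1.le, hs.2⟩

end Taylor

/-! ### The weak problem -/

section Weak

variable {n : ℕ} {Ω : Set (E n)}

theorem val_add_smul (u v : V Ω) (s : ℝ) :
    V.val (u + s • v) =ᵐ[volume.restrict Ω] fun x => V.val u x + s * V.val v x := by
  have h1 := Lp.coeFn_add (u : L2Pair Ω).fst (s • (v : L2Pair Ω).fst)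
  have h2 := Lp.coeFn_smul s (v : L2Pair Ω).fst
  filter_upwards [h1, h2] with x h1 h2
  refine h1.trans ?_
  rw [Pi.add_apply, h2]
  rfl

theorem grad_add_smul (u v : V Ω) (s : ℝ) :
    V.grad (u + s • v) =ᵐ[volume.restrict Ω] fun x => V.grad u x + s • V.grad v x := by
  have h1 := Lp.coeFn_add (u : L2Pair Ω).snd (s • (v : L2Pair Ω).snd)
  have h2 := Lp.coeFn_smul s (v : L2Pair Ω).snd
  filter_upwards [h1, h2] with x h1 h2
  refine h1.trans ?_
  rw [Pi.add_apply, h2]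
  rfl

theorem integral_eq_add_mul {β : Type*} [MeasurableSpace β] {μ : Measure β} {f g h : β → ℝ}
    {s : ℝ} (hf : Integrable f μ) (hg : Integrable g μ) (hh : h =ᵐ[μ] fun x => f x + s * g x) :
    ∫ x, h x ∂μ = ∫ x, f x ∂μ + s * ∫ x, g x ∂μ := by
  rw [integral_congr_ae hh, integral_add hf (hg.const_mul s), integral_const_mul]

theorem integrable_inner_of_memLp_two {β F : Type*} [MeasurableSpace β] [NormedAddCommGroup F]
    [InnerProductSpace ℝ F] {μ : Measure β} {f g : β → F} (hf : MemLp f 2 μ) (hg : MemLp g 2 μ) :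
    Integrable (fun x => inner ℝ (f x) (g x)) μ := by
  refine (hf.norm.integrable_mul hg.norm).mono' (hf.1.inner hg.1) (Eventually.of_forall fun x => ?_)
  exact norm_inner_le_norm _ _

theorem memLp_inner_top {β F : Type*} [MeasurableSpace β] [NormedAddCommGroup F]
    [InnerProductSpace ℝ F] {μ : Measure β} {b g : β → F} (hb : MemLp b ⊤ μ) (hg : MemLp g 2 μ) :
    MemLp (fun x => inner ℝ (b x) (g x)) 2 μ := by
  have h : MemLp (fun x => ‖b x‖ * ‖g x‖) 2 μ := hg.norm.mul' hb.norm
  refine h.mono (hb.1.inner hg.1) (Eventually.of_forall fun x => ?_)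
  rw [Real.norm_of_nonneg (mul_nonneg (norm_nonneg _) (norm_nonneg _))]
  exact norm_inner_le_norm _ _

theorem memLp_mul_top {β : Type*} [MeasurableSpace β] {μ : Measure β} {a g : β → ℝ}
    (ha : MemLp a ⊤ μ) (hg : MemLp g 2 μ) : MemLp (fun x => a x * g x) 2 μ := hg.mul' ha

variable {ε : ℝ} {b : E n → E n} {α f : E n → ℝ}

theorem integrable_diffusion (ε : ℝ) (u φ : V Ω) :
    IntegrableOn (fun x => inner ℝ (ε • V.grad u x) (V.grad φ x)) Ω :=
  integrable_inner_of_memLp_two ((memLp_grad u).const_smul ε) (memLp_grad φ)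

theorem integrable_convection (hb : MemLp b ⊤ (volume.restrict Ω)) (u φ : V Ω) :
    IntegrableOn (fun x => inner ℝ (b x) (V.grad u x) * V.val φ x) Ω :=
  (memLp_inner_top hb (memLp_grad u)).integrable_mul (memLp_val φ)

theorem integrable_reaction (hα : MemLp α ⊤ (volume.restrict Ω)) (u φ : V Ω) :
    IntegrableOn (fun x => α x * V.val u x * V.val φ x) Ω :=
  (memLp_mul_top hα (memLp_val u)).integrable_mul (memLp_val φ)

/-- The shape `u + s • v` serves both the derivatives of the Lagrangian along lines and, with `s =
-1`, the differences of arguments. -/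
theorem formA_add_smul_left (hb : MemLp b ⊤ (volume.restrict Ω))
    (hα : MemLp α ⊤ (volume.restrict Ω)) (u v φ : V Ω) (s : ℝ) :
    formA ε b α (u + s • v) φ = formA ε b α u φ + s * formA ε b α v φ := by
  have e1 : ∫ x in Ω, inner ℝ (ε • V.grad (u + s • v) x) (V.grad φ x)
      = (∫ x in Ω, inner ℝ (ε • V.grad u x) (V.grad φ x))
        + s * ∫ x in Ω, inner ℝ (ε • V.grad v x) (V.grad φ x) := by
    refine integral_eq_add_mul (integrable_diffusion ε u φ) (integrable_diffusion ε v φ) ?_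
    filter_upwards [grad_add_smul u v s] with x hx
    simp only [hx, smul_add, inner_add_left, real_inner_smul_left]
    ring
  have e2 : ∫ x in Ω, inner ℝ (b x) (V.grad (u + s • v) x) * V.val φ x
      = (∫ x in Ω, inner ℝ (b x) (V.grad u x) * V.val φ x)
        + s * ∫ x in Ω, inner ℝ (b x) (V.grad v x) * V.val φ x := by
    refine integral_eq_add_mul (integrable_convection hb u φ) (integrable_convection hb v φ) ?_
    filter_upwards [grad_add_smul u v s] with x hx
    simp only [hx, inner_add_right, real_inner_smul_right]
    ring
  have e3 : ∫ x in Ω, α x * V.val (u + s • v) x * V.val φ x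
      = (∫ x in Ω, α x * V.val u x * V.val φ x)
        + s * ∫ x in Ω, α x * V.val v x * V.val φ x := by
    refine integral_eq_add_mul (integrable_reaction hα u φ) (integrable_reaction hα v φ) ?_
    filter_upwards [val_add_smul u v s] with x hx
    simp only [hx]
    ring
  rw [formA, e1, e2, e3, formA, formA]
  ring

theorem formA_add_smul_right (hb : MemLp b ⊤ (volume.restrict Ω))
    (hα : MemLp α ⊤ (volume.restrict Ω)) (u φ ψ : V Ω) (s : ℝ) :
    formA ε b α u (φ + s • ψ) = formA ε b α u φ + s * formA ε b α u ψ := by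
  have e1 : ∫ x in Ω, inner ℝ (ε • V.grad u x) (V.grad (φ + s • ψ) x)
      = (∫ x in Ω, inner ℝ (ε • V.grad u x) (V.grad φ x))
        + s * ∫ x in Ω, inner ℝ (ε • V.grad u x) (V.grad ψ x) := by
    refine integral_eq_add_mul (integrable_diffusion ε u φ) (integrable_diffusion ε u ψ) ?_
    filter_upwards [grad_add_smul φ ψ s] with x hx
    simp only [hx, inner_add_right, real_inner_smul_right]
  have e2 : ∫ x in Ω, inner ℝ (b x) (V.grad u x) * V.val (φ + s • ψ) x
      = (∫ x in Ω, inner ℝ (b x) (V.grad u x) * V.val φ x)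
        + s * ∫ x in Ω, inner ℝ (b x) (V.grad u x) * V.val ψ x := by
    refine integral_eq_add_mul (integrable_convection hb u φ) (integrable_convection hb u ψ) ?_
    filter_upwards [val_add_smul φ ψ s] with x hx
    simp only [hx]
    ring
  have e3 : ∫ x in Ω, α x * V.val u x * V.val (φ + s • ψ) x
      = (∫ x in Ω, α x * V.val u x * V.val φ x)
        + s * ∫ x in Ω, α x * V.val u x * V.val ψ x := by
    refine integral_eq_add_mul (integrable_reaction hα u φ) (integrable_reaction hα u ψ) ?_
    filter_upwards [val_add_smul φ ψ s] with x hx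
    simp only [hx]
    ring
  rw [formA, e1, e2, e3, formA, formA]
  ring

theorem formF_add_smul (hf : MemLp f 2 (volume.restrict Ω)) (φ ψ : V Ω) (s : ℝ) :
    formF f (φ + s • ψ) = formF f φ + s * formF f ψ := by
  have i (φ : V Ω) : IntegrableOn (fun x => f x * V.val φ x) Ω := hf.integrable_mul (memLp_val φ)
  refine integral_eq_add_mul (i φ) (i ψ) ?_
  filter_upwards [val_add_smul φ ψ s] with x hx
  simp only [hx]
  ring

variable {J : V Ω → ℝ} {u z : V Ω}

/-- Only derivatives along lines are used, which spares a proof that the bilinear form is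
continuous. -/
theorem hasDerivAt_lagrangian_line
    (huz : HasFDerivAt (lagrangian ε b α f J) (0 : V Ω × V Ω →L[ℝ] ℝ) (u, z)) (v w : V Ω) :
    HasDerivAt (fun s : ℝ => lagrangian ε b α f J (u + s • v, z + s • w)) 0 0 := by
  have hline : HasDerivAt (fun s : ℝ => (u + s • v, z + s • w)) (v, w) 0 := by
    refine HasDerivAt.prodMk ?_ ?_
    · simpa using ((hasDerivAt_id (0 : ℝ)).smul_const v).const_add u
    · simpa using ((hasDerivAt_id (0 : ℝ)).smul_const w).const_add z
  have huz' : HasFDerivAt (lagrangian ε b α f J) (0 : V Ω × V Ω →L[ℝ] ℝ)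
      ((fun s : ℝ => (u + s • v, z + s • w)) 0) := by simpa using huz
  have h := huz'.comp_hasDerivAt (0 : ℝ) hline
  rw [zero_apply] at h
  exact h

/-- The primal problem. -/
theorem formA_eq_formF_of_stationary (hb : MemLp b ⊤ (volume.restrict Ω))
    (hα : MemLp α ⊤ (volume.restrict Ω)) (hf : MemLp f 2 (volume.restrict Ω))
    (huz : HasFDerivAt (lagrangian ε b α f J) (0 : V Ω × V Ω →L[ℝ] ℝ) (u, z)) (φ : V Ω) :
    formA ε b α u φ = formF f φ := by
  have h1 := hasDerivAt_lagrangian_line huz 0 φ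
  have h2 : HasDerivAt (fun s : ℝ => J u + formF f z - formA ε b α u z
      + s * (formF f φ - formA ε b α u φ)) (formF f φ - formA ε b α u φ) 0 := by
    simpa using ((hasDerivAt_id (0 : ℝ)).mul_const (formF f φ - formA ε b α u φ)).const_add
      (J u + formF f z - formA ε b α u z)
  have h3 : (fun s : ℝ => lagrangian ε b α f J (u + s • (0 : V Ω), z + s • φ))
      = fun s : ℝ => J u + formF f z - formA ε b α u z
      + s * (formF f φ - formA ε b α u φ) := by
    funext s
    simp only [lagrangian, smul_zero, add_zero, formA_add_smul_right hb hα, formF_add_smul hf]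
    ring
  rw [h3] at h1
  linarith [h1.unique h2]

/-- The dual problem. -/
theorem fderiv_eq_formA_of_stationary (hb : MemLp b ⊤ (volume.restrict Ω))
    (hα : MemLp α ⊤ (volume.restrict Ω)) (hJ : DifferentiableAt ℝ J u)
    (huz : HasFDerivAt (lagrangian ε b α f J) (0 : V Ω × V Ω →L[ℝ] ℝ) (u, z)) (v : V Ω) :
    fderiv ℝ J u v = formA ε b α v z := by
  have h1 := hasDerivAt_lagrangian_line huz v 0
  have hline : HasDerivAt (fun s : ℝ => u + s • v) v 0 := by
    simpa using ((hasDerivAt_id (0 : ℝ)).smul_const v).const_add u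
  have hJ' : HasFDerivAt J (fderiv ℝ J u) ((fun s : ℝ => u + s • v) 0) := by
    simpa using hJ.hasFDerivAt
  have h2 : HasDerivAt (fun s : ℝ => J (u + s • v) + (formF f z - formA ε b α u z
      + s * (- formA ε b α v z))) (fderiv ℝ J u v + (- formA ε b α v z)) 0 := by
    refine (hJ'.comp_hasDerivAt (0 : ℝ) hline).add ?_
    simpa using ((hasDerivAt_id (0 : ℝ)).mul_const (- formA ε b α v z)).const_add
      (formF f z - formA ε b α u z)
  have h3 : (fun s : ℝ => lagrangian ε b α f J (u + s • v, z + s • (0 : V Ω)))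
      = fun s : ℝ => J (u + s • v) + (formF f z - formA ε b α u z
      + s * (- formA ε b α v z)) := by
    funext s
    simp only [lagrangian, smul_zero, add_zero, formA_add_smul_left hb hα]
    ring
  rw [h3] at h1
  linarith [h1.unique h2]

end Weak

end SUPG

namespace SUPG

open scoped ENNReal NNReal

namespace Mesh

variable {n : ℕ} {Ω : Set (E n)} {ι : Type*} (M : Mesh Ω ι)

/-! ### Cell residuals -/

variable {ε : ℝ} {U : E n → ℝ} {p : ℕ} {v : V Ω} {b : E n → E n} {α f : E n → ℝ}

theorem memLp_cell_of_continuousOn {F : Type*} [NormedAddCommGroup F]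
    [SecondCountableTopology F] {h : E n → F} (K : ι)
    (hh : ContinuousOn h (M.closedCell K)) (r : ℝ≥0∞) : MemLp h r (volume.restrict (M.cell K)) := by
  have := M.isFiniteMeasure_restrict_cell K
  obtain ⟨C, hC⟩ := (M.isCompact_closedCell K).exists_bound_of_continuousOn hh
  have hm := (M.isOpen_cell K).measurableSet
  refine MemLp.of_bound ((hh.mono (M.cell_subset_closedCell K)).aestronglyMeasurable hm) C ?_
  filter_upwards [ae_restrict_mem hm] with x hx using hC x (M.cell_subset_closedCell K hx)

theorem memLp_gradient_cell (hU : M.IsFERep p v U) (K : ι) (r : ℝ≥0∞) :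
    MemLp (gradient U) r (volume.restrict (M.cell K)) := by
  obtain ⟨q, -, hq⟩ := hU.2.2 K
  refine (M.memLp_cell_of_continuousOn K
    (M.continuousOn_comp_inv K (M.continuousOn_refGrad K q)) r).ae_eq ?_
  filter_upwards [ae_restrict_mem (M.isOpen_cell K).measurableSet] with x hx
  exact (M.gradient_cell hq hx).symm

theorem memLp_divergence_cell (hU : M.IsFERep p v U) (K : ι) (r : ℝ≥0∞) :
    MemLp (divergence fun y => ε • gradient U y) r (volume.restrict (M.cell K)) := by
  obtain ⟨q, -, hq⟩ := hU.2.2 K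
  have hc : ContinuousOn (fun x => ε * M.refDiv K (M.refGrad K q) (M.inv K x)) (M.closedCell K) :=
    continuousOn_const.mul
      (M.continuousOn_comp_inv K (M.continuousOn_refDiv K (M.contDiffAt_refGrad K q)))
  refine (M.memLp_cell_of_continuousOn K hc r).ae_eq ?_
  filter_upwards [ae_restrict_mem (M.isOpen_cell K).measurableSet] with x hx
  exact (M.divergence_cell hq ε hx).symm

theorem restrict_cell_le (K : ι) : volume.restrict (M.cell K) ≤ volume.restrict Ω :=
  Measure.restrict_mono (M.cell_subset K) le_rfl

theorem memLp_of_cell {F : Type*} [NormedAddCommGroup F] {h : E n → F} {r : ℝ≥0∞}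
    (hh : MemLp h r (volume.restrict Ω)) (K : ι) : MemLp h r (volume.restrict (M.cell K)) :=
  hh.mono_measure (M.restrict_cell_le K)

theorem memLp_rep_cell (hU : M.IsFERep p v U) (K : ι) :
    MemLp U 2 (volume.restrict (M.cell K)) :=
  M.memLp_of_cell ((memLp_val v).ae_eq hU.1) K

theorem memLp_cellResidual (hb : MemLp b ⊤ (volume.restrict Ω))
    (hα : MemLp α ⊤ (volume.restrict Ω)) (hf : MemLp f 2 (volume.restrict Ω))
    (hU : M.IsFERep p v U) (K : ι) :
    MemLp (cellResidual ε b α f U) 2 (volume.restrict (M.cell K)) :=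
  (((M.memLp_of_cell hf K).add (M.memLp_divergence_cell hU K 2)).sub
    (memLp_inner_top (M.memLp_of_cell hb K) (M.memLp_gradient_cell hU K 2))).sub
    (memLp_mul_top (M.memLp_of_cell hα K) (M.memLp_rep_cell hU K))

theorem grad_ae_eq_gradient (hn : n + 1 = 2 ∨ n + 1 = 3) (hU : M.IsFERep p v U) (K : ι) :
    V.grad v =ᵐ[volume.restrict (M.cell K)] gradient U := by
  obtain ⟨q, -, hq⟩ := hU.2.2 K
  filter_upwards [M.grad_ae_eq hn hU.1 hq, ae_restrict_mem (M.isOpen_cell K).measurableSet]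
    with x h1 h2
  rw [h1, M.gradient_cell hq h2]

theorem stab_eq [Fintype ι] (δ : ι → ℝ) (φ : V Ω) : M.stab ε b α f δ U φ
    = - ∑ K, δ K * ∫ x in M.cell K, cellResidual ε b α f U x * inner ℝ (b x) (V.grad φ x) := by
  rw [stab, ← Finset.sum_neg_distrib]
  refine Finset.sum_congr rfl fun K _ => ?_
  rw [← mul_neg, ← integral_neg]
  congr 1
  refine integral_congr_ae (Eventually.of_forall fun x => ?_)
  simp only [strongResidual, cellResidual]
  ring

/-- Green's formula on a cell for the diffusive flux of a finite element function. -/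
theorem green_cellFlux (hn : n + 1 = 2 ∨ n + 1 = 3) (hU : M.IsFERep p v U) (K : ι)
    {φ : E n → ℝ} (hφ : ContDiff ℝ 1 φ) :
    ∫ x in M.cell K, (inner ℝ (gradient φ x) (ε • gradient U x)
        + divergence (fun y => ε • gradient U y) x * φ x)
      = ∫ x, φ x * inner ℝ (M.cellFlux ε U K x) (M.normal K x) ∂M.surface K := by
  obtain ⟨q, -, hq⟩ := hU.2.2 K
  have hgreen := congrArg (ε * ·) (M.green_cell K hn (M.contDiffAt_refGrad K q) hφ)
  simp only [← integral_const_mul] at hgreen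
  calc _ = ∫ x in M.cell K, ε * (inner ℝ (gradient φ x) (M.refGrad K q (M.inv K x))
          + φ x * M.refDiv K (M.refGrad K q) (M.inv K x)) := by
        refine setIntegral_congr_fun (M.isOpen_cell K).measurableSet fun x hx => ?_
        simp only [M.gradient_cell hq hx, M.divergence_cell hq ε hx, inner_smul_right]
        ring
    _ = ∫ x, ε * (φ x * inner ℝ (M.refGrad K q (M.inv K x)) (M.normal K x)) ∂M.surface K := hgreen
    _ = _ := by
        refine integral_congr_ae ?_
        filter_upwards [M.ae_mem_closedCell K] with x hx
        rw [cellFlux, M.gradientWithin_closedCell hq hx, real_inner_smul_left]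
        ring

/-- Integration by parts of the diffusive term on all cells. -/
theorem sum_green_cellFlux [Fintype ι] (hn : n + 1 = 2 ∨ n + 1 = 3) (hΩ : IsOpen Ω)
    (hU : M.IsFERep p v U) (w : V Ω) {g : ι → E n → ℝ} (hg : ∀ K, M.IsTrace K w (g K)) :
    ∑ K, ((∫ x in M.cell K, inner ℝ (V.grad w x) (ε • gradient U x))
        + ∫ x in M.cell K, divergence (fun y => ε • gradient U y) x * V.val w x)
      = ∑ K, ∫ x, M.edgeResidual ε U K x * g K x ∂M.surface K := by
  obtain ⟨φ, hφ, h1, h2⟩ := exists_isTest_tendsto w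
  have hG (K : ι) : MemLp (fun x => ε • gradient U x) 2 (volume.restrict (M.cell K)) :=
    (M.memLp_gradient_cell hU K 2).const_smul ε
  have hD (K : ι) := M.memLp_divergence_cell (ε := ε) hU K 2
  have small {F : Type} [NormedAddCommGroup F] {a : ℕ → E n → F} (K : ι)
      (ha : Tendsto (fun m => eLpNorm (a m) 2 (volume.restrict Ω)) atTop (𝓝 0)) :
      Tendsto (fun m => eLpNorm (a m) 2 (volume.restrict (M.cell K))) atTop (𝓝 0) :=
    tendsto_of_tendsto_of_tendsto_of_le_of_le tendsto_const_nhds ha (fun _ => zero_le)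
      fun m => eLpNorm_mono_measure _ (M.restrict_cell_le K)
  have l1 (K : ι) := tendsto_integral_inner_of_eLpNorm
    (fun m => (hφ m).memLp_gradient 2 (volume.restrict (M.cell K)))
    (M.memLp_of_cell (memLp_grad w) K) (hG K) (small K h2)
  have l2 (K : ι) := tendsto_integral_mul_of_eLpNorm
    (fun m => (hφ m).memLp 2 (volume.restrict (M.cell K)))
    (M.memLp_of_cell (memLp_val w) K) (hD K) (small K h1)
  -- Each `g K` comes with its own approximating sequence; by `IsTrace.tendsto` the single sequence
  -- `φ` converges to all of them.
  have l3 (K : ι) := tendsto_integral_mul_of_eLpNorm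
    (fun m => (hφ m).memLp 2 (M.surface K)) (hg K).1 (M.memLp_edgeResidual (ε := ε) hU K 2)
    ((hg K).tendsto hn hφ h1 h2)
  have L := tendsto_finsetSum Finset.univ fun K _ => (l1 K).add (l2 K)
  have R := tendsto_finsetSum Finset.univ fun K _ => l3 K
  refine tendsto_nhds_unique L (R.congr fun m => ?_)
  rw [← M.sum_integral_cellFlux hn hΩ hU (hφ m)]
  refine Finset.sum_congr rfl fun K _ => ?_
  rw [← M.green_cellFlux hn hU K (hφ m).contDiff_one]
  exact integral_add
    (integrable_inner_of_memLp_two ((hφ m).memLp_gradient 2 (volume.restrict (M.cell K))) (hG K))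
    ((hD K).integrable_mul ((hφ m).memLp 2 (volume.restrict (M.cell K))))

/-- The residual of the weak form, localized to the cells. -/
theorem formF_sub_formA_eq [Fintype ι] (hn : n + 1 = 2 ∨ n + 1 = 3) (hΩ : IsOpen Ω)
    (hb : MemLp b ⊤ (volume.restrict Ω))
    (hα : MemLp α ⊤ (volume.restrict Ω)) (hf : MemLp f 2 (volume.restrict Ω))
    (hU : M.IsFERep p v U) (w : V Ω) {g : ι → E n → ℝ} (hg : ∀ K, M.IsTrace K w (g K)) :
    formF f w - formA ε b α v w
      = ∑ K, ((∫ x in M.cell K, cellResidual ε b α f U x * V.val w x)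
        - ∫ x, M.edgeResidual ε U K x * g K x ∂M.surface K) := by
  have i1 : IntegrableOn (fun x => f x * V.val w x) Ω := hf.integrable_mul (memLp_val w)
  have i2 := integrable_diffusion ε v w
  have i3 := integrable_convection hb v w
  have i4 := integrable_reaction hα v w
  have i12 : IntegrableOn
      (fun x => f x * V.val w x - inner ℝ (ε • V.grad v x) (V.grad w x)) Ω := i1.sub i2
  have i123 : IntegrableOn (fun x => f x * V.val w x - inner ℝ (ε • V.grad v x) (V.grad w x)
      - inner ℝ (b x) (V.grad v x) * V.val w x) Ω := i12.sub i3
  have i1234 : IntegrableOn (fun x => f x * V.val w x - inner ℝ (ε • V.grad v x) (V.grad w x)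
      - inner ℝ (b x) (V.grad v x) * V.val w x - α x * V.val v x * V.val w x) Ω := i123.sub i4
  have hsum : formF f w - formA ε b α v w = ∫ x in Ω, (f x * V.val w x
      - inner ℝ (ε • V.grad v x) (V.grad w x) - inner ℝ (b x) (V.grad v x) * V.val w x
      - α x * V.val v x * V.val w x) := by
    rw [integral_sub i123 i4, integral_sub i12 i3, integral_sub i1 i2, formF, formA]
    ring
  rw [hsum, M.setIntegral_eq_sum i1234, Finset.sum_sub_distrib,
    ← M.sum_green_cellFlux hn hΩ hU w hg, ← Finset.sum_sub_distrib]
  refine Finset.sum_congr rfl fun K _ => ?_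
  have j1 := (M.memLp_cellResidual (ε := ε) hb hα hf hU K).integrable_mul
    (M.memLp_of_cell (memLp_val w) K)
  have j2 := integrable_inner_of_memLp_two (M.memLp_of_cell (memLp_grad w) K)
    ((M.memLp_gradient_cell hU K 2).const_smul ε)
  have j3 := (M.memLp_divergence_cell (ε := ε) hU K 2).integrable_mul
    (M.memLp_of_cell (memLp_val w) K)
  -- Taking the diffusive terms off the cell residual leaves an integrand that agrees almost
  -- everywhere with that of the weak form, where weak and classical gradients of the discrete
  -- function coincide.
  have e : ∫ x in M.cell K, (cellResidual ε b α f U x * V.val w x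
      - (inner ℝ (V.grad w x) (ε • gradient U x)
        + divergence (fun y => ε • gradient U y) x * V.val w x))
      = (∫ x in M.cell K, cellResidual ε b α f U x * V.val w x)
      - ((∫ x in M.cell K, inner ℝ (V.grad w x) (ε • gradient U x))
        + ∫ x in M.cell K, divergence (fun y => ε • gradient U y) x * V.val w x) :=
    (integral_sub j1 (j2.add j3)).trans (congrArg _ (integral_add j2 j3))
  rw [← e]
  refine integral_congr_ae ?_
  filter_upwards [M.grad_ae_eq_gradient hn hU K, ae_mono (M.restrict_cell_le K) hU.1] with x h1 h2
  rw [h1, h2, cellResidual, real_inner_comm]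
  ring

end Mesh

theorem sub_eq_add_neg_one_smul {W : Type*} [AddCommGroup W] [Module ℝ W] (x y : W) :
    x - y = x + (-1 : ℝ) • y := by
  rw [neg_one_smul, sub_eq_add_neg]

section Linearity

variable {n : ℕ} {Ω : Set (E n)} {ε : ℝ} {b : E n → E n} {α f : E n → ℝ}

theorem formA_sub_left (hb : MemLp b ⊤ (volume.restrict Ω)) (hα : MemLp α ⊤ (volume.restrict Ω))
    (u v φ : V Ω) : formA ε b α (u - v) φ = formA ε b α u φ - formA ε b α v φ := by
  rw [sub_eq_add_neg_one_smul u v, formA_add_smul_left hb hα]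
  ring

theorem formA_sub_right (hb : MemLp b ⊤ (volume.restrict Ω)) (hα : MemLp α ⊤ (volume.restrict Ω))
    (u φ ψ : V Ω) : formA ε b α u (φ - ψ) = formA ε b α u φ - formA ε b α u ψ := by
  rw [sub_eq_add_neg_one_smul φ ψ, formA_add_smul_right hb hα]
  ring

theorem formF_sub (hf : MemLp f 2 (volume.restrict Ω)) (φ ψ : V Ω) :
    formF f (φ - ψ) = formF f φ - formF f ψ := by
  rw [sub_eq_add_neg_one_smul φ ψ, formF_add_smul hf]
  ring

end Linearity

theorem differentiable_of_iteratedFDeriv_zero {W : Type*} [NormedAddCommGroup W]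
    [NormedSpace ℝ W] {J : W → ℝ} (h : Differentiable ℝ (iteratedFDeriv ℝ 0 J)) :
    Differentiable ℝ J := by
  rw [iteratedFDeriv_zero_eq_comp] at h
  exact ((continuousMultilinearCurryFin0 ℝ W ℝ).symm.comp_differentiable_iff).1 h

end SUPG

/-! ### The error representation -/

theorem theorem4 {n : ℕ} (hn : n + 1 = 2 ∨ n + 1 = 3) {Ω : Set (SUPG.E n)} (hΩ : IsOpen Ω)
    {ι : Type*} [Fintype ι] (M : SUPG.Mesh Ω ι)
    -- data of the convection-diffusion-reaction problem
    (ε : ℝ) (hε : 0 < ε) (b : SUPG.E n → SUPG.E n) (hb : MemLp b ⊤ (volume.restrict Ω))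
    (α : SUPG.E n → ℝ) (hα : MemLp α ⊤ (volume.restrict Ω))
    (f : SUPG.E n → ℝ) (hf : MemLp f 2 (volume.restrict Ω))
    -- a three times differentiable target functional
    (J : SUPG.V Ω → ℝ) (hJ : ∀ k < 3, Differentiable ℝ (iteratedFDeriv ℝ k J))
    -- a stationary point of the Lagrangian functional
    (u z : SUPG.V Ω)
    (huz : HasFDerivAt (SUPG.lagrangian ε b α f J) (0 : SUPG.V Ω × SUPG.V Ω →L[ℝ] ℝ) (u, z))
    -- the stabilized discrete solution, with its continuous representative
    (p : ℕ) (δ : ι → ℝ) (uh : SUPG.V Ω) (Uh : SUPG.E n → ℝ)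
    (huh : M.IsDiscreteSol p ε b α f δ uh Uh)
    -- the integral that defines the cubic remainder exists
    (hR : IntervalIntegrable (fun s : ℝ =>
      SUPG.dirDeriv 3 J (uh + s • (u - uh)) (u - uh) * s * (s - 1)) volume 0 1)
    (φh : SUPG.V Ω) (hφh : φh ∈ M.feSpace p) :
    -- the weight `z - φh` has a trace on each cell boundary
    (∀ K, ∃ g : SUPG.E n → ℝ, M.IsTrace K (z - φh) g) ∧
    (∀ g : ι → SUPG.E n → ℝ, (∀ K, M.IsTrace K (z - φh) (g K)) →
      -- all the terms are well defined
      (∀ K,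
        IntegrableOn (fun x => SUPG.cellResidual ε b α f Uh x * SUPG.V.val (z - φh) x)
          (M.cell K) ∧
        IntegrableOn
          (fun x => SUPG.cellResidual ε b α f Uh x * inner ℝ (b x) (SUPG.V.grad φh x))
          (M.cell K) ∧
        Integrable (fun x => M.edgeResidual ε Uh K x * g K x) (M.surface K)) ∧
      -- the error representation
      J u - J uh =
        (∑ K,
          ((∫ x in M.cell K, SUPG.cellResidual ε b α f Uh x * SUPG.V.val (z - φh) x)
            - δ K * (∫ x in M.cell K,
                SUPG.cellResidual ε b α f Uh x * inner ℝ (b x) (SUPG.V.grad φh x))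
            - ∫ x, M.edgeResidual ε Uh K x * g K x ∂(M.surface K)))
        + (SUPG.remainderJ J u uh + (1 / 2) * SUPG.deltaRho J u uh)) ∧
    -- the neglected terms are of second and third order in the error
    (∀ C : ℝ, (∀ s ∈ Icc (0 : ℝ) 1, ‖iteratedFDeriv ℝ 2 J (uh + s • (u - uh))‖ ≤ C) →
      |(1 / 2) * SUPG.deltaRho J u uh| ≤ C / 2 * ‖u - uh‖ ^ 2) ∧
    (∀ C : ℝ, (∀ s ∈ Icc (0 : ℝ) 1, ‖iteratedFDeriv ℝ 3 J (uh + s • (u - uh))‖ ≤ C) →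
      |SUPG.remainderJ J u uh| ≤ C / 12 * ‖u - uh‖ ^ 3) := by
  refine ⟨fun K => M.exists_isTrace hn (z - φh), fun g hg => ⟨fun K => ⟨?_, ?_, ?_⟩, ?_⟩,
    fun C hC => SUPG.abs_half_deltaRho_le hC, fun C hC => SUPG.abs_remainderJ_le hC⟩
  · exact (M.memLp_cellResidual hb hα hf huh.1 K).integrable_mul
      (M.memLp_of_cell (SUPG.memLp_val _) K)
  · exact (M.memLp_cellResidual hb hα hf huh.1 K).integrable_mul
      (SUPG.memLp_inner_top (M.memLp_of_cell hb K) (M.memLp_of_cell (SUPG.memLp_grad _) K))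
  · exact (M.memLp_edgeResidual huh.1 K 2).integrable_mul (hg K).1
  · have hJd : Differentiable ℝ J :=
      SUPG.differentiable_of_iteratedFDeriv_zero (hJ 0 (by norm_num))
    have htaylor := SUPG.sub_eq_fderiv_add_remainder hJ u uh hR
    have hdual := SUPG.fderiv_eq_formA_of_stationary hb hα (hJd u) huz (u - uh)
    have hprimal := SUPG.formA_eq_formF_of_stationary hb hα hf huz z
    have hsub := SUPG.formA_sub_left (ε := ε) hb hα u uh z
    have hsubz := SUPG.formA_sub_right (ε := ε) hb hα uh z φh
    have hsubF := SUPG.formF_sub hf z φh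
    have hdisc := huh.2 φh hφh
    rw [M.stab_eq] at hdisc
    have hloc := M.formF_sub_formA_eq (ε := ε) hn hΩ hb hα hf huh.1 (z - φh) hg
    -- With `F = A(u)` this is `A(u - u_h)(z) = F(z) - A(u_h)(z)`. Splitting `z = (z - φ_h) + φ_h`,
    -- the first part is localized by `hloc` and the second is the stabilization term by `hdisc`;
    -- the rest is linear arithmetic.
    rw [htaylor, hdual]
    simp only [Finset.sum_sub_distrib] at hloc ⊢
    linarith
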